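/- For a link $L\subset\mathbb{R}^3$ with components $L_1,\dots,L_k$ (pairwise disjoint simple closed curves), the mod 2 linking pattern of $L$ is the graph with vertices $v_1,\dots,v_k$ in which distinct $v_i$ and $v_j$ are joined by an edge if and only if the mod 2 linking number $\omega(L_i,L_j)=\mathrm{lk}(L_i,L_j)\bmod 2$ equals $1$. (For continuous closed curves, $\mathrm{lk}(L_i,L_j)$ is the linking number of any sufficiently close polygonal approximations of $L_i$ and $L_j$.) For every $n\in\mathbb{N}$ there is a finite graph $G$ such that, for every topological embedding $f$ of $G$ in $\mathbb{R}^3$, the image $f(G)$ contains a link whose mod 2 linking pattern contains the complete bipartite graph $K_{n,n}$ as a (not necessarily induced) subgraph. In other words, $f(G)$ contains $2n$ pairwise disjoint simple closed curves $Z_1,\dots,Z_n,X_1,\dots,X_n$ such that $\mathrm{lk}(Z_i,X_j)$ is odd for all $i,j\in\{1,\dots,n\}$. -/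

import Mathlib

noncomputable section

namespace SpatialGraph

/-- Euclidean 3-space. -/
abbrev R3 := EuclideanSpace ℝ (Fin 3)

/-- A parametrized closed curve in Euclidean 3-space. -/
abbrev ClosedCurve := C(UnitAddCircle, R3)

/-- The geometric realization of a finite graph: the union of the standard basis vectors of `ℝ ^ V`
(the vertices) and the segments joining two adjacent ones (the edges), with the subspace
topology. -/
def realization {V : Type} [Fintype V] [DecidableEq V] (G : SimpleGraph V) : Set (V → ℝ) :=
  {x | (∃ v, x = Pi.single v 1) ∨
    ∃ u v, G.Adj u v ∧ x ∈ segment ℝ (Pi.single u (1 : ℝ)) (Pi.single v (1 : ℝ))}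

/-- A closed polygon: its vertices are `vertex 0, …, vertex length = vertex 0`, and its edges are
the segments from `vertex k` to `vertex (k + 1)` for `k < length`. -/
structure ClosedPolygon where
  length : ℕ
  length_pos : 0 < length
  vertex : ℕ → R3
  closed : vertex length = vertex 0

/-- The closed polygon `P`, parametrized by running through its edges at equal times, is uniformly
`ε`-close to the closed curve `γ`. -/
def ClosedPolygon.Approximates (P : ClosedPolygon) (ε : ℝ) (γ : ClosedCurve) : Prop :=
  ∀ k < P.length, ∀ s ∈ Set.Icc (0 : ℝ) 1,
    dist (AffineMap.lineMap (P.vertex k) (P.vertex (k + 1)) s)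
      (γ ((((k : ℝ) + s) / (P.length : ℝ) : ℝ) : UnitAddCircle)) < ε

/-- `x` and `y` have the same projection to the horizontal plane. -/
def SameProjection (x y : R3) : Prop := x 0 = y 0 ∧ x 1 = y 1

/-- `P` and `Q` have a regular diagram (as far as crossings between `P` and `Q` are concerned): no
vertex of one of them has the same projection as a point of the other one. Then the projections of
an edge of `P` and an edge of `Q` are disjoint or cross transversally in exactly one point. -/
def RegularDiagram (P Q : ClosedPolygon) : Prop :=
  (∀ i < P.length, ∀ j < Q.length, ∀ y ∈ segment ℝ (Q.vertex j) (Q.vertex (j + 1)),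
    ¬ SameProjection (P.vertex i) y) ∧
  (∀ i < P.length, ∀ j < Q.length, ∀ x ∈ segment ℝ (P.vertex i) (P.vertex (i + 1)),
    ¬ SameProjection x (Q.vertex j))

/-- In the diagram, the segment from `a` to `b` crosses over the segment from `c` to `d`. -/
def CrossesOver (a b c d : R3) : Prop :=
  ∃ x ∈ segment ℝ a b, ∃ y ∈ segment ℝ c d, SameProjection x y ∧ y 2 < x 2

/-- The sign (`1` or `-1`) of a transversal crossing of the segment from `a` to `b` over the segment
from `c` to `d`. -/
def crossingSign (a b c d : R3) : ℤ :=
  (SignType.sign ((b 0 - a 0) * (d 1 - c 1) - (b 1 - a 1) * (d 0 - c 0)) : ℤ)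

open Classical in
/-- The linking number of two disjoint closed polygons with a regular diagram: the sum of the signs
of the crossings at which `P` passes over `Q`. -/
def ClosedPolygon.lk (P Q : ClosedPolygon) : ℤ :=
  ∑ i ∈ Finset.range P.length, ∑ j ∈ Finset.range Q.length,
    if CrossesOver (P.vertex i) (P.vertex (i + 1)) (Q.vertex j) (Q.vertex (j + 1)) then
      crossingSign (P.vertex i) (P.vertex (i + 1)) (Q.vertex j) (Q.vertex (j + 1))
    else 0

/-- `w` is the mod 2 linking number of the disjoint closed curves `γ` and `δ`: the linking number of
any sufficiently close polygonal approximations of `γ` and `δ` with a regular diagram is `w`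
modulo 2. -/
def HasMod2LinkingNumber (γ δ : ClosedCurve) (w : ZMod 2) : Prop :=
  ∃ ε > 0, ∀ P Q : ClosedPolygon, P.Approximates ε γ → Q.Approximates ε δ →
    RegularDiagram P Q → (P.lk Q : ZMod 2) = w

/-- The closed curves `L i` are the components of a link: they are simple and pairwise disjoint. -/
def IsLink {ι : Type} (L : ι → ClosedCurve) : Prop :=
  (∀ i, Function.Injective (L i)) ∧
    ∀ i j, i ≠ j → Disjoint (Set.range (L i)) (Set.range (L j))

/-- The mod 2 linking pattern of a link: one vertex for each component, and an edge between two
components if and only if their mod 2 linking number is `1` (a symmetric condition on disjoint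
curves). -/
def mod2LinkingPattern {ι : Type} (L : ι → ClosedCurve) : SimpleGraph ι :=
  SimpleGraph.fromRel fun i j => HasMod2LinkingNumber (L i) (L j) 1

end SpatialGraph

end

noncomputable section

namespace SpatialGraph

/-! ### Counting mod 2 how one segment passes over another along a direction -/

open MeasureTheory Filter Topology

/-- Some point of the segment `[a, b]` lies over some point of the segment `[c, d]` with respect
to the direction `u`. -/
def Over (u a b c d : R3) : Prop :=
  ∃ x ∈ segment ℝ a b, ∃ y ∈ segment ℝ c d, ∃ t : ℝ, 0 < t ∧ x - y = t • u

open Classical in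
/-- The mod 2 indicator of `Over`. -/
def overCount (u a b c d : R3) : ZMod 2 := if Over u a b c d then 1 else 0

/-- `u` lies in the closed convex cone spanned by `p`, `q`, `r`. -/
def InCone (u p q r : R3) : Prop :=
  ∃ α β γ : ℝ, 0 ≤ α ∧ 0 ≤ β ∧ 0 ≤ γ ∧ u = α • p + β • q + γ • r

open Classical in
/-- The mod 2 indicator of `InCone`. -/
def cone (u p q r : R3) : ZMod 2 := if InCone u p q r then 1 else 0

lemma inCone_swap_left {u p q r : R3} : InCone u p q r ↔ InCone u q p r := by
  constructor <;> rintro ⟨α, β, γ, h1, h2, h3, h⟩ <;>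
    exact ⟨β, α, γ, h2, h1, h3, by rw [h]; abel⟩

lemma inCone_swap_right {u p q r : R3} : InCone u p q r ↔ InCone u p r q := by
  constructor <;> rintro ⟨α, β, γ, h1, h2, h3, h⟩ <;>
    exact ⟨α, γ, β, h1, h3, h2, by rw [h]; abel⟩

open Classical in
lemma cone_swap_left (u p q r : R3) : cone u p q r = cone u q p r :=
  if_congr inCone_swap_left rfl rfl

open Classical in
lemma cone_swap_right (u p q r : R3) : cone u p q r = cone u p r q :=
  if_congr inCone_swap_right rfl rfl

lemma notMem_span_pair {u p q : R3} (h : u ∉ Submodule.span ℝ {p, q}) (a b : ℝ) :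
    u ≠ a • p + b • q := fun e => h (Submodule.mem_span_pair.2 ⟨a, b, e.symm⟩)

lemma ae_notMem_submodule {W : Submodule ℝ R3} (hW : W ≠ ⊤) : ∀ᵐ u : R3, u ∉ W := by
  have := Measure.addHaar_submodule (volume : Measure R3) W hW
  exact measure_eq_zero_iff_ae_notMem.1 this

lemma ae_notMem_span_pair (p q : R3) : ∀ᵐ u : R3, u ∉ Submodule.span ℝ {p, q} := by
  classical
  apply ae_notMem_submodule
  intro h
  have h1 : Module.finrank ℝ (Submodule.span ℝ (({p, q} : Finset R3) : Set R3)) ≤ _ :=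
    finrank_span_finset_le_card (R := ℝ) ({p, q} : Finset R3)
  have h2 : ({p, q} : Finset R3).card ≤ 2 := Finset.card_le_two
  rw [Finset.coe_pair, h, finrank_top, finrank_euclideanSpace, Fintype.card_fin] at h1
  omega

open Classical in
lemma sum_indicator_eq_one {A B C : Prop} (hAB : ¬(A ∧ B)) (hAC : ¬(A ∧ C)) (hBC : ¬(B ∧ C))
    (h : A ∨ B ∨ C) :
    (if A then 1 else 0) + (if B then 1 else 0) + (if C then 1 else 0) = (1 : ZMod 2) := by
  by_cases a : A <;> by_cases b : B <;> by_cases c : C <;> simp_all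

/-- Here `x`, `y`, `z` are the coordinates of `s` relative to those of `u`. A combination of `q`,
`r`, `s` equal to `u` must use `s` with coefficient `1 / x`, which leaves `β * (1 - y / x)` and `γ *
(1 - z / x)` for the other two. So the cone over a face through `s` contains `u` exactly when the
ratio of the omitted vertex is positive and maximal. -/
lemma inCone_face_iff {u p q r s : R3} {α β γ x y z : ℝ}
    (key : ∀ a b c : ℝ, a • p + b • q + c • r = 0 → a = 0 ∧ b = 0 ∧ c = 0)
    (hα : 0 < α) (hβ : 0 < β) (hγ : 0 < γ) (hu : u = α • p + β • q + γ • r)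
    (hs : s = (x * α) • p + (y * β) • q + (z * γ) • r) :
    InCone u q r s ↔ 0 < x ∧ y ≤ x ∧ z ≤ x := by
  constructor
  · rintro ⟨b, c, d, hb, hc, hd, e⟩
    obtain ⟨h1, h2, h3⟩ := key (d * (x * α) - α) (b + d * (y * β) - β) (c + d * (z * γ) - γ) (by
      rw [← sub_eq_zero.2 e.symm, hs, hu]
      module)
    have hdx : d * x = 1 := by
      have : (d * x - 1) * α = 0 := by linarith
      rcases mul_eq_zero.1 this with h | h <;> linarith
    have hx0 : 0 < x := by
      by_contra! hx0
      nlinarith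
    have hd0 : 0 < d := by
      rcases hd.eq_or_lt with e | e
      · rw [← e] at hdx; simp at hdx
      · exact e
    refine ⟨hx0, ?_, ?_⟩
    · by_contra! hlt
      have : 1 < d * y := by nlinarith
      nlinarith
    · by_contra! hlt
      have : 1 < d * z := by nlinarith
      nlinarith
  · rintro ⟨hx0, hy0, hz0⟩
    obtain ⟨i, hi⟩ : ∃ i, i * x = 1 := ⟨x⁻¹, inv_mul_cancel₀ hx0.ne'⟩
    have hi0 : 0 < i := by
      by_contra! h
      nlinarith
    refine ⟨β * (1 - i * y), γ * (1 - i * z), i, ?_, ?_, hi0.le, ?_⟩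
    · exact mul_nonneg hβ.le (by nlinarith)
    · exact mul_nonneg hγ.le (by nlinarith)
    · rw [hs, hu]
      match_scalars
      · linear_combination -α * hi
      · ring
      · ring

/-- Genericity rules out ties between positive ratios, so that the maximal ratio of
`inCone_face_iff` is attained only once. -/
lemma tie_mem_span {u p q r s : R3} {α β γ x y z : ℝ}
    (hrs : u ∉ Submodule.span ℝ {r, s}) (hu : u = α • p + β • q + γ • r)
    (hs : s = (x * α) • p + (y * β) • q + (z * γ) • r) (e : x = y) : x ≤ 0 := by
  by_contra! hp
  obtain ⟨i, hi⟩ : ∃ i, i * x = 1 := ⟨x⁻¹, inv_mul_cancel₀ hp.ne'⟩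
  refine notMem_span_pair hrs (γ - i * z * γ) i ?_
  rw [hs, hu, ← e]
  match_scalars
  · linear_combination -α * hi
  · linear_combination -β * hi
  · ring

lemma eq_zero_of_notMem_span {u p q r : R3} {α β γ a b c : ℝ} (hqr : u ∉ Submodule.span ℝ {q, r})
    (hu : u = α • p + β • q + γ • r) (h : a • p + b • q + c • r = 0) : a = 0 := by
  by_contra ha
  obtain ⟨i, hi⟩ : ∃ i, i * a = 1 := ⟨a⁻¹, inv_mul_cancel₀ ha⟩
  refine notMem_span_pair hqr (β - α * (i * b)) (γ - α * (i * c)) ?_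
  rw [hu, ← sub_eq_zero]
  have : (α * i) • (a • p + b • q + c • r) = 0 := by rw [h, smul_zero]
  rw [← this]
  match_scalars
  · linear_combination -α * hi
  · ring
  · ring

lemma cone_linearIndependent {u p q r : R3} {α β γ : ℝ} (hpq : u ∉ Submodule.span ℝ {p, q})
    (hpr : u ∉ Submodule.span ℝ {p, r}) (hqr : u ∉ Submodule.span ℝ {q, r})
    (hu : u = α • p + β • q + γ • r) (a b c : ℝ) (h : a • p + b • q + c • r = 0) :
    a = 0 ∧ b = 0 ∧ c = 0 := by
  refine ⟨eq_zero_of_notMem_span hqr hu h,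
    eq_zero_of_notMem_span (p := q) (α := β) (β := α) (γ := γ) (b := a) (c := c) hpr ?_ ?_,
    eq_zero_of_notMem_span (p := r) (α := γ) (β := α) (γ := β) (b := a) (c := b) hpq ?_ ?_⟩
  · rw [hu]; abel
  · rw [← h]; abel
  · rw [hu]; abel
  · rw [← h]; abel

/-- If `u` lies in the cone over one face of a tetrahedron not containing `0`, then it lies in the
cone over exactly one of the other faces. -/
lemma cone_other_faces {u p q r s : R3} (hpq : u ∉ Submodule.span ℝ {p, q})
    (hpr : u ∉ Submodule.span ℝ {p, r}) (hqr : u ∉ Submodule.span ℝ {q, r})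
    (hps : u ∉ Submodule.span ℝ {p, s}) (hqs : u ∉ Submodule.span ℝ {q, s})
    (hrs : u ∉ Submodule.span ℝ {r, s})
    (h0 : ∀ a b c d : ℝ, 0 ≤ a → 0 ≤ b → 0 ≤ c → 0 ≤ d → a + b + c + d = 1 →
      a • p + b • q + c • r + d • s ≠ 0) (h : InCone u p q r) :
    cone u q r s + cone u p r s + cone u p q s = 1 := by
  obtain ⟨α, β, γ, hα, hβ, hγ, hu⟩ := h
  have hα' : 0 < α := by
    rcases hα.eq_or_lt with e | e
    · exact absurd (by rw [hu, ← e]; simp) (notMem_span_pair hqr β γ)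
    · exact e
  have hβ' : 0 < β := by
    rcases hβ.eq_or_lt with e | e
    · exact absurd (by rw [hu, ← e]; simp) (notMem_span_pair hpr α γ)
    · exact e
  have hγ' : 0 < γ := by
    rcases hγ.eq_or_lt with e | e
    · exact absurd (by rw [hu, ← e]; simp) (notMem_span_pair hpq α β)
    · exact e
  have key := cone_linearIndependent hpq hpr hqr hu
  have hli : LinearIndependent ℝ ![p, q, r] := by
    rw [Fintype.linearIndependent_iff]
    intro g hg
    simp only [Fin.sum_univ_three, Matrix.cons_val_zero, Matrix.cons_val_one,
      Matrix.cons_val] at hg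
    obtain ⟨h1, h2, h3⟩ := key _ _ _ hg
    intro i
    fin_cases i <;> assumption
  have hsp : s ∈ Submodule.span ℝ (Set.range ![p, q, r]) := by
    rw [hli.span_eq_top_of_card_eq_finrank' (by simp)]
    trivial
  obtain ⟨g, hg⟩ := (Submodule.mem_span_range_iff_exists_fun ℝ).1 hsp
  simp only [Fin.sum_univ_three, Matrix.cons_val_zero, Matrix.cons_val_one,
      Matrix.cons_val] at hg
  obtain ⟨x, hx⟩ : ∃ x, x * α = g 0 := ⟨g 0 / α, by field_simp⟩
  obtain ⟨y, hy⟩ : ∃ y, y * β = g 1 := ⟨g 1 / β, by field_simp⟩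
  obtain ⟨z, hz⟩ : ∃ z, z * γ = g 2 := ⟨g 2 / γ, by field_simp⟩
  rw [← hx, ← hy, ← hz] at hg
  -- Otherwise `s` is minus a nonnegative combination of `p`, `q`, `r`, and normalizing by the total
  -- weight exhibits 0 as a point of the tetrahedron.
  have hpos : 0 < x ∨ 0 < y ∨ 0 < z := by
    by_contra! hneg
    obtain ⟨h1, h2, h3⟩ := hneg
    have i1 : 0 ≤ -(x * α) := by nlinarith
    have i2 : 0 ≤ -(y * β) := by nlinarith
    have i3 : 0 ≤ -(z * γ) := by nlinarith
    obtain ⟨i, hi⟩ : ∃ i, i * (1 - x * α - y * β - z * γ) = 1 :=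
      ⟨(1 - x * α - y * β - z * γ)⁻¹, inv_mul_cancel₀ (by linarith)⟩
    have hi0 : 0 ≤ i := by
      by_contra! h
      nlinarith
    refine h0 (i * -(x * α)) (i * -(y * β)) (i * -(z * γ)) i (by positivity) (by positivity)
      (by positivity) hi0 (by linarith) ?_
    rw [← hg]
    module
  have A := inCone_face_iff key hα' hβ' hγ' hu hg.symm
  have B := inCone_face_iff (p := q) (q := p) (r := r) (s := s)
    (fun a b c e => by obtain ⟨h1, h2, h3⟩ := key b a c (by rw [← e]; abel); exact ⟨h2, h1, h3⟩)
    hβ' hα' hγ' (hu.trans (by abel)) (hg.symm.trans (by abel))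
  have C := inCone_face_iff (p := r) (q := p) (r := q) (s := s)
    (fun a b c e => by obtain ⟨h1, h2, h3⟩ := key b c a (by rw [← e]; abel); exact ⟨h3, h1, h2⟩)
    hγ' hα' hβ' (hu.trans (by abel)) (hg.symm.trans (by abel))
  have nxy : x = y → x ≤ 0 := tie_mem_span hrs hu hg.symm
  have nxz : x = z → x ≤ 0 := tie_mem_span (p := p) (q := r) (r := q) (s := s) hqs
    (hu.trans (by abel)) (hg.symm.trans (by abel))
  have nyz : y = z → y ≤ 0 := tie_mem_span (p := q) (q := r) (r := p) (s := s) hps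
    (hu.trans (by abel)) (hg.symm.trans (by abel))
  have nx : ¬(InCone u q r s ∧ InCone u p r s) := by
    rw [A, B]; rintro ⟨⟨h1, h2, h3⟩, h4, h5, h6⟩
    linarith [nxy (le_antisymm h5 h2)]
  have ny : ¬(InCone u q r s ∧ InCone u p q s) := by
    rw [A, C]; rintro ⟨⟨h1, h2, h3⟩, h4, h5, h6⟩
    linarith [nxz (le_antisymm h5 h3)]
  have nz : ¬(InCone u p r s ∧ InCone u p q s) := by
    rw [B, C]; rintro ⟨⟨h1, h2, h3⟩, h4, h5, h6⟩
    linarith [nyz (le_antisymm h6 h3)]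
  have ex : InCone u q r s ∨ InCone u p r s ∨ InCone u p q s := by
    rw [A, B, C]
    by_cases h1 : y ≤ x ∧ z ≤ x
    · exact Or.inl ⟨by rcases hpos with h | h | h <;> linarith, h1.1, h1.2⟩
    by_cases h2 : x ≤ y ∧ z ≤ y
    · exact Or.inr (Or.inl ⟨by rcases hpos with h | h | h <;> linarith, h2.1, h2.2⟩)
    have h3 : x ≤ z ∧ y ≤ z := by
      rw [not_and_or, not_le, not_le] at h1 h2
      rcases h1 with h1 | h1 <;> rcases h2 with h2 | h2 <;> constructor <;> linarith
    exact Or.inr (Or.inr ⟨by rcases hpos with h | h | h <;> linarith, h3.1, h3.2⟩)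
  exact sum_indicator_eq_one nx ny nz ex

/-- The cones over the faces of a tetrahedron not containing `0` cover a generic direction an even
number of times. -/
lemma cone_tetrahedron {u p q r s : R3} (hpq : u ∉ Submodule.span ℝ {p, q})
    (hpr : u ∉ Submodule.span ℝ {p, r}) (hqr : u ∉ Submodule.span ℝ {q, r})
    (hps : u ∉ Submodule.span ℝ {p, s}) (hqs : u ∉ Submodule.span ℝ {q, s})
    (hrs : u ∉ Submodule.span ℝ {r, s})
    (h0 : ∀ a b c d : ℝ, 0 ≤ a → 0 ≤ b → 0 ≤ c → 0 ≤ d → a + b + c + d = 1 →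
      a • p + b • q + c • r + d • s ≠ 0) :
    cone u p q r + cone u q r s + cone u p r s + cone u p q s = 0 := by
  have sw : ∀ p q : R3, Submodule.span ℝ {p, q} = Submodule.span ℝ {q, p} := fun p q => by
    rw [Set.pair_comm]
  have one : ∀ {u p q r : R3}, InCone u p q r → cone u p q r = 1 := fun h => if_pos h
  have z2 : (1 : ZMod 2) + 1 = 0 := rfl
  -- If some face cone contains `u`, rename the vertices so that it is the first one; exactly one
  -- further face then contributes, and `1 + 1 = 0`.
  by_cases h1 : InCone u p q r
  · rw [add_assoc, add_assoc, ← add_assoc (cone u q r s),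
      cone_other_faces hpq hpr hqr hps hqs hrs h0 h1, one h1, z2]
  by_cases h2 : InCone u q r s
  · have := cone_other_faces (u := u) (p := q) (q := r) (r := s) (s := p) hqr hqs hrs
      (by rwa [sw]) (by rwa [sw]) (by rwa [sw])
      (fun a b c d ha hb hc hd hs e => h0 d a b c hd ha hb hc (by linarith) (by rw [← e]; abel)) h2
    rw [cone_swap_right _ r, cone_swap_left _ r, cone_swap_right _ q s, cone_swap_left _ q p,
      cone_swap_right _ q r, cone_swap_left _ q p] at this
    rw [one h2]
    linear_combination this + z2
  by_cases h3 : InCone u p r s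
  · have := cone_other_faces (u := u) (p := p) (q := r) (r := s) (s := q) hpr hps hrs
      hpq (by rwa [sw]) (by rwa [sw])
      (fun a b c d ha hb hc hd hs e => h0 a d b c ha hd hb hc (by linarith) (by rw [← e]; abel)) h3
    rw [cone_swap_right _ r, cone_swap_left _ r, cone_swap_right _ p s, 
      cone_swap_right _ p r] at this
    rw [one h3]
    linear_combination this + z2
  by_cases h4 : InCone u p q s
  · have := cone_other_faces (u := u) (p := p) (q := q) (r := s) (s := r) hpq hps hqs
      hpr hqr (by rwa [sw])
      (fun a b c d ha hb hc hd hs e => h0 a b d c ha hb hd hc (by linarith) (by rw [← e]; abel)) h4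
    rw [cone_swap_right _ q, cone_swap_right _ p s] at this
    rw [one h4]
    linear_combination this + z2
  simp [cone, h1, h2, h3, h4]

lemma over_swap {u a b c d : R3} : Over u a b c d ↔ Over (-u) c d a b := by
  constructor <;> rintro ⟨x, hx, y, hy, t, ht, h⟩ <;> refine ⟨y, hy, x, hx, t, ht, ?_⟩
  · rw [smul_neg, ← h]; abel
  · rw [← neg_sub, h]; simp

lemma over_symm_left {u a b c d : R3} : Over u a b c d ↔ Over u b a c d := by
  simp only [Over, segment_symm ℝ a b]

open Classical in
lemma overCount_swap (u a b c d : R3) : overCount u a b c d = overCount (-u) c d a b :=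
  if_congr over_swap rfl rfl

open Classical in
lemma overCount_symm_left (u a b c d : R3) : overCount u a b c d = overCount u b a c d :=
  if_congr over_symm_left rfl rfl

/-- The differences `x - y` fill the parallelogram with vertices `a - c`, `b - c`, `b - d`, `a - d`,
and the two triangles are its halves on either side of the diagonal from `a - c` to `b - d`. -/
lemma over_iff_inCone_or {u a b c d : R3} (hu : u ≠ 0) :
    Over u a b c d ↔ InCone u (a - c) (b - c) (b - d) ∨ InCone u (a - c) (a - d) (b - d) := by
  constructor
  · rintro ⟨x, ⟨a1, b1, ha1, hb1, hab, rfl⟩, y, ⟨c1, d1, hc1, hd1, hcd, rfl⟩, t, ht, h⟩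
    obtain ⟨i, hi⟩ : ∃ i, i * t = 1 := ⟨t⁻¹, inv_mul_cancel₀ ht.ne'⟩
    have hi0 : 0 ≤ i := by
      by_contra! h
      nlinarith
    have hu' : u = i • (a1 • a + b1 • b - (c1 • c + d1 • d)) := by
      rw [h, smul_smul, hi, one_smul]
    have ea : a1 = 1 - b1 := by linarith
    have ec : c1 = 1 - d1 := by linarith
    -- The comparison of the two parameters decides on which side of the diagonal the difference
    -- lies.
    rcases le_total d1 b1 with hle | hle
    · left
      refine ⟨i * a1, i * (b1 - d1), i * d1, by positivity, mul_nonneg hi0 (by linarith),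
        by positivity, ?_⟩
      rw [hu', ea, ec]
      module
    · right
      refine ⟨i * c1, i * (d1 - b1), i * b1, by positivity, mul_nonneg hi0 (by linarith),
        by positivity, ?_⟩
      rw [hu', ea, ec]
      module
  · have pos : ∀ {α β γ : ℝ} {p q r : R3}, 0 ≤ α → 0 ≤ β → 0 ≤ γ →
        u = α • p + β • q + γ • r → ∃ i, 0 < i ∧ i * (α + β + γ) = 1 := by
      intro α β γ p q r hα hβ hγ h
      have h0 : 0 < α + β + γ := by
        by_contra! hle
        apply hu
        rw [h, show α = 0 by linarith, show β = 0 by linarith, show γ = 0 by linarith]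
        simp
      exact ⟨(α + β + γ)⁻¹, inv_pos.2 h0, inv_mul_cancel₀ h0.ne'⟩
    rintro (⟨α, β, γ, hα, hβ, hγ, h⟩ | ⟨α, β, γ, hα, hβ, hγ, h⟩)
    · obtain ⟨i, hi, e⟩ := pos hα hβ hγ h
      refine ⟨_, ⟨i * α, i * (β + γ), by positivity, by positivity, by linarith, rfl⟩,
        _, ⟨i * (α + β), i * γ, by positivity, by positivity, by linarith, rfl⟩, i, hi, ?_⟩
      rw [h]; module
    · obtain ⟨i, hi, e⟩ := pos hα hβ hγ h
      refine ⟨_, ⟨i * (α + β), i * γ, by positivity, by positivity, by linarith, rfl⟩,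
        _, ⟨i * α, i * (β + γ), by positivity, by positivity, by linarith, rfl⟩, i, hi, ?_⟩
      rw [h]; module

-- A direction in both cones would lie in the plane through the diagonal, because the four vertices
-- satisfy `a - d = (a - c) - (b - c) + (b - d)`; genericity excludes this.
open Classical in
lemma overCount_eq_cone {u a b c d : R3} (h1 : u ∉ Submodule.span ℝ {a - c, b - c})
    (h2 : u ∉ Submodule.span ℝ {a - c, b - d}) (h3 : u ∉ Submodule.span ℝ {b - c, b - d}) :
    overCount u a b c d = cone u (a - c) (b - c) (b - d) + cone u (a - c) (a - d) (b - d) := by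
  have hu : u ≠ 0 := fun h => h1 (h ▸ Submodule.zero_mem _)
  have hnot : ¬(InCone u (a - c) (b - c) (b - d) ∧ InCone u (a - c) (a - d) (b - d)) := by
    rintro ⟨⟨α, β, γ, hα, hβ, hγ, h⟩, α', β', γ', hα', hβ', hγ', h'⟩
    obtain ⟨-, hb, -⟩ := cone_linearIndependent h1 h2 h3 h (α - α' - β') (β + β') (γ - γ' - β')
      (by rw [← sub_eq_zero.2 (h.symm.trans h')]; module)
    refine notMem_span_pair h2 α γ ?_
    rw [h, show β = 0 by linarith]
    simp
  rw [overCount, if_congr (over_iff_inCone_or hu) rfl rfl, cone, cone]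
  by_cases hA : InCone u (a - c) (b - c) (b - d) <;>
    by_cases hB : InCone u (a - c) (a - d) (b - d)
  · exact absurd ⟨hA, hB⟩ hnot
  all_goals simp only [hA, hB, or_true, or_false, if_true, if_false, add_zero, zero_add]

lemma ae_generic (S : Finset R3) :
    ∀ᵐ u : R3, ∀ p ∈ S, ∀ q ∈ S, u ∉ Submodule.span ℝ {p, q} := by
  simp only [← Finset.mem_coe]
  exact (ae_ball_iff S.countable_toSet).2 fun p _ => (ae_ball_iff S.countable_toSet).2 fun q _ =>
    ae_notMem_span_pair p q

lemma combo_mem_convexHull {a b e : R3} {x y z : ℝ} (hx : 0 ≤ x) (hy : 0 ≤ y) (hz : 0 ≤ z)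
    (h : x + y + z = 1) : x • a + y • b + z • e ∈ convexHull ℝ {a, b, e} := by
  have := (convex_convexHull ℝ ({a, b, e} : Set R3)).sum_mem (t := Finset.univ)
    (w := ![x, y, z]) (z := ![a, b, e])
    (by intro i _; fin_cases i <;> simpa) (by simpa [Fin.sum_univ_three] using h)
    (by intro i _; apply subset_convexHull; fin_cases i <;> simp)
  simpa [Fin.sum_univ_three] using this

/-- How the boundary of a triangle passes over a segment disjoint from the triangle is determined
by the endpoints of the segment. -/
lemma ae_triangle_segment {a b e c d : R3}
    (h : Disjoint (convexHull ℝ {a, b, e}) (segment ℝ c d)) :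
    ∀ᵐ u : R3, overCount u a b c d + overCount u b e c d + overCount u a e c d =
      cone u (a - c) (b - c) (e - c) + cone u (a - d) (b - d) (e - d) := by
  classical
  have hne : ∀ x y z v w : ℝ, 0 ≤ x → 0 ≤ y → 0 ≤ z → 0 ≤ v → 0 ≤ w → x + y + z = 1 → v + w = 1 →
      x • a + y • b + z • e - (v • c + w • d) ≠ 0 := by
    intro x y z v w hx hy hz hv hw h1 h2 h0
    exact Set.disjoint_left.1 h (combo_mem_convexHull hx hy hz h1)
      (sub_eq_zero.1 h0 ▸ ⟨v, w, hv, hw, h2, rfl⟩)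
  filter_upwards [ae_generic {a - c, b - c, e - c, a - d, b - d, e - d}] with u hu
  -- The differences of the triangle and the segment are the image of a prism, cut here into three
  -- tetrahedra. The two inner faces cancel; the lateral faces form the three parallelograms, and
  -- the bottom and the top give the right-hand side.
  have t1 := cone_tetrahedron (u := u) (p := a - c) (q := b - c) (r := e - c) (s := e - d)
    (hu _ (by simp) _ (by simp)) (hu _ (by simp) _ (by simp)) (hu _ (by simp) _ (by simp))
    (hu _ (by simp) _ (by simp)) (hu _ (by simp) _ (by simp)) (hu _ (by simp) _ (by simp))
    (fun x y z w hx hy hz hw hs h0 => hne x y (z + w) (x + y + z) w hx hy (by positivity)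
      (by positivity) hw (by linarith) hs (by rw [← h0]; module))
  have t2 := cone_tetrahedron (u := u) (p := a - c) (q := b - c) (r := b - d) (s := e - d)
    (hu _ (by simp) _ (by simp)) (hu _ (by simp) _ (by simp)) (hu _ (by simp) _ (by simp))
    (hu _ (by simp) _ (by simp)) (hu _ (by simp) _ (by simp)) (hu _ (by simp) _ (by simp))
    (fun x y z w hx hy hz hw hs h0 => hne x (y + z) w (x + y) (z + w) hx (by positivity) hw
      (by positivity) (by positivity) (by linarith) (by linarith) (by rw [← h0]; module))
  have t3 := cone_tetrahedron (u := u) (p := a - c) (q := a - d) (r := b - d) (s := e - d)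
    (hu _ (by simp) _ (by simp)) (hu _ (by simp) _ (by simp)) (hu _ (by simp) _ (by simp))
    (hu _ (by simp) _ (by simp)) (hu _ (by simp) _ (by simp)) (hu _ (by simp) _ (by simp))
    (fun x y z w hx hy hz hw hs h0 => hne (x + y) z w x (y + z + w) (by positivity) hz hw
      hx (by positivity) (by linarith) (by linarith) (by rw [← h0]; module))
  rw [overCount_eq_cone (hu _ (by simp) _ (by simp)) (hu _ (by simp) _ (by simp))
      (hu _ (by simp) _ (by simp)),
    overCount_eq_cone (hu _ (by simp) _ (by simp)) (hu _ (by simp) _ (by simp))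
      (hu _ (by simp) _ (by simp)),
    overCount_eq_cone (hu _ (by simp) _ (by simp)) (hu _ (by simp) _ (by simp))
      (hu _ (by simp) _ (by simp))]
  have z2 : (2 : ZMod 2) = 0 := rfl
  linear_combination t1 + t2 + t3 - (cone u (a - c) (b - c) (e - c) +
    cone u (a - d) (b - d) (e - d) + cone u (a - c) (b - c) (e - d) +
    cone u (a - c) (b - d) (e - d)) * z2

/-! ### Homotopy invariance of the count for closed polygons -/

lemma sum_range_add_succ (g : ℕ → ZMod 2) (M : ℕ) :
    ∑ j ∈ Finset.range M, (g j + g (j + 1)) = g 0 + g M := by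
  have z2 : (2 : ZMod 2) = 0 := rfl
  induction M with
  | zero => rw [Finset.sum_range_zero]; linear_combination -g 0 * z2
  | succ M ih => rw [Finset.sum_range_succ, ih]; linear_combination g M * z2

/-- The mod 2 number of times that the segment `[a, b]` passes over the polygonal path `q`. -/
def pathOver (u a b : R3) (q : ℕ → R3) (M : ℕ) : ZMod 2 :=
  ∑ j ∈ Finset.range M, overCount u a b (q j) (q (j + 1))

/-- The mod 2 number of times that the polygonal path `p` passes over the polygonal path `q`. -/
def polyOver (u : R3) (p : ℕ → R3) (L : ℕ) (q : ℕ → R3) (M : ℕ) : ZMod 2 :=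
  ∑ i ∈ Finset.range L, pathOver u (p i) (p (i + 1)) q M

lemma polyOver_swap (u : R3) (p : ℕ → R3) (L : ℕ) (q : ℕ → R3) (M : ℕ) :
    polyOver u p L q M = polyOver (-u) q M p L := by
  simp only [polyOver, pathOver]
  rw [Finset.sum_comm]
  simp only [overCount_swap u]

lemma ae_neg {p : R3 → Prop} (h : ∀ᵐ u : R3, p u) : ∀ᵐ u : R3, p (-u) :=
  (Measure.measurePreserving_neg (volume : Measure R3)).quasiMeasurePreserving.ae h

/-- By `ae_triangle_segment` every edge of the closed path contributes one term for each of its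
endpoints, and these terms cancel around the path. -/
lemma ae_triangle_closed {a b e : R3} {q : ℕ → R3} {M : ℕ} (hq : q M = q 0)
    (h : ∀ j < M, Disjoint (convexHull ℝ {a, b, e}) (segment ℝ (q j) (q (j + 1)))) :
    ∀ᵐ u : R3, pathOver u a b q M + pathOver u b e q M + pathOver u a e q M = 0 := by
  have h1 : ∀ᵐ u : R3, ∀ j ∈ Finset.range M, overCount u a b (q j) (q (j + 1)) +
      overCount u b e (q j) (q (j + 1)) + overCount u a e (q j) (q (j + 1)) =
      cone u (a - q j) (b - q j) (e - q j) +
        cone u (a - q (j + 1)) (b - q (j + 1)) (e - q (j + 1)) := by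
    simp only [← Finset.mem_coe]
    exact (ae_ball_iff (Finset.countable_toSet _)).2 fun j hj =>
      ae_triangle_segment (h j (Finset.mem_range.1 hj))
  filter_upwards [h1] with u hu
  simp only [pathOver]
  rw [← Finset.sum_add_distrib, ← Finset.sum_add_distrib, Finset.sum_congr rfl hu,
    sum_range_add_succ (fun j => cone u (a - q j) (b - q j) (e - q j)), hq]
  exact CharTwo.add_self_eq_zero _

/-- Homotopy invariance of the mod 2 count of a closed polygon over another one. -/
lemma ae_polyOver_homotopy {p p' : ℕ → R3} {L : ℕ} {q : ℕ → R3} {M : ℕ} (hp : p L = p 0)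
    (hp' : p' L = p' 0) (hq : q M = q 0)
    (h : ∀ i < L, ∀ j < M, Disjoint (convexHull ℝ {p i, p (i + 1), p' i, p' (i + 1)})
      (segment ℝ (q j) (q (j + 1)))) :
    ∀ᵐ u : R3, polyOver u p L q M = polyOver u p' L q M := by
  have h1 : ∀ᵐ u : R3, ∀ i ∈ Finset.range L,
      (pathOver u (p i) (p (i + 1)) q M + pathOver u (p (i + 1)) (p' (i + 1)) q M +
        pathOver u (p i) (p' (i + 1)) q M = 0) ∧
      (pathOver u (p i) (p' i) q M + pathOver u (p' i) (p' (i + 1)) q M +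
        pathOver u (p i) (p' (i + 1)) q M = 0) := by
    simp only [← Finset.mem_coe]
    -- The strip between the two polygons is cut along the diagonal from `p i` to `p' (i + 1)`. The
    -- diagonals cancel within a strip, the rungs from `p i` to `p' i` between neighbouring strips.
    refine (ae_ball_iff (Finset.countable_toSet _)).2 fun i hi => Filter.Eventually.and ?_ ?_
    · refine ae_triangle_closed hq fun j hj => (h i (Finset.mem_range.1 hi) j hj).mono_left
        (convexHull_mono ?_)
      intro x hx
      simp only [Set.mem_insert_iff, Set.mem_singleton_iff] at hx ⊢
      tauto
    · refine ae_triangle_closed hq fun j hj => (h i (Finset.mem_range.1 hi) j hj).mono_left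
        (convexHull_mono ?_)
      intro x hx
      simp only [Set.mem_insert_iff, Set.mem_singleton_iff] at hx ⊢
      tauto
  filter_upwards [h1] with u hu
  have z2 : (2 : ZMod 2) = 0 := rfl
  have h2 : ∀ i ∈ Finset.range L, pathOver u (p i) (p (i + 1)) q M =
      pathOver u (p' i) (p' (i + 1)) q M +
        (pathOver u (p i) (p' i) q M + pathOver u (p (i + 1)) (p' (i + 1)) q M) := by
    intro i hi
    obtain ⟨e1, e2⟩ := hu i hi
    linear_combination e1 - e2 - pathOver u (p (i + 1)) (p' (i + 1)) q M * z2
  unfold polyOver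
  rw [Finset.sum_congr rfl h2, Finset.sum_add_distrib,
    sum_range_add_succ (fun i => pathOver u (p i) (p' i) q M), hp, hp',
    CharTwo.add_self_eq_zero, add_zero]

/-! ### Subdivision, and comparison of close polygonal approximations -/

lemma sum_range_mul {A : Type*} [AddCommMonoid A] (f : ℕ → A) (L N : ℕ) :
    ∑ m ∈ Finset.range (L * N), f m =
      ∑ k ∈ Finset.range L, ∑ r ∈ Finset.range N, f (k * N + r) := by
  induction L with
  | zero => simp
  | succ L ih => rw [Nat.succ_mul, Finset.sum_range_add, ih, Finset.sum_range_succ]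

/-- The path obtained from `p` by dividing each edge into `N` parts of equal length. -/
def subdivide (p : ℕ → R3) (N : ℕ) (m : ℕ) : R3 :=
  AffineMap.lineMap (p (m / N)) (p (m / N + 1)) ((m % N : ℕ) / N : ℝ)

/-- The value `r = N` is included: there the definition already uses the next edge, whose starting
point is the same. This lets both ends of every piece be read off on one edge. -/
lemma subdivide_apply {p : ℕ → R3} {N : ℕ} (hN : 0 < N) (k : ℕ) {r : ℕ} (hr : r ≤ N) :
    subdivide p N (k * N + r) = AffineMap.lineMap (p k) (p (k + 1)) (r / N : ℝ) := by
  have hN' : (N : ℝ) ≠ 0 := by positivity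
  rcases hr.lt_or_eq with h | rfl
  · rw [subdivide, mul_comm, Nat.mul_add_div hN, Nat.div_eq_of_lt h, Nat.mul_add_mod,
      Nat.mod_eq_of_lt h, add_zero]
  · rw [subdivide, ← Nat.succ_mul, Nat.mul_div_cancel _ hN, Nat.mul_mod_left, div_self hN']
    simp

/-- Apply `ae_triangle_closed` to the flat triangles spanned by `a` and one piece of the segment,
and telescope. The term for `[a, a]` that remains vanishes by the totally degenerate triangle. -/
lemma ae_pathOver_subdivide {a b : R3} {q : ℕ → R3} {M : ℕ} (hq : q M = q 0) {N : ℕ} (hN : 0 < N)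
    (h : ∀ j < M, Disjoint (segment ℝ a b) (segment ℝ (q j) (q (j + 1)))) :
    ∀ᵐ u : R3, ∑ r ∈ Finset.range N, pathOver u (AffineMap.lineMap a b (r / N : ℝ))
      (AffineMap.lineMap a b ((r + 1 : ℕ) / N : ℝ)) q M = pathOver u a b q M := by
  have hmem : ∀ r ≤ N, AffineMap.lineMap a b (r / N : ℝ) ∈ segment ℝ a b := by
    intro r hr
    rw [segment_eq_image_lineMap]
    exact ⟨_, ⟨by positivity, div_le_one_of_le₀ (by exact_mod_cast hr) (by positivity)⟩, rfl⟩
  have h1 : ∀ᵐ u : R3, ∀ r ∈ Finset.range N,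
      pathOver u a (AffineMap.lineMap a b (r / N : ℝ)) q M +
      pathOver u (AffineMap.lineMap a b (r / N : ℝ)) (AffineMap.lineMap a b ((r + 1 : ℕ) / N : ℝ)) q M +
      pathOver u a (AffineMap.lineMap a b ((r + 1 : ℕ) / N : ℝ)) q M = 0 := by
    simp only [← Finset.mem_coe]
    refine (ae_ball_iff (Finset.countable_toSet _)).2 fun r hr => ?_
    have hr := Finset.mem_range.1 hr
    refine ae_triangle_closed hq fun j hj => (h j hj).mono_left
      (convexHull_min ?_ (convex_segment a b))
    rintro x (rfl | rfl | rfl)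
    · exact left_mem_segment ..
    · exact hmem r hr.le
    · exact hmem (r + 1) hr
  have h2 : ∀ᵐ u : R3, pathOver u a a q M + pathOver u a a q M + pathOver u a a q M = 0 := by
    refine ae_triangle_closed hq fun j hj => (h j hj).mono_left ?_
    simpa using left_mem_segment ℝ a b
  filter_upwards [h1, h2] with u hu hu0
  have e : ∀ r ∈ Finset.range N, pathOver u (AffineMap.lineMap a b (r / N : ℝ))
      (AffineMap.lineMap a b ((r + 1 : ℕ) / N : ℝ)) q M =
      pathOver u a (AffineMap.lineMap a b (r / N : ℝ)) q M +
      pathOver u a (AffineMap.lineMap a b ((r + 1 : ℕ) / N : ℝ)) q M := by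
    intro r hr
    have z2 : (2 : ZMod 2) = 0 := rfl
    linear_combination hu r hr - (pathOver u a (AffineMap.lineMap a b (r / N : ℝ)) q M +
      pathOver u a (AffineMap.lineMap a b ((r + 1 : ℕ) / N : ℝ)) q M) * z2
  rw [Finset.sum_congr rfl e,
    sum_range_add_succ (fun r : ℕ => pathOver u a (AffineMap.lineMap a b (r / N : ℝ)) q M)]
  have hN' : (N : ℝ) ≠ 0 := by positivity
  rw [div_self hN', AffineMap.lineMap_apply_one, Nat.cast_zero, zero_div,
    AffineMap.lineMap_apply_zero]
  rw [CharTwo.add_self_eq_zero, zero_add] at hu0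
  rw [hu0, zero_add]

lemma ae_polyOver_subdivide {p : ℕ → R3} {L : ℕ} {q : ℕ → R3} {M : ℕ} (hq : q M = q 0) {N : ℕ}
    (hN : 0 < N) (h : ∀ i < L, ∀ j < M,
      Disjoint (segment ℝ (p i) (p (i + 1))) (segment ℝ (q j) (q (j + 1)))) :
    ∀ᵐ u : R3, polyOver u (subdivide p N) (L * N) q M = polyOver u p L q M := by
  have h1 : ∀ᵐ u : R3, ∀ i ∈ Finset.range L, ∑ r ∈ Finset.range N,
      pathOver u (AffineMap.lineMap (p i) (p (i + 1)) (r / N : ℝ))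
      (AffineMap.lineMap (p i) (p (i + 1)) ((r + 1 : ℕ) / N : ℝ)) q M =
        pathOver u (p i) (p (i + 1)) q M := by
    simp only [← Finset.mem_coe]
    exact (ae_ball_iff (Finset.countable_toSet _)).2 fun i hi =>
      ae_pathOver_subdivide hq hN fun j hj => h i (Finset.mem_range.1 hi) j hj
  filter_upwards [h1] with u hu
  rw [polyOver, sum_range_mul, polyOver]
  refine Finset.sum_congr rfl fun i hi => ?_
  rw [← hu i hi]
  refine Finset.sum_congr rfl fun r hr => ?_
  have hr := Finset.mem_range.1 hr
  rw [subdivide_apply hN i hr.le, add_assoc, subdivide_apply hN i (Nat.succ_le_of_lt hr)]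

/-- The vertices of the polygon inscribed in `γ` at `K` equidistant times. -/
def sample (γ : ClosedCurve) (K : ℕ) (m : ℕ) : R3 := γ ((m / K : ℝ) : UnitAddCircle)

lemma sample_closed (γ : ClosedCurve) {K : ℕ} (hK : 0 < K) : sample γ K K = sample γ K 0 := by
  have hK' : (K : ℝ) ≠ 0 := by positivity
  have : ((1 : ℝ) : UnitAddCircle) = ((0 : ℝ) : UnitAddCircle) := by
    simp
  simp only [sample]
  rw [div_self hK', Nat.cast_zero, zero_div, this]

lemma exists_uniform (γ : ClosedCurve) {ε : ℝ} (hε : 0 < ε) : ∃ δ > 0, ∀ s t : ℝ, |s - t| < δ →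
    dist (γ (s : UnitAddCircle)) (γ (t : UnitAddCircle)) < ε := by
  obtain ⟨δ, hδ, h⟩ := Metric.uniformContinuous_iff.1
    (CompactSpace.uniformContinuous_of_continuous γ.continuous) ε hε
  refine ⟨δ, hδ, fun s t hst => h ?_⟩
  rw [dist_eq_norm, ← AddCircle.coe_sub]
  exact QuotientAddGroup.norm_mk_le_norm.trans_lt hst

lemma dist_subdivide_lt {P : ClosedPolygon} {ε : ℝ} {γ : ClosedCurve} (hP : P.Approximates ε γ)
    {N : ℕ} (hN : 0 < N) {k : ℕ} (hk : k < P.length) {r : ℕ} (hr : r ≤ N) :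
    dist (subdivide P.vertex N (k * N + r)) (sample γ (P.length * N) (k * N + r)) < ε := by
  have hN' : (0 : ℝ) < N := by positivity
  have hL' : (0 : ℝ) < P.length := by exact_mod_cast P.length_pos
  have := hP k hk (r / N) ⟨by positivity, div_le_one_of_le₀ (by exact_mod_cast hr) (by positivity)⟩
  have e : (((k * N + r : ℕ) : ℝ) / (P.length * N : ℕ)) = (k + r / N) / P.length := by
    push_cast
    field_simp
  rwa [subdivide_apply hN k hr, sample, e]

/-- After a fine subdivision, each step of `P` and the corresponding step of the polygon inscribed
in `γ` lie in one ball of radius `2 * ε` around a point of `γ`, which `q` avoids, so homotopy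
invariance applies. All large `N` are allowed so that two approximations can be compared with the
same inscribed polygon. -/
lemma ae_polyOver_sample {P : ClosedPolygon} {ε : ℝ} {γ : ClosedCurve} (hP : P.Approximates ε γ)
    {q : ℕ → R3} {M : ℕ} (hq : q M = q 0)
    (hd : ∀ j < M, ∀ y ∈ segment ℝ (q j) (q (j + 1)), ∀ x, 2 * ε ≤ dist (γ x) y) :
    ∃ N₀ > 0, ∀ N ≥ N₀, ∀ᵐ u : R3, polyOver u P.vertex P.length q M =
      polyOver u (sample γ (P.length * N)) (P.length * N) q M := by
  have hL' : (0 : ℝ) < P.length := by exact_mod_cast P.length_pos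
  have hε : 0 < ε := dist_nonneg.trans_lt (hP 0 P.length_pos 0 (by simp))
  obtain ⟨δ, hδ, hγ⟩ := exists_uniform γ hε
  obtain ⟨N₀, hN₀⟩ := exists_nat_gt (1 / δ)
  refine ⟨N₀ + 1, by omega, fun N hN => ?_⟩
  have hNpos : 0 < N := by omega
  have hN' : (0 : ℝ) < N := by positivity
  have hsmall : ((P.length * N : ℕ) : ℝ)⁻¹ < δ := by
    have h1 : 1 / δ < N := hN₀.trans_le (by exact_mod_cast (by omega : N₀ ≤ N))
    have h2 : (1 : ℝ) ≤ P.length := by exact_mod_cast P.length_pos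
    rw [inv_lt_comm₀ (by push_cast; positivity) hδ, ← one_div]
    push_cast
    nlinarith
  have near : ∀ i < P.length * N,
      subdivide P.vertex N i ∈ Metric.ball (sample γ (P.length * N) i) (2 * ε) ∧
      subdivide P.vertex N (i + 1) ∈ Metric.ball (sample γ (P.length * N) i) (2 * ε) ∧
      sample γ (P.length * N) i ∈ Metric.ball (sample γ (P.length * N) i) (2 * ε) ∧
      sample γ (P.length * N) (i + 1) ∈ Metric.ball (sample γ (P.length * N) i) (2 * ε) := by
    intro i hi
    have hk : i / N < P.length := Nat.div_lt_of_lt_mul (by rwa [mul_comm])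
    have hr : i % N < N := Nat.mod_lt _ hNpos
    have ei : i / N * N + i % N = i := by rw [mul_comm]; exact Nat.div_add_mod i N
    have d1 := dist_subdivide_lt hP hNpos hk hr.le
    have d2 := dist_subdivide_lt hP hNpos hk (Nat.succ_le_of_lt hr)
    rw [Nat.succ_eq_add_one, ← add_assoc, ei] at d2
    rw [ei] at d1
    have d3 : dist (sample γ (P.length * N) (i + 1)) (sample γ (P.length * N) i) < ε := by
      apply hγ
      rw [← sub_div]
      push_cast at hsmall ⊢
      rw [add_sub_cancel_left, one_div, abs_of_pos (by positivity)]
      exact hsmall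
    simp only [Metric.mem_ball]
    refine ⟨by linarith, ?_, by simpa, by linarith⟩
    linarith [dist_triangle (subdivide P.vertex N (i + 1)) (sample γ (P.length * N) (i + 1))
      (sample γ (P.length * N) i)]
  have h1 : ∀ᵐ u : R3, polyOver u (subdivide P.vertex N) (P.length * N) q M =
      polyOver u P.vertex P.length q M := by
    refine ae_polyOver_subdivide hq hNpos fun i hi j hj => Set.disjoint_left.2 fun z hz hz' => ?_
    rw [segment_eq_image_lineMap] at hz
    obtain ⟨s, hs, rfl⟩ := hz
    have := hP i hi s hs
    have := hd j hj _ hz' (((i + s) / P.length : ℝ) : UnitAddCircle)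
    rw [dist_comm] at this
    linarith
  have h2 : ∀ᵐ u : R3, polyOver u (subdivide P.vertex N) (P.length * N) q M =
      polyOver u (sample γ (P.length * N)) (P.length * N) q M := by
    refine ae_polyOver_homotopy ?_ (sample_closed γ (Nat.mul_pos P.length_pos hNpos)) hq ?_
    · have h0 := subdivide_apply (p := P.vertex) hNpos 0 (Nat.zero_le N)
      have h1 := subdivide_apply (p := P.vertex) hNpos P.length (Nat.zero_le N)
      simp only [zero_mul, add_zero, Nat.cast_zero, zero_div, AffineMap.lineMap_apply_zero] at h0 h1
      rw [h0, h1, P.closed]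
    · intro i hi j hj
      obtain ⟨n1, n2, n3, n4⟩ := near i hi
      refine Set.disjoint_left.2 fun z hz hz' => ?_
      have hz2 : z ∈ Metric.ball (sample γ (P.length * N) i) (2 * ε) := by
        refine convexHull_min ?_ (convex_ball _ _) hz
        rintro x (rfl | rfl | rfl | rfl) <;> assumption
      have := hd j hj z hz' (((i : ℝ) / (P.length * N : ℕ) : ℝ) : UnitAddCircle)
      rw [Metric.mem_ball, dist_comm] at hz2
      exact absurd hz2 (not_lt.2 this)
  filter_upwards [h1, h2] with u e1 e2
  rw [← e1, e2]

lemma ae_polyOver_left_eq {P P' : ClosedPolygon} {ε : ℝ} {γ : ClosedCurve}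
    (hP : P.Approximates ε γ) (hP' : P'.Approximates ε γ) {q : ℕ → R3} {M : ℕ} (hq : q M = q 0)
    (hd : ∀ j < M, ∀ y ∈ segment ℝ (q j) (q (j + 1)), ∀ x, 2 * ε ≤ dist (γ x) y) :
    ∀ᵐ u : R3, polyOver u P.vertex P.length q M = polyOver u P'.vertex P'.length q M := by
  obtain ⟨N, hN, h⟩ := ae_polyOver_sample hP hq hd
  obtain ⟨N', hN', h'⟩ := ae_polyOver_sample hP' hq hd
  -- A common multiple: both polygons are compared with the polygon inscribed at this number of
  -- times.
  have e : P.length * (P'.length * (N * N')) = P'.length * (P.length * (N * N')) := by ring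
  filter_upwards [h (P'.length * (N * N')) (by nlinarith [P'.length_pos, Nat.mul_pos hN hN']),
    h' (P.length * (N * N')) (by nlinarith [P.length_pos, Nat.mul_pos hN hN'])] with u h1 h2
  rw [h1, h2, e]

lemma le_dist_segment {Q : ClosedPolygon} {ε r : ℝ} {γ δ : ClosedCurve} (hQ : Q.Approximates ε δ)
    (hd : ∀ x y, r + ε ≤ dist (γ x) (δ y)) :
    ∀ j < Q.length, ∀ y ∈ segment ℝ (Q.vertex j) (Q.vertex (j + 1)), ∀ x, r ≤ dist (γ x) y := by
  intro j hj y hy x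
  rw [segment_eq_image_lineMap] at hy
  obtain ⟨s, hs, rfl⟩ := hy
  have h1 := hQ j hj s hs
  linarith [hd x (((j + s) / Q.length : ℝ) : UnitAddCircle), dist_triangle (γ x)
    (AffineMap.lineMap (Q.vertex j) (Q.vertex (j + 1)) s)
    (δ (((j + s) / Q.length : ℝ) : UnitAddCircle))]

/-- Sufficiently close polygonal approximations of two disjoint closed curves pass over each other
equally often modulo 2. -/
lemma ae_polyOver_eq {P P' Q Q' : ClosedPolygon} {ε : ℝ} {γ δ : ClosedCurve}
    (hP : P.Approximates ε γ) (hP' : P'.Approximates ε γ) (hQ : Q.Approximates ε δ)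
    (hQ' : Q'.Approximates ε δ) (hd : ∀ x y, 3 * ε ≤ dist (γ x) (δ y)) :
    ∀ᵐ u : R3, polyOver u P.vertex P.length Q.vertex Q.length =
      polyOver u P'.vertex P'.length Q'.vertex Q'.length := by
  have h1 := ae_polyOver_left_eq hP hP' Q.closed
    (le_dist_segment hQ fun x y => by linarith [hd x y])
  have h2 := ae_polyOver_left_eq hQ hQ' P'.closed
    (le_dist_segment hP' fun x y => by rw [dist_comm]; linarith [hd y x])
  -- The second polygon is replaced after exchanging the roles of the two, which reverses the
  -- direction.
  filter_upwards [h1, ae_neg h2] with u e1 e2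
  rw [e1, polyOver_swap u, polyOver_swap u, e2]

/-! ### Regular diagrams: the count along nearly vertical directions is the linking number mod 2 -/

/-- The vertical direction. -/
def vertical : R3 := EuclideanSpace.single 2 1

lemma vertical_zero : vertical 0 = 0 := by simp [vertical]
lemma vertical_one : vertical 1 = 0 := by simp [vertical]
lemma vertical_two : vertical 2 = 1 := by simp [vertical]

/-- The conditions on a pair of edges in a regular diagram. -/
structure RegularPair (a b c d : R3) : Prop where
  left : ∀ y ∈ segment ℝ c d, ¬ SameProjection a y
  right : ∀ y ∈ segment ℝ c d, ¬ SameProjection b y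
  left' : ∀ x ∈ segment ℝ a b, ¬ SameProjection x c
  right' : ∀ x ∈ segment ℝ a b, ¬ SameProjection x d

lemma RegularDiagram.pair {P Q : ClosedPolygon} (h : RegularDiagram P Q) {i j : ℕ}
    (hi : i < P.length) (hj : j < Q.length) :
    RegularPair (P.vertex i) (P.vertex (i + 1)) (Q.vertex j) (Q.vertex (j + 1)) := by
  refine ⟨h.1 i hi j hj, ?_, h.2 i hi j hj, ?_⟩
  · rcases (Nat.succ_le_of_lt hi).lt_or_eq with h' | h'
    · exact h.1 _ h' j hj
    · rw [show i + 1 = P.length from h', P.closed]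
      exact h.1 0 P.length_pos j hj
  · rcases (Nat.succ_le_of_lt hj).lt_or_eq with h' | h'
    · exact h.2 i hi _ h'
    · intro x hx
      have := h.2 i hi 0 Q.length_pos x hx
      rwa [show j + 1 = Q.length from h', Q.closed]

lemma segment_coord {a b : R3} {s : ℝ} (i : Fin 3) :
    (AffineMap.lineMap a b s : R3) i = a i + s * (b i - a i) := by
  simp [AffineMap.lineMap_apply]
  ring

/-- Regularity forbids endpoints at a crossing, which gives the strict inequalities; these survive a
small change of direction. -/
lemma CrossesOver.exists_params {a b c d : R3} (h : CrossesOver a b c d)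
    (hr : RegularPair a b c d) : ∃ s t l : ℝ, 0 < s ∧ s < 1 ∧ 0 < t ∧ t < 1 ∧ 0 < l ∧
      a 0 + s * (b 0 - a 0) = c 0 + t * (d 0 - c 0) ∧
      a 1 + s * (b 1 - a 1) = c 1 + t * (d 1 - c 1) ∧
      a 2 + s * (b 2 - a 2) = c 2 + t * (d 2 - c 2) + l := by
  obtain ⟨x, hx, y, hy, ⟨h0, h1⟩, h2⟩ := h
  have hx' := hx
  have hy' := hy
  rw [segment_eq_image_lineMap] at hx' hy'
  obtain ⟨s, ⟨hs0, hs1⟩, rfl⟩ := hx'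
  obtain ⟨t, ⟨ht0, ht1⟩, rfl⟩ := hy'
  refine ⟨s, t, _, lt_of_le_of_ne hs0 ?_, lt_of_le_of_ne hs1 ?_, lt_of_le_of_ne ht0 ?_,
    lt_of_le_of_ne ht1 ?_, sub_pos.2 h2, ?_, ?_, ?_⟩
  · rintro rfl
    exact hr.left _ hy ⟨by simpa using h0, by simpa using h1⟩
  · rintro rfl
    exact hr.right _ hy ⟨by simpa using h0, by simpa using h1⟩
  · rintro rfl
    exact hr.left' _ hx ⟨by simpa using h0, by simpa using h1⟩
  · rintro rfl
    exact hr.right' _ hx ⟨by simpa using h0, by simpa using h1⟩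
  · simpa only [segment_coord] using h0
  · simpa only [segment_coord] using h1
  · simp only [segment_coord]; ring

/-- Two parallel plane segments which meet are such that one contains an endpoint of the other. -/
lemma exists_endpoint_of_parallel {s t k : ℝ} (hs0 : 0 < s) (hs1 : s < 1) (ht0 : 0 < t)
    (ht1 : t < 1) : ∃ s' t' : ℝ, s' ∈ Set.Icc (0 : ℝ) 1 ∧ t' ∈ Set.Icc (0 : ℝ) 1 ∧
      s' - s = k * (t' - t) ∧ (t' = 1 ∨ s' = 0 ∨ s' = 1) := by
  rcases lt_or_ge (s + k * (1 - t)) 0 with h | h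
  · have hk : k < 0 := by
      by_contra! hk
      nlinarith [mul_nonneg hk (sub_nonneg.2 ht1.le)]
    refine ⟨0, t - s / k, by simp, ⟨?_, ?_⟩, by field_simp [hk.ne]; ring, Or.inr (Or.inl rfl)⟩
    · have : s / k < 0 := div_neg_of_pos_of_neg hs0 hk
      linarith
    · have : -(1 - t) ≤ s / k := by
        rw [le_div_iff_of_neg hk]; linarith
      linarith
  rcases le_or_gt (s + k * (1 - t)) 1 with h' | h'
  · exact ⟨s + k * (1 - t), 1, ⟨h, h'⟩, by simp, by ring, Or.inl rfl⟩
  · have hk : 0 < k := by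
      by_contra! hk
      nlinarith [mul_nonneg (neg_nonneg.2 hk) (sub_nonneg.2 ht1.le)]
    refine ⟨1, t + (1 - s) / k, by simp, ⟨?_, ?_⟩, by field_simp; ring, Or.inr (Or.inr rfl)⟩
    · have : 0 < (1 - s) / k := div_pos (by linarith) hk
      linarith
    · have : (1 - s) / k ≤ 1 - t := by
        rw [div_le_iff₀ hk]; linarith
      linarith

/-- Crossings in a regular diagram are transversal. -/
lemma CrossesOver.transversal {a b c d : R3} (h : CrossesOver a b c d)
    (hr : RegularPair a b c d) :
    (b 0 - a 0) * (d 1 - c 1) - (b 1 - a 1) * (d 0 - c 0) ≠ 0 := by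
  obtain ⟨s, t, l, hs0, hs1, ht0, ht1, hl, e0, e1, -⟩ := h.exists_params hr
  intro hdet
  have mem : ∀ {x y : R3} {r : ℝ}, r ∈ Set.Icc (0 : ℝ) 1 →
      (AffineMap.lineMap x y r : R3) ∈ segment ℝ x y := fun hr => by
    rw [segment_eq_image_lineMap]; exact ⟨_, hr, rfl⟩
  have hv : ¬(b 0 - a 0 = 0 ∧ b 1 - a 1 = 0) := by
    rintro ⟨h0, h1⟩
    refine hr.left _ (mem (r := t) ⟨ht0.le, ht1.le⟩) ⟨?_, ?_⟩ <;> rw [segment_coord]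
    · rw [← e0, h0]; ring
    · rw [← e1, h1]; ring
  obtain ⟨k, hk0, hk1⟩ : ∃ k, d 0 - c 0 = k * (b 0 - a 0) ∧ d 1 - c 1 = k * (b 1 - a 1) := by
    by_cases h0 : b 0 - a 0 = 0
    · have h1 : b 1 - a 1 ≠ 0 := fun h1 => hv ⟨h0, h1⟩
      refine ⟨(d 1 - c 1) / (b 1 - a 1), ?_, by field_simp⟩
      rw [h0] at hdet ⊢
      rw [mul_zero]
      have : (b 1 - a 1) * (d 0 - c 0) = 0 := by linarith
      exact (mul_eq_zero.1 this).resolve_left h1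
    · refine ⟨(d 0 - c 0) / (b 0 - a 0), by field_simp, ?_⟩
      field_simp
      linarith
  obtain ⟨s', t', hs', ht', e, hend⟩ := exists_endpoint_of_parallel (k := k) hs0 hs1 ht0 ht1
  have f0 : a 0 + s' * (b 0 - a 0) = c 0 + t' * (d 0 - c 0) := by
    rw [hk0] at e0 ⊢
    linear_combination e0 + (b 0 - a 0) * e
  have f1 : a 1 + s' * (b 1 - a 1) = c 1 + t' * (d 1 - c 1) := by
    rw [hk1] at e1 ⊢
    linear_combination e1 + (b 1 - a 1) * e
  rcases hend with rfl | rfl | rfl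
  · refine hr.right' _ (mem hs') ⟨?_, ?_⟩ <;> rw [segment_coord]
    · linarith
    · linarith
  · refine hr.left _ (mem ht') ⟨?_, ?_⟩ <;> rw [segment_coord]
    · linarith
    · linarith
  · refine hr.right _ (mem ht') ⟨?_, ?_⟩ <;> rw [segment_coord]
    · linarith
    · linarith

/-- By transversality, the system `a + s • (b - a) = c + t • (d - c) + l • u` is nonsingular at the
vertical direction. Cramer's rule then gives solutions depending continuously on `u`, so the strict
inequalities for `s`, `t`, `l` persist. -/
lemma CrossesOver.eventually_over {a b c d : R3} (h : CrossesOver a b c d)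
    (hr : RegularPair a b c d) : ∀ᶠ u in 𝓝 vertical, Over u a b c d := by
  have hdet := h.transversal hr
  obtain ⟨s, t, l, hs0, hs1, ht0, ht1, hl, e0, e1, e2⟩ := h.exists_params hr
  let det : R3 → R3 → R3 → ℝ := fun x y z => x 0 * (y 1 * z 2 - y 2 * z 1) -
    x 1 * (y 0 * z 2 - y 2 * z 0) + x 2 * (y 0 * z 1 - y 1 * z 0)
  let D : R3 → ℝ := fun u => det (b - a) (d - c) u
  have cont : ∀ x y : R3, Continuous fun u => det x y u := by
    intro x y
    simp only [det]
    fun_prop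
  have hD : D vertical ≠ 0 := by
    simpa [D, det, vertical_zero, vertical_one, vertical_two] using hdet
  have hs : ContinuousAt (fun u => det (c - a) (d - c) u / D u) vertical :=
    (cont _ _).continuousAt.div (cont _ _).continuousAt hD
  have ht : ContinuousAt (fun u => -det (b - a) (c - a) u / D u) vertical :=
    (cont _ _).neg.continuousAt.div (cont _ _).continuousAt hD
  have hl' : ContinuousAt (fun u => -det (b - a) (d - c) (c - a) / D u) vertical :=
    continuousAt_const.div (cont _ _).continuousAt hD
  have vs : det (c - a) (d - c) vertical / D vertical = s := by
    rw [div_eq_iff hD]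
    simp only [D, det, vertical_zero, vertical_one, vertical_two, PiLp.sub_apply]
    linear_combination -(d 1 - c 1) * e0 + (d 0 - c 0) * e1
  have vt : -det (b - a) (c - a) vertical / D vertical = t := by
    rw [div_eq_iff hD]
    simp only [D, det, vertical_zero, vertical_one, vertical_two, PiLp.sub_apply]
    linear_combination -(b 1 - a 1) * e0 + (b 0 - a 0) * e1
  have vl : -det (b - a) (d - c) (c - a) / D vertical = l := by
    rw [div_eq_iff hD]
    simp only [D, det, vertical_zero, vertical_one, vertical_two, PiLp.sub_apply]
    linear_combination ((b 1 - a 1) * (d 2 - c 2) - (b 2 - a 2) * (d 1 - c 1)) * e0 -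
      ((b 0 - a 0) * (d 2 - c 2) - (b 2 - a 2) * (d 0 - c 0)) * e1 +
      ((b 0 - a 0) * (d 1 - c 1) - (b 1 - a 1) * (d 0 - c 0)) * e2
  filter_upwards [hs.eventually (lt_mem_nhds (hs0.trans_eq vs.symm)),
    hs.eventually (gt_mem_nhds (vs.trans_lt hs1)), ht.eventually (lt_mem_nhds (ht0.trans_eq vt.symm)),
    ht.eventually (gt_mem_nhds (vt.trans_lt ht1)), hl'.eventually (lt_mem_nhds (hl.trans_eq vl.symm)),
    (cont (b - a) (d - c)).continuousAt.eventually_ne hD] with u u1 u2 u3 u4 u5 u6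
  refine ⟨AffineMap.lineMap a b (det (c - a) (d - c) u / D u), ?_,
    AffineMap.lineMap c d (-det (b - a) (c - a) u / D u), ?_,
    -det (b - a) (d - c) (c - a) / D u, u5, ?_⟩
  · rw [segment_eq_image_lineMap]; exact ⟨_, ⟨u1.le, u2.le⟩, rfl⟩
  · rw [segment_eq_image_lineMap]; exact ⟨_, ⟨u3.le, u4.le⟩, rfl⟩
  · have u6' : D u ≠ 0 := u6
    ext i
    rw [PiLp.sub_apply, PiLp.smul_apply, segment_coord, segment_coord, smul_eq_mul]
    field_simp
    simp only [D, det, PiLp.sub_apply]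
    fin_cases i <;> simp only [Fin.zero_eta, Fin.mk_one, Fin.reduceFinMk] <;> ring

/-- Without a crossing and with disjoint segments, no difference of their points is a nonnegative
multiple of the vertical vector. This is an open condition, uniform over the compact product of the
segments. -/
lemma eventually_not_over {a b c d : R3} (h : ¬ CrossesOver a b c d)
    (hd : Disjoint (segment ℝ a b) (segment ℝ c d)) :
    ∀ᶠ u in 𝓝 vertical, ¬ Over u a b c d := by
  have hK : IsCompact (segment ℝ a b ×ˢ segment ℝ c d) := by
    rw [segment_eq_image_lineMap, segment_eq_image_lineMap]
    exact (isCompact_Icc.image (AffineMap.lineMap_continuous)).prod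
      (isCompact_Icc.image (AffineMap.lineMap_continuous))
  -- Proportionality is written with cross-multiplied coordinates and a weak inequality, so that the
  -- negated condition is closed; disjointness takes care of equality of the heights.
  have h1 := hK.eventually_forall_of_forall_eventually (x₀ := vertical)
    (P := fun u k => ¬((k.1 0 - k.2 0) * u 2 = u 0 * (k.1 2 - k.2 2) ∧
      (k.1 1 - k.2 1) * u 2 = u 1 * (k.1 2 - k.2 2) ∧ k.2 2 ≤ k.1 2)) (by
    rintro ⟨x, y⟩ ⟨hx, hy⟩
    have hcl : IsClosed {z : R3 × R3 × R3 |
        (z.2.1 0 - z.2.2 0) * z.1 2 = z.1 0 * (z.2.1 2 - z.2.2 2) ∧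
        (z.2.1 1 - z.2.2 1) * z.1 2 = z.1 1 * (z.2.1 2 - z.2.2 2) ∧ z.2.2 2 ≤ z.2.1 2} :=
      (isClosed_eq (f := fun z : R3 × R3 × R3 => (z.2.1 0 - z.2.2 0) * z.1 2)
        (g := fun z => z.1 0 * (z.2.1 2 - z.2.2 2)) (by fun_prop) (by fun_prop)).inter
      ((isClosed_eq (f := fun z : R3 × R3 × R3 => (z.2.1 1 - z.2.2 1) * z.1 2)
        (g := fun z => z.1 1 * (z.2.1 2 - z.2.2 2)) (by fun_prop) (by fun_prop)).inter
      (isClosed_le (f := fun z : R3 × R3 × R3 => z.2.2 2)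
        (g := fun z => z.2.1 2) (by fun_prop) (by fun_prop)))
    refine hcl.isOpen_compl.eventually_mem ?_
    simp only [Set.mem_compl_iff, Set.mem_ofPred_eq, vertical_zero, vertical_one, vertical_two]
    rintro ⟨e0, e1, e2⟩
    have e0' : x 0 = y 0 := by linarith
    have e1' : x 1 = y 1 := by linarith
    rcases e2.lt_or_eq with e | e
    · exact h ⟨x, hx, y, hy, ⟨e0', e1'⟩, e⟩
    · refine Set.disjoint_left.1 hd hx ?_
      have : x = y := by
        ext i
        fin_cases i
        exacts [e0', e1', e.symm]
      rwa [this])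
  have h2 : ∀ᶠ u in 𝓝 vertical, (0 : ℝ) < u 2 := by
    have : Continuous fun u : R3 => u 2 := by fun_prop
    exact this.continuousAt.eventually (lt_mem_nhds (one_pos.trans_eq vertical_two.symm))
  filter_upwards [h1, h2] with u hu hu2
  rintro ⟨x, hx, y, hy, t, ht, e⟩
  have ei : ∀ i, x i - y i = t * u i := fun i => by
    simpa using congrArg (fun z : R3 => z i) e
  refine hu (x, y) ⟨hx, hy⟩ ⟨?_, ?_, ?_⟩
  · simp only [ei]; ring
  · simp only [ei]; ring
  · have := ei 2
    nlinarith

/-- Both crossing signs are 1 mod 2, and each of the finitely many pairs of edges keeps its crossing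
status near the vertical direction. -/
lemma ClosedPolygon.lk_eq {P Q : ClosedPolygon} (hr : RegularDiagram P Q)
    (hd : ∀ i < P.length, ∀ j < Q.length, Disjoint (segment ℝ (P.vertex i) (P.vertex (i + 1)))
      (segment ℝ (Q.vertex j) (Q.vertex (j + 1)))) :
    ∀ᶠ u in 𝓝 vertical, polyOver u P.vertex P.length Q.vertex Q.length = (P.lk Q : ZMod 2) := by
  classical
  have h1 : ∀ᶠ u in 𝓝 vertical, ∀ i ∈ Finset.range P.length, ∀ j ∈ Finset.range Q.length,
      overCount u (P.vertex i) (P.vertex (i + 1)) (Q.vertex j) (Q.vertex (j + 1)) =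
      ((if CrossesOver (P.vertex i) (P.vertex (i + 1)) (Q.vertex j) (Q.vertex (j + 1)) then
        crossingSign (P.vertex i) (P.vertex (i + 1)) (Q.vertex j) (Q.vertex (j + 1)) else 0 : ℤ) :
        ZMod 2) := by
    refine (Finset.eventually_all _).2 fun i hi => (Finset.eventually_all _).2 fun j hj => ?_
    rw [Finset.mem_range] at hi hj
    by_cases hc : CrossesOver (P.vertex i) (P.vertex (i + 1)) (Q.vertex j) (Q.vertex (j + 1))
    · filter_upwards [hc.eventually_over (hr.pair hi hj)] with u hu
      have ht := hc.transversal (hr.pair hi hj)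
      rw [overCount, if_pos hu, if_pos hc, crossingSign]
      rcases ht.lt_or_gt with h | h
      · rw [sign_neg h]; rfl
      · rw [sign_pos h]; rfl
    · filter_upwards [eventually_not_over hc (hd i hi j hj)] with u hu
      rw [overCount, if_neg hu, if_neg hc]; rfl
  filter_upwards [h1] with u hu
  simp only [polyOver, pathOver, ClosedPolygon.lk, Int.cast_sum]
  exact Finset.sum_congr rfl fun i hi => Finset.sum_congr rfl fun j hj => by
    rw [hu i hi j hj]

/-! ### Existence of the mod 2 linking number -/

/-- The filter of generic directions close to the vertical one. -/
def generic : Filter R3 := 𝓝 vertical ⊓ ae volume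

instance generic_neBot : generic.NeBot := by
  rw [generic, inf_neBot_iff]
  intro s hs t ht
  have : Dense t := Measure.dense_of_ae (μ := volume) (p := (· ∈ t)) ht
  exact mem_closure_iff_nhds.1 (this vertical) s hs

lemma eventually_generic_of_ae {p : R3 → Prop} (h : ∀ᵐ u : R3, p u) : ∀ᶠ u in generic, p u :=
  h.filter_mono inf_le_right

lemma eventually_generic_of_nhds {p : R3 → Prop} (h : ∀ᶠ u in 𝓝 vertical, p u) :
    ∀ᶠ u in generic, p u :=
  h.filter_mono inf_le_left

/-- The polygon `P` translated by `v`. -/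
def ClosedPolygon.translate (P : ClosedPolygon) (v : R3) : ClosedPolygon where
  length := P.length
  length_pos := P.length_pos
  vertex i := P.vertex i + v
  closed := by rw [P.closed]

lemma lineMap_add_right (a b v : R3) (s : ℝ) :
    AffineMap.lineMap (a + v) (b + v) s = AffineMap.lineMap a b s + v := by
  simp only [AffineMap.lineMap_apply, vsub_eq_sub, vadd_eq_add]
  module

lemma ClosedPolygon.Approximates.translate {P : ClosedPolygon} {ε r : ℝ} {γ : ClosedCurve}
    (h : P.Approximates ε γ) {v : R3} (hv : ‖v‖ < r) : (P.translate v).Approximates (ε + r) γ := by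
  intro k hk s hs
  have h1 := h k hk s hs
  simp only [ClosedPolygon.translate, lineMap_add_right]
  refine (dist_triangle _ (AffineMap.lineMap (P.vertex k) (P.vertex (k + 1)) s) _).trans_lt ?_
  rw [dist_self_add_left]
  linarith [show dist (AffineMap.lineMap (P.vertex k) (P.vertex (k + 1)) s) _ < ε from h1]

lemma ae_sub_notMem_span_pair (x p q : R3) : ∀ᵐ v : R3, x - v ∉ Submodule.span ℝ {p, q} :=
  (Measure.measurePreserving_sub_left (volume : Measure R3) x).quasiMeasurePreserving.ae
    (ae_notMem_span_pair p q)

lemma SameProjection.mem_span {x y w : R3} {s : ℝ} (h : SameProjection (s • w) (x - y)) :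
    x - y ∈ Submodule.span ℝ {w, vertical} := by
  refine Submodule.mem_span_pair.2 ⟨s, (x - y) 2 - s * w 2, ?_⟩
  obtain ⟨h0, h1⟩ := h
  ext i
  fin_cases i
  · simpa [vertical_zero] using h0
  · simpa [vertical_one] using h1
  · simp [vertical_two]

/-- A bad translation vector lies in one of finitely many affine planes, each parallel to the
vertical direction and to an edge of `P` or `Q`. -/
lemma ae_regularDiagram_translate (P Q : ClosedPolygon) :
    ∀ᵐ v : R3, RegularDiagram P (Q.translate v) := by
  have h1 : ∀ᵐ v : R3, ∀ i ∈ Finset.range P.length, ∀ j ∈ Finset.range Q.length,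
      P.vertex i - Q.vertex j - v ∉ Submodule.span ℝ {Q.vertex (j + 1) - Q.vertex j, vertical} ∧
      P.vertex i - Q.vertex j - v ∉ Submodule.span ℝ {P.vertex (i + 1) - P.vertex i, vertical} := by
    simp only [← Finset.mem_coe]
    exact (ae_ball_iff (Finset.countable_toSet _)).2 fun i _ =>
      (ae_ball_iff (Finset.countable_toSet _)).2 fun j _ =>
        (ae_sub_notMem_span_pair _ _ _).and (ae_sub_notMem_span_pair _ _ _)
  filter_upwards [h1] with v hv
  refine ⟨fun i hi j hj y hy hs => ?_, fun i hi j hj x hx hs => ?_⟩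
  · refine (hv i (Finset.mem_range.2 hi) j (Finset.mem_range.2 hj)).1 ?_
    rw [segment_eq_image_lineMap] at hy
    obtain ⟨s, -, rfl⟩ := hy
    apply SameProjection.mem_span (s := s)
    obtain ⟨e0, e1⟩ := hs
    simp only [ClosedPolygon.translate, segment_coord, PiLp.add_apply] at e0 e1
    refine ⟨?_, ?_⟩ <;> simp only [PiLp.smul_apply, PiLp.sub_apply, smul_eq_mul] <;> linarith
  · refine (hv i (Finset.mem_range.2 hi) j (Finset.mem_range.2 hj)).2 ?_
    rw [segment_eq_image_lineMap] at hx
    obtain ⟨s, -, rfl⟩ := hx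
    apply SameProjection.mem_span (s := -s)
    obtain ⟨e0, e1⟩ := hs
    simp only [ClosedPolygon.translate, segment_coord, PiLp.add_apply] at e0 e1
    refine ⟨?_, ?_⟩ <;> simp only [PiLp.smul_apply, PiLp.sub_apply, smul_eq_mul] <;> linarith

/-- The polygon inscribed in `γ` with `K` vertices at equidistant times. -/
def samplePolygon (γ : ClosedCurve) (K : ℕ) (hK : 0 < K) : ClosedPolygon where
  length := K
  length_pos := hK
  vertex := sample γ K
  closed := sample_closed γ hK

lemma exists_samplePolygon_approximates (γ : ClosedCurve) {ε : ℝ} (hε : 0 < ε) :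
    ∃ K₀ : ℕ, ∀ K, ∀ hK : 0 < K, K₀ ≤ K → (samplePolygon γ K hK).Approximates ε γ := by
  obtain ⟨δ, hδ, hγ⟩ := exists_uniform γ hε
  obtain ⟨K₀, hK₀⟩ := exists_nat_gt (1 / δ)
  refine ⟨K₀, fun K hK hKK k hk s hs => ?_⟩
  have hK' : (0 : ℝ) < K := by exact_mod_cast hK
  have h1 : 1 / (K : ℝ) < δ := by
    rw [one_div_lt hK' hδ]
    exact hK₀.trans_le (by exact_mod_cast hKK)
  set t : ℝ := (k + s) / K with ht
  have near : ∀ m : ℕ, |(m : ℝ) - (k + s)| ≤ 1 →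
      sample γ K m ∈ Metric.ball (γ (t : UnitAddCircle)) ε := by
    intro m hm
    apply hγ
    rw [ht, ← sub_div, abs_div, abs_of_pos hK']
    exact (div_le_div_of_nonneg_right hm hK'.le).trans_lt h1
  have hmem : AffineMap.lineMap (sample γ K k) (sample γ K (k + 1)) s ∈
      segment ℝ (sample γ K k) (sample γ K (k + 1)) := by
    rw [segment_eq_image_lineMap]; exact ⟨s, hs, rfl⟩
  refine (convex_ball (γ (t : UnitAddCircle)) ε).segment_subset (near k ?_) (near (k + 1) ?_) hmem
  · rw [abs_le]; constructor <;> linarith [hs.1, hs.2]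
  · push_cast
    rw [abs_le]; constructor <;> linarith [hs.1, hs.2]

lemma exists_pos_le_dist {γ δ : ClosedCurve} (h : Disjoint (Set.range γ) (Set.range δ)) :
    ∃ r > 0, ∀ x y, r ≤ dist (γ x) (δ y) := by
  have hc : Continuous fun z : UnitAddCircle × UnitAddCircle => dist (γ z.1) (δ z.2) := by
    fun_prop
  obtain ⟨z, -, hz⟩ := isCompact_univ.exists_isMinOn Set.univ_nonempty hc.continuousOn
  have hz' := isMinOn_iff.1 hz
  refine ⟨dist (γ z.1) (δ z.2), dist_pos.2 fun e => ?_, fun x y => hz' (x, y) (Set.mem_univ _)⟩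
  exact Set.disjoint_left.1 h (Set.mem_range_self z.1) (e ▸ Set.mem_range_self z.2)

/-- The mod 2 linking number of disjoint closed curves is well defined, and it may be computed by
counting with respect to generic almost vertical directions. -/
theorem exists_hasMod2LinkingNumber {γ δ : ClosedCurve}
    (h : Disjoint (Set.range γ) (Set.range δ)) :
    ∃ w, HasMod2LinkingNumber γ δ w ∧ ∃ ε > 0, ∀ P Q : ClosedPolygon, P.Approximates ε γ →
      Q.Approximates ε δ →
      ∀ᶠ u in generic, polyOver u P.vertex P.length Q.vertex Q.length = w := by
  obtain ⟨r, hr, hd⟩ := exists_pos_le_dist h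
  -- One `ε` is for the distance of one polygon from its curve, and `2 * ε` is the radius of the
  -- balls in which the other polygon is deformed.
  obtain ⟨ε, hε, rfl⟩ : ∃ ε > 0, r = 3 * ε := ⟨r / 3, by positivity, by ring⟩
  have disj : ∀ {P Q : ClosedPolygon}, P.Approximates ε γ → Q.Approximates ε δ →
      ∀ i < P.length, ∀ j < Q.length, Disjoint (segment ℝ (P.vertex i) (P.vertex (i + 1)))
      (segment ℝ (Q.vertex j) (Q.vertex (j + 1))) := by
    intro P Q hP hQ i hi j hj
    refine Set.disjoint_left.2 fun z hz hz' => ?_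
    rw [segment_eq_image_lineMap] at hz
    obtain ⟨s, hs, rfl⟩ := hz
    have h1 := hP i hi s hs
    have h2 := le_dist_segment (r := 2 * ε) hQ (fun x y => by linarith [hd x y]) j hj _ hz'
      (((i + s) / P.length : ℝ) : UnitAddCircle)
    rw [dist_comm] at h2
    linarith
  obtain ⟨K, hK⟩ := exists_samplePolygon_approximates γ hε
  obtain ⟨K', hK'⟩ := exists_samplePolygon_approximates δ (half_pos hε)
  set P₀ := samplePolygon γ (K + 1) K.succ_pos
  have hP₀ : P₀.Approximates ε γ := hK _ _ (by omega)
  -- A reference pair with a regular diagram fixes the value. The approximation within `ε / 2`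
  -- leaves room for a translation shorter than `ε / 2` that makes the diagram regular.
  set Q₁ := samplePolygon δ (K' + 1) K'.succ_pos
  have hQ₁ : Q₁.Approximates (ε / 2) δ := hK' _ _ (by omega)
  obtain ⟨v, hv, hreg⟩ := Metric.dense_iff.1 (Measure.dense_of_ae (μ := volume)
    (ae_regularDiagram_translate P₀ Q₁)) 0 (ε / 2) (half_pos hε)
  rw [mem_ball_zero_iff] at hv
  have hQ₀ := hQ₁.translate hv
  rw [add_halves] at hQ₀
  set Q₀ := Q₁.translate v
  have key : ∀ P Q : ClosedPolygon, P.Approximates ε γ → Q.Approximates ε δ →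
      ∀ᶠ u in generic, polyOver u P.vertex P.length Q.vertex Q.length = (P₀.lk Q₀ : ZMod 2) := by
    intro P Q hP hQ
    filter_upwards [eventually_generic_of_nhds (ClosedPolygon.lk_eq hreg (disj hP₀ hQ₀)),
      eventually_generic_of_ae (ae_polyOver_eq hP hP₀ hQ hQ₀ hd)] with u h1 h2
    rw [h2, h1]
  refine ⟨P₀.lk Q₀, ⟨ε, hε, fun P Q hP hQ hPQ => ?_⟩, ε, hε, key⟩
  obtain ⟨u, h1, h2⟩ := ((key P Q hP hQ).and
    (eventually_generic_of_nhds (ClosedPolygon.lk_eq hPQ (disj hP hQ)))).exists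
  rw [← h1, ← h2]

/-! ### Crossings of plane segments, expressed by vertical rays from their endpoints -/

section

open Classical in
lemma affine_zero_iff {p q m M : ℝ} (hm : p + q * m ≠ 0) (hM : p + q * M ≠ 0) (h : m < M) :
    (if ∃ t, m ≤ t ∧ t ≤ M ∧ p + q * t = 0 then (1 : ZMod 2) else 0) =
      (if p + q * m < 0 then 1 else 0) + (if p + q * M < 0 then 1 else 0) := by
  have root : ∀ {t : ℝ}, p + q * t = 0 → q ≠ 0 := by
    rintro t ht rfl
    apply hm
    linarith
  rcases hm.lt_or_gt with h1 | h1 <;> rcases hM.lt_or_gt with h2 | h2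
  · rw [if_neg, if_pos h1, if_pos h2]
    · rfl
    · rintro ⟨t, ht1, ht2, e⟩
      rcases (root e).lt_or_gt with hq | hq <;> nlinarith
  · rw [if_pos, if_pos h1, if_neg h2.le.not_gt, add_zero]
    have hq : 0 < q := by
      by_contra! hq
      nlinarith
    refine ⟨-p / q, ?_, ?_, by field_simp; ring⟩
    · rw [le_div_iff₀ hq]; linarith
    · rw [div_le_iff₀ hq]; linarith
  · rw [if_pos, if_neg h1.le.not_gt, if_pos h2, zero_add]
    have hq : q < 0 := by
      by_contra! hq
      nlinarith
    refine ⟨-p / q, ?_, ?_, by field_simp [hq.ne]; ring⟩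
    · rw [le_div_iff_of_neg hq]; linarith
    · rw [div_le_iff_of_neg hq]; linarith
  · rw [if_neg, if_neg h1.le.not_gt, if_neg h2.le.not_gt, add_zero]
    rintro ⟨t, ht1, ht2, e⟩
    rcases (root e).lt_or_gt with hq | hq <;> nlinarith

open Classical in
/-- The parity of the number of zeros of an affine function on the intersection of two intervals is
determined by its signs at the endpoints of the intersection. -/
lemma affine_zero_inter {p q a b c d : ℝ} (hab : a < b) (hcd : c < d) (hac : a ≠ c) (had : a ≠ d)
    (hbc : b ≠ c) (hbd : b ≠ d) (ha : c < a → a < d → p + q * a ≠ 0)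
    (hb : c < b → b < d → p + q * b ≠ 0) (hc : a < c → c < b → p + q * c ≠ 0)
    (hd : a < d → d < b → p + q * d ≠ 0) :
    (if ∃ t, (a ≤ t ∧ t ≤ b) ∧ (c ≤ t ∧ t ≤ d) ∧ p + q * t = 0 then (1 : ZMod 2) else 0) =
      (if (a < c ∧ c < b) ∧ p + q * c < 0 then 1 else 0) +
      (if (a < d ∧ d < b) ∧ p + q * d < 0 then 1 else 0) +
      (if (c < a ∧ a < d) ∧ p + q * a < 0 then 1 else 0) +
      (if (c < b ∧ b < d) ∧ p + q * b < 0 then 1 else 0) := by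
  have key : ∀ m M, (∀ t, (a ≤ t ∧ t ≤ b) ∧ (c ≤ t ∧ t ≤ d) ∧ p + q * t = 0 ↔
      m ≤ t ∧ t ≤ M ∧ p + q * t = 0) → m < M → p + q * m ≠ 0 → p + q * M ≠ 0 →
      (if ∃ t, (a ≤ t ∧ t ≤ b) ∧ (c ≤ t ∧ t ≤ d) ∧ p + q * t = 0 then (1 : ZMod 2) else 0) =
      (if p + q * m < 0 then 1 else 0) + (if p + q * M < 0 then 1 else 0) := by
    intro m M h1 h2 h3 h4
    rw [← affine_zero_iff h3 h4 h2]
    exact if_congr (exists_congr h1) rfl rfl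
  -- If the intervals meet, the ends of their intersection are exactly those of `a`, `b`, `c`, `d`
  -- that lie inside the other interval. The four cases say which two these are; the other two terms
  -- vanish.
  by_cases h0 : b < c ∨ d < a
  · rw [if_neg, if_neg, if_neg, if_neg, if_neg]
    · simp
    all_goals
      first
        | (rintro ⟨⟨h1, h2⟩, -⟩; rcases h0 with h | h <;> linarith)
        | (rintro ⟨t, ⟨h1, h2⟩, ⟨h3, h4⟩, -⟩; rcases h0 with h | h <;> linarith)
  obtain ⟨h1, h2⟩ := not_or.1 h0
  have h1 : c < b := lt_of_le_of_ne (not_lt.1 h1) hbc.symm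
  have h2 : a < d := lt_of_le_of_ne (not_lt.1 h2) had
  rcases hac.lt_or_gt with h3 | h3 <;> rcases hbd.lt_or_gt with h4 | h4
  · rw [key c b (fun t => ⟨fun ⟨x, y, z⟩ => ⟨y.1, x.2, z⟩, fun ⟨x, y, z⟩ =>
      ⟨⟨by linarith, y⟩, ⟨x, by linarith⟩, z⟩⟩) h1 (hc h3 h1) (hb h1 h4)]
    simp only [h1, h2, h3, h4, h3.le.not_gt, h4.le.not_gt, true_and, and_true, and_false, false_and,
      and_self, if_false]
    ring
  · rw [key c d (fun t => ⟨fun ⟨x, y, z⟩ => ⟨y.1, y.2, z⟩, fun ⟨x, y, z⟩ =>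
      ⟨⟨by linarith, by linarith⟩, ⟨x, y⟩, z⟩⟩) hcd (hc h3 h1) (hd h2 h4)]
    simp only [h1, h2, h3, h4, h3.le.not_gt, h4.le.not_gt, true_and, and_true, and_false, false_and,
      and_self, if_false]
    ring
  · rw [key a b (fun t => ⟨fun ⟨x, y, z⟩ => ⟨x.1, x.2, z⟩, fun ⟨x, y, z⟩ =>
      ⟨⟨x, y⟩, ⟨by linarith, by linarith⟩, z⟩⟩) hab (ha h3 h2) (hb h1 h4)]
    simp only [h1, h2, h3, h4, h3.le.not_gt, h4.le.not_gt, true_and, and_true, and_false, false_and,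
      and_self, if_false]
    ring
  · rw [key a d (fun t => ⟨fun ⟨x, y, z⟩ => ⟨x.1, y.2, z⟩, fun ⟨x, y, z⟩ =>
      ⟨⟨x, by linarith⟩, ⟨by linarith, y⟩, z⟩⟩) h2 (ha h3 h2) (hd h2 h4)]
    simp only [h1, h2, h3, h4, h3.le.not_gt, h4.le.not_gt, true_and, and_true, and_false, false_and,
      and_self, if_false]
    ring

variable {ξ η : R3 →ₗ[ℝ] ℝ}

/-- The vertical line through `p` in the plane with coordinates `ξ`, `η` separates `a` from `b`. -/
def Straddles (ξ : R3 →ₗ[ℝ] ℝ) (p a b : R3) : Prop := ¬(ξ a < ξ p ↔ ξ b < ξ p)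

/-- The height of `p` above the line through `a` and `b` in the plane with coordinates `ξ`, `η`. -/
def gap (ξ η : R3 →ₗ[ℝ] ℝ) (p a b : R3) : ℝ :=
  η p - (η a + (η b - η a) / (ξ b - ξ a) * (ξ p - ξ a))

open Classical in
/-- Whether the upward ray from `p` meets the segment `[a, b]`. -/
def upCount (ξ η : R3 →ₗ[ℝ] ℝ) (p a b : R3) : ZMod 2 :=
  if Straddles ξ p a b ∧ gap ξ η p a b < 0 then 1 else 0

open Classical in
/-- Whether the downward ray from `p` meets the segment `[a, b]`. -/
def downCount (ξ η : R3 →ₗ[ℝ] ℝ) (p a b : R3) : ZMod 2 :=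
  if Straddles ξ p a b ∧ 0 < gap ξ η p a b then 1 else 0

open Classical in
/-- Whether `p` lies to the right of `a`. -/
def rightCount (ξ : R3 →ₗ[ℝ] ℝ) (a p : R3) : ZMod 2 := if ξ a < ξ p then 1 else 0

/-- The plane projections of the segments `[a, b]` and `[c, d]` meet. -/
def Meets (ξ η : R3 →ₗ[ℝ] ℝ) (a b c d : R3) : Prop :=
  ∃ x ∈ segment ℝ a b, ∃ y ∈ segment ℝ c d, ξ x = ξ y ∧ η x = η y

lemma straddles_comm {p a b : R3} : Straddles ξ p a b ↔ Straddles ξ p b a := by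
  unfold Straddles
  tauto

lemma gap_comm {p a b : R3} (h : ξ a ≠ ξ b) : gap ξ η p a b = gap ξ η p b a := by
  have h1 : ξ b - ξ a ≠ 0 := sub_ne_zero.2 h.symm
  have h2 : ξ a - ξ b ≠ 0 := sub_ne_zero.2 h
  unfold gap
  field_simp
  ring

open Classical in
lemma upCount_comm {p a b : R3} (h : ξ a ≠ ξ b) : upCount ξ η p a b = upCount ξ η p b a := by
  unfold upCount
  rw [gap_comm h]
  exact if_congr (and_congr_left' straddles_comm) rfl rfl

open Classical in
lemma downCount_comm {p a b : R3} (h : ξ a ≠ ξ b) :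
    downCount ξ η p a b = downCount ξ η p b a := by
  unfold downCount
  rw [gap_comm h]
  exact if_congr (and_congr_left' straddles_comm) rfl rfl

lemma straddles_iff {p a b : R3} (hab : ξ a < ξ b) (hpb : ξ p ≠ ξ b) :
    Straddles ξ p a b ↔ ξ a < ξ p ∧ ξ p < ξ b := by
  unfold Straddles
  constructor
  · intro h
    rcases hpb.lt_or_gt with h1 | h1
    · refine ⟨?_, h1⟩
      by_contra h2
      exact h ⟨fun h3 => absurd h3 h2, fun h3 => absurd h3 h1.le.not_gt⟩
    · exact absurd ⟨fun _ => h1, fun _ => hab.trans h1⟩ h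
  · rintro ⟨h1, h2⟩ h
    exact absurd (h.1 h1) h2.le.not_gt

lemma map_lineMap (f : R3 →ₗ[ℝ] ℝ) (a b : R3) (s : ℝ) :
    f (AffineMap.lineMap a b s) = f a + s * (f b - f a) := by
  simp [AffineMap.lineMap_apply]
  ring

/-- No endpoint of one of the segments `[a, b]` and `[c, d]` projects to the other one. -/
structure ChartRegular (ξ η : R3 →ₗ[ℝ] ℝ) (a b c d : R3) : Prop where
  left : ∀ y ∈ segment ℝ c d, ¬(ξ a = ξ y ∧ η a = η y)
  right : ∀ y ∈ segment ℝ c d, ¬(ξ b = ξ y ∧ η b = η y)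
  left' : ∀ y ∈ segment ℝ a b, ¬(ξ c = ξ y ∧ η c = η y)
  right' : ∀ y ∈ segment ℝ a b, ¬(ξ d = ξ y ∧ η d = η y)

lemma gap_ne_zero {p a b : R3} (h : ∀ y ∈ segment ℝ a b, ¬(ξ p = ξ y ∧ η p = η y))
    (hab : ξ a ≠ ξ b) (hpa : ξ p ≠ ξ a) (hpb : ξ p ≠ ξ b) (hp : Straddles ξ p a b) :
    gap ξ η p a b ≠ 0 := by
  wlog hlt : ξ a < ξ b generalizing a b
  · rw [gap_comm hab]
    exact this (by rwa [segment_symm]) hab.symm hpb hpa (straddles_comm.1 hp)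
      (lt_of_le_of_ne (not_lt.1 hlt) hab.symm)
  obtain ⟨h1, h2⟩ := (straddles_iff hlt hpb).1 hp
  have h3 : 0 < ξ b - ξ a := by linarith
  intro h0
  refine h (AffineMap.lineMap a b ((ξ p - ξ a) / (ξ b - ξ a))) ?_ ⟨?_, ?_⟩
  · rw [segment_eq_image_lineMap]
    exact ⟨_, ⟨div_nonneg (by linarith) h3.le, div_le_one_of_le₀ (by linarith) h3.le⟩, rfl⟩
  · rw [map_lineMap]
    field_simp
    ring
  · rw [map_lineMap]
    unfold gap at h0
    have : (ξ p - ξ a) / (ξ b - ξ a) * (η b - η a) = (η b - η a) / (ξ b - ξ a) * (ξ p - ξ a) := by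
      ring
    rw [this]
    linarith

/-- Both projections are graphs of affine functions of the coordinate `ξ`, and they meet where the
difference of these functions vanishes on the common interval. -/
lemma meets_iff {a b c d : R3} (hab : ξ a < ξ b) (hcd : ξ c < ξ d) :
    Meets ξ η a b c d ↔ ∃ t, (ξ a ≤ t ∧ t ≤ ξ b) ∧ (ξ c ≤ t ∧ t ≤ ξ d) ∧
      (η c - (η d - η c) / (ξ d - ξ c) * ξ c - η a + (η b - η a) / (ξ b - ξ a) * ξ a) +
      ((η d - η c) / (ξ d - ξ c) - (η b - η a) / (ξ b - ξ a)) * t = 0 := by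
  have h1 : 0 < ξ b - ξ a := by linarith
  have h2 : 0 < ξ d - ξ c := by linarith
  obtain ⟨m, hm⟩ : ∃ m, m = (η b - η a) / (ξ b - ξ a) := ⟨_, rfl⟩
  obtain ⟨n, hn⟩ : ∃ n, n = (η d - η c) / (ξ d - ξ c) := ⟨_, rfl⟩
  rw [← hm, ← hn]
  rw [eq_div_iff h1.ne'] at hm
  rw [eq_div_iff h2.ne'] at hn
  constructor
  · rintro ⟨x, hx, y, hy, e1, e2⟩
    rw [segment_eq_image_lineMap] at hx hy
    obtain ⟨s, ⟨hs0, hs1⟩, rfl⟩ := hx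
    obtain ⟨t, ⟨ht0, ht1⟩, rfl⟩ := hy
    simp only [map_lineMap] at e1 e2
    refine ⟨ξ a + s * (ξ b - ξ a), ⟨by nlinarith, by nlinarith⟩,
      ⟨by rw [e1]; nlinarith, by rw [e1]; nlinarith⟩, ?_⟩
    linear_combination -e2 + n * e1 + t * hn - s * hm
  · rintro ⟨t, ⟨ha, hb⟩, ⟨hc, hd⟩, e⟩
    refine ⟨AffineMap.lineMap a b ((t - ξ a) / (ξ b - ξ a)), ?_,
      AffineMap.lineMap c d ((t - ξ c) / (ξ d - ξ c)), ?_, ?_, ?_⟩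
    · rw [segment_eq_image_lineMap]
      exact ⟨_, ⟨div_nonneg (by linarith) h1.le, div_le_one_of_le₀ (by linarith) h1.le⟩, rfl⟩
    · rw [segment_eq_image_lineMap]
      exact ⟨_, ⟨div_nonneg (by linarith) h2.le, div_le_one_of_le₀ (by linarith) h2.le⟩, rfl⟩
    · rw [map_lineMap, map_lineMap, div_mul_cancel₀ _ h1.ne', div_mul_cancel₀ _ h2.ne']
      ring
    · rw [map_lineMap, map_lineMap, ← hm, ← hn]
      field_simp
      linarith

open Classical in
/-- The parity of the number of intersections of two plane segments, expressed by the rays from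
their endpoints. -/
lemma meets_count {a b c d : R3} (h : ChartRegular ξ η a b c d) (hab : ξ a ≠ ξ b)
    (hcd : ξ c ≠ ξ d) (hac : ξ a ≠ ξ c) (had : ξ a ≠ ξ d) (hbc : ξ b ≠ ξ c) (hbd : ξ b ≠ ξ d) :
    (if Meets ξ η a b c d then (1 : ZMod 2) else 0) =
      upCount ξ η c a b + upCount ξ η d a b + (downCount ξ η a c d + downCount ξ η b c d) := by
  wlog h1 : ξ a < ξ b generalizing a b
  · have h2 := this (a := b) (b := a) ⟨h.right, h.left, by rw [segment_symm]; exact h.left',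
      by rw [segment_symm]; exact h.right'⟩ hab.symm hbc hbd hac had
      (lt_of_le_of_ne (not_lt.1 h1) hab.symm)
    rw [upCount_comm hab, upCount_comm (p := d) hab, add_comm (downCount ξ η a c d), ← h2, Meets,
      Meets, segment_symm]
  wlog h2 : ξ c < ξ d generalizing c d
  · have h3 := this (c := d) (d := c) hcd.symm ⟨by rw [segment_symm]; exact h.left,
      by rw [segment_symm]; exact h.right, h.right', h.left'⟩ had hac hbd hbc
      (lt_of_le_of_ne (not_lt.1 h2) hcd.symm)
    rw [downCount_comm hcd, downCount_comm (p := b) hcd, add_comm (upCount ξ η c a b), ← h3, Meets,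
      Meets, segment_symm ℝ c d]
  have s1 := straddles_iff h1 hbc.symm
  have s2 := straddles_iff h1 hbd.symm
  have s3 := straddles_iff h2 had
  have s4 := straddles_iff h2 hbd
  have g1 := gap_ne_zero h.left' hab hac.symm hbc.symm
  have g2 := gap_ne_zero h.right' hab had.symm hbd.symm
  have g3 := gap_ne_zero h.left hcd hac had
  have g4 := gap_ne_zero h.right hcd hbc hbd
  rw [s1] at g1
  rw [s2] at g2
  rw [s3] at g3
  rw [s4] at g4
  have k1 : ξ b - ξ a ≠ 0 := by linarith
  have k2 : ξ d - ξ c ≠ 0 := by linarith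
  have m := meets_iff (η := η) h1 h2
  obtain ⟨p, hp⟩ : ∃ p, p = η c - (η d - η c) / (ξ d - ξ c) * ξ c - η a +
    (η b - η a) / (ξ b - ξ a) * ξ a := ⟨_, rfl⟩
  obtain ⟨q, hq⟩ : ∃ q, q = (η d - η c) / (ξ d - ξ c) - (η b - η a) / (ξ b - ξ a) := ⟨_, rfl⟩
  -- The function `p + q * t` is the height of the line through `c`, `d` minus that of the line
  -- through `a`, `b`. It is negative at an endpoint of `[c, d]` that lies below `[a, b]`, and at an
  -- endpoint of `[a, b]` that lies above `[c, d]`; hence upward rays from the former and downward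
  -- rays from the latter.
  have e1 : gap ξ η c a b = p + q * ξ c := by
    rw [hp, hq, gap]
    ring
  have e2 : gap ξ η d a b = p + q * ξ d := by
    rw [hp, hq, gap]
    field_simp
    ring
  have e3 : gap ξ η a c d = -(p + q * ξ a) := by
    rw [hp, hq, gap]
    ring
  have e4 : gap ξ η b c d = -(p + q * ξ b) := by
    rw [hp, hq, gap]
    field_simp
    ring
  rw [e1] at g1
  rw [e2] at g2
  rw [e3, neg_ne_zero] at g3
  rw [e4, neg_ne_zero] at g4
  rw [← hp, ← hq] at m
  have := affine_zero_inter h1 h2 hac had hbc hbd (fun x y => g3 ⟨x, y⟩) (fun x y => g4 ⟨x, y⟩)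
    (fun x y => g1 ⟨x, y⟩) (fun x y => g2 ⟨x, y⟩)
  rw [if_congr m rfl rfl, this, ← add_assoc]
  unfold upCount downCount
  rw [e1, e2, e3, e4]
  congr 1
  congr 1
  congr 1
  · exact (if_congr (and_congr_left' s1) rfl rfl).symm
  · exact (if_congr (and_congr_left' s2) rfl rfl).symm
  · exact (if_congr (and_congr s3 neg_pos) rfl rfl).symm
  · exact (if_congr (and_congr s4 neg_pos) rfl rfl).symm

-- The full vertical line through `p` meets the segment exactly when one endpoint is to the left of
-- `p` and the other is not.
open Classical in
lemma downCount_eq {p a b : R3} (h : ∀ y ∈ segment ℝ a b, ¬(ξ p = ξ y ∧ η p = η y))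
    (hab : ξ a ≠ ξ b) (hpa : ξ p ≠ ξ a) (hpb : ξ p ≠ ξ b) :
    downCount ξ η p a b = upCount ξ η p a b + (rightCount ξ a p + rightCount ξ b p) := by
  have h0 := gap_ne_zero h hab hpa hpb
  unfold downCount upCount rightCount
  by_cases hs : Straddles ξ p a b
  · have h1 : (if ξ a < ξ p then (1 : ZMod 2) else 0) + (if ξ b < ξ p then 1 else 0) = 1 := by
      unfold Straddles at hs
      by_cases h1 : ξ a < ξ p <;> by_cases h2 : ξ b < ξ p <;> simp_all
    rw [h1]
    rcases (h0 hs).lt_or_gt with h2 | h2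
    · rw [if_neg (fun h3 => h2.not_gt h3.2), if_pos ⟨hs, h2⟩]; rfl
    · rw [if_pos ⟨hs, h2⟩, if_neg (fun h3 => h2.not_gt h3.2)]; rfl
  · rw [if_neg (fun h => hs h.1), if_neg (fun h => hs h.1), zero_add]
    have h1 : ξ a < ξ p ↔ ξ b < ξ p := not_not.1 hs
    rw [if_congr h1 rfl rfl, CharTwo.add_self_eq_zero]

/-- `ξ` and `η` are coordinates on the quotient of the space by the line spanned by `u`, and `ξ`
separates the points of `A`. -/
structure Chart (u : R3) (A : Finset R3) (ξ η : R3 →ₗ[ℝ] ℝ) : Prop where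
  ker : ∀ x, (ξ x = 0 ∧ η x = 0) ↔ ∃ t : ℝ, x = t • u
  inj : ∀ a ∈ A, ∀ b ∈ A, a ≠ b → ξ a ≠ ξ b

/-- Project along `u` to the horizontal plane and shear by a factor `k`: no two points of `A` have
the same projection, so only finitely many `k` let two of them share their first coordinate. -/
lemma exists_chart {u : R3} (hu : u 2 ≠ 0) {A : Finset R3}
    (hA : ∀ a ∈ A, ∀ b ∈ A, a ≠ b → ∀ t : ℝ, a - b ≠ t • u) :
    ∃ ξ η : R3 →ₗ[ℝ] ℝ, Chart u A ξ η := by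
  classical
  let f : Fin 3 → R3 →ₗ[ℝ] ℝ := fun i =>
    { toFun := fun x => x i - u i / u 2 * x 2
      map_add' := fun x y => by simp only [PiLp.add_apply]; ring
      map_smul' := fun t x => by simp only [PiLp.smul_apply, smul_eq_mul, RingHom.id_apply]; ring }
  have hf : ∀ i x, f i x = x i - u i / u 2 * x 2 := fun i x => rfl
  have ker : ∀ x, (f 0 x = 0 ∧ f 1 x = 0) ↔ ∃ t : ℝ, x = t • u := by
    intro x
    constructor
    · rintro ⟨h0, h1⟩
      rw [hf] at h0 h1
      refine ⟨x 2 / u 2, ?_⟩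
      ext i
      rw [PiLp.smul_apply, smul_eq_mul]
      fin_cases i
      · simp only [Fin.zero_eta]
        linear_combination h0
      · simp only [Fin.mk_one]
        linear_combination h1
      · simp only [Fin.reduceFinMk]
        field_simp
    · rintro ⟨t, rfl⟩
      simp only [hf, PiLp.smul_apply, smul_eq_mul]
      constructor <;> field_simp <;> ring
  obtain ⟨k, hk⟩ := Infinite.exists_notMem_finset
    ((A ×ˢ A).image fun z => -(f 0 (z.1 - z.2) / f 1 (z.1 - z.2)))
  refine ⟨f 0 + k • f 1, f 1, fun x => ?_, fun a ha b hb hab e => ?_⟩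
  · rw [← ker]
    simp only [LinearMap.add_apply, LinearMap.smul_apply, smul_eq_mul]
    constructor
    · rintro ⟨h0, h1⟩
      rw [h1] at h0
      exact ⟨by simpa using h0, h1⟩
    · rintro ⟨h0, h1⟩
      rw [h0, h1]
      simp
  · have e' : f 0 (a - b) + k * f 1 (a - b) = 0 := by
      simp only [LinearMap.add_apply, LinearMap.smul_apply, smul_eq_mul] at e
      rw [map_sub, map_sub]
      linarith
    by_cases h1 : f 1 (a - b) = 0
    · rw [h1, mul_zero, add_zero] at e'
      obtain ⟨t, ht⟩ := (ker _).1 ⟨e', h1⟩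
      exact hA a ha b hb hab t ht
    · refine hk (Finset.mem_image.2 ⟨(a, b), Finset.mk_mem_product ha hb, ?_⟩)
      simp only
      field_simp
      linarith

-- When the projections meet, disjointness forces one segment to pass over the other. If each passed
-- over the other, a positive multiple of `u` would be a combination of the directions of the two
-- segments.
open Classical in
lemma overCount_add_swap {u a b c d : R3} {A : Finset R3} (hξ : Chart u A ξ η)
    (hd : Disjoint (segment ℝ a b) (segment ℝ c d))
    (hu : u ∉ Submodule.span ℝ {b - a, d - c}) :
    overCount u a b c d + overCount u c d a b = if Meets ξ η a b c d then 1 else 0 := by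
  have hm : Meets ξ η a b c d ↔ Over u a b c d ∨ Over u c d a b := by
    constructor
    · rintro ⟨x, hx, y, hy, e1, e2⟩
      obtain ⟨t, ht⟩ := (hξ.ker (x - y)).1 (by rw [map_sub, map_sub, e1, e2]; simp)
      rcases lt_trichotomy t 0 with h | h | h
      · exact Or.inr ⟨y, hy, x, hx, -t, neg_pos.2 h, by rw [neg_smul, ← ht]; abel⟩
      · rw [h, zero_smul] at ht
        exact absurd (sub_eq_zero.1 ht ▸ hy) (Set.disjoint_left.1 hd hx)
      · exact Or.inl ⟨x, hx, y, hy, t, h, ht⟩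
    · rintro (⟨x, hx, y, hy, t, -, e⟩ | ⟨y, hy, x, hx, t, -, e⟩)
      · obtain ⟨e1, e2⟩ := (hξ.ker (x - y)).2 ⟨t, e⟩
        rw [map_sub, sub_eq_zero] at e1 e2
        exact ⟨x, hx, y, hy, e1, e2⟩
      · obtain ⟨e1, e2⟩ := (hξ.ker (y - x)).2 ⟨t, e⟩
        rw [map_sub, sub_eq_zero] at e1 e2
        exact ⟨x, hx, y, hy, e1.symm, e2.symm⟩
  have hn : ¬(Over u a b c d ∧ Over u c d a b) := by
    rintro ⟨⟨x, hx, y, hy, t, ht, e⟩, y', hy', x', hx', t', ht', e'⟩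
    rw [segment_eq_image_lineMap] at hx hy hx' hy'
    obtain ⟨s1, -, rfl⟩ := hx
    obtain ⟨s2, -, rfl⟩ := hy
    obtain ⟨s3, -, rfl⟩ := hx'
    obtain ⟨s4, -, rfl⟩ := hy'
    obtain ⟨i, hi⟩ : ∃ i, i * (t + t') = 1 := ⟨(t + t')⁻¹, inv_mul_cancel₀ (by positivity)⟩
    refine notMem_span_pair hu (i * (s1 - s3)) (i * (s4 - s2)) ?_
    have : u = i • (t • u + t' • u) := by rw [← add_smul, smul_smul, hi, one_smul]
    rw [this, ← e, ← e']
    simp only [AffineMap.lineMap_apply, vsub_eq_sub, vadd_eq_add]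
    module
  rw [if_congr hm rfl rfl, overCount, overCount]
  by_cases hA : Over u a b c d <;> by_cases hB : Over u c d a b
  · exact absurd ⟨hA, hB⟩ hn
  all_goals simp only [hA, hB, or_true, or_false, or_self, if_true, if_false, add_zero, zero_add]

lemma Chart.regular {u a b c d : R3} {A : Finset R3} (hξ : Chart u A ξ η)
    (hd : Disjoint (segment ℝ a b) (segment ℝ c d)) (h1 : u ∉ Submodule.span ℝ {a - c, d - c})
    (h2 : u ∉ Submodule.span ℝ {b - c, d - c}) (h3 : u ∉ Submodule.span ℝ {c - a, b - a})
    (h4 : u ∉ Submodule.span ℝ {d - a, b - a}) : ChartRegular ξ η a b c d := by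
  have key : ∀ {p c d : R3}, p ∉ segment ℝ c d → u ∉ Submodule.span ℝ {p - c, d - c} →
      ∀ y ∈ segment ℝ c d, ¬(ξ p = ξ y ∧ η p = η y) := by
    rintro p c d hp hu y hy ⟨e1, e2⟩
    obtain ⟨t, ht⟩ := (hξ.ker (p - y)).1 (by rw [map_sub, map_sub, e1, e2]; simp)
    rcases eq_or_ne t 0 with rfl | h0
    · rw [zero_smul, sub_eq_zero] at ht
      exact hp (ht ▸ hy)
    · rw [segment_eq_image_lineMap] at hy
      obtain ⟨s, -, rfl⟩ := hy
      refine notMem_span_pair hu t⁻¹ (-(t⁻¹ * s)) ?_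
      have : u = t⁻¹ • (t • u) := by rw [smul_smul, inv_mul_cancel₀ h0, one_smul]
      rw [this, ← ht]
      simp only [AffineMap.lineMap_apply, vsub_eq_sub, vadd_eq_add]
      module
  refine ⟨key ?_ h1, key ?_ h2, key ?_ h3, key ?_ h4⟩
  · exact Set.disjoint_left.1 hd (left_mem_segment ..)
  · exact Set.disjoint_left.1 hd (right_mem_segment ..)
  · exact Set.disjoint_right.1 hd (left_mem_segment ..)
  · exact Set.disjoint_right.1 hd (right_mem_segment ..)

end

/-! ### The van Kampen obstruction of the complete graph on five vertices -/

section

variable {ξ η : R3 →ₗ[ℝ] ℝ}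

/-- The mod 2 number of times that the upward ray from `x` meets the path `p`. -/
def upPath (ξ η : R3 →ₗ[ℝ] ℝ) (x : R3) (p : ℕ → R3) (N : ℕ) : ZMod 2 :=
  ∑ i ∈ Finset.range N, upCount ξ η x (p i) (p (i + 1))

/-- The mod 2 number of times that the downward ray from `x` meets the path `p`. -/
def downPath (ξ η : R3 →ₗ[ℝ] ℝ) (x : R3) (p : ℕ → R3) (N : ℕ) : ZMod 2 :=
  ∑ i ∈ Finset.range N, downCount ξ η x (p i) (p (i + 1))

/-- Summing `meets_count` over all pairs of edges, the ray from each inner vertex of a path is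
counted twice; only rays from the ends of the paths remain. -/
lemma polyOver_add_swap {u : R3} {p q : ℕ → R3} {N M : ℕ}
    (h : ∀ i < N, ∀ j < M, overCount u (p i) (p (i + 1)) (q j) (q (j + 1)) +
      overCount u (q j) (q (j + 1)) (p i) (p (i + 1)) =
      upCount ξ η (q j) (p i) (p (i + 1)) + upCount ξ η (q (j + 1)) (p i) (p (i + 1)) +
      (downCount ξ η (p i) (q j) (q (j + 1)) + downCount ξ η (p (i + 1)) (q j) (q (j + 1)))) :
    polyOver u p N q M + polyOver u q M p N = upPath ξ η (q 0) p N + upPath ξ η (q M) p N +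
      downPath ξ η (p 0) q M + downPath ξ η (p N) q M := by
  have e : polyOver u q M p N = ∑ i ∈ Finset.range N, ∑ j ∈ Finset.range M,
      overCount u (q j) (q (j + 1)) (p i) (p (i + 1)) := Finset.sum_comm
  rw [e, polyOver]
  simp only [pathOver]
  rw [← Finset.sum_add_distrib]
  simp only [← Finset.sum_add_distrib]
  have e2 : ∀ i ∈ Finset.range N, (∑ j ∈ Finset.range M,
      (overCount u (p i) (p (i + 1)) (q j) (q (j + 1)) +
      overCount u (q j) (q (j + 1)) (p i) (p (i + 1)))) =
      (upCount ξ η (q 0) (p i) (p (i + 1)) + upCount ξ η (q M) (p i) (p (i + 1))) +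
      (downPath ξ η (p i) q M + downPath ξ η (p (i + 1)) q M) := by
    intro i hi
    rw [Finset.sum_congr rfl fun j hj => h i (Finset.mem_range.1 hi) j (Finset.mem_range.1 hj),
      Finset.sum_add_distrib, sum_range_add_succ (fun j => upCount ξ η (q j) (p i) (p (i + 1))),
      Finset.sum_add_distrib]
    rfl
  rw [Finset.sum_congr rfl e2, Finset.sum_add_distrib, Finset.sum_add_distrib,
    sum_range_add_succ (fun i => downPath ξ η (p i) q M)]
  simp only [upPath]
  ring

/-- The combinatorial core of the van Kampen obstruction of the complete graph on five vertices. -/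
lemma sum_K5 {r r' : Fin 5 → Fin 5 → Fin 5 → ZMod 2} {o : Fin 5 → Fin 5 → ZMod 2}
    {y : Fin 5 → Fin 5 → Fin 5 → Fin 5 → ZMod 2}
    (hr : ∀ c a b, c ≠ a → c ≠ b → a < b → r' c a b = r c a b + (o a c + o b c))
    (ho : ∀ a b, a < b → o b a = 1 + o a b)
    (hy : ∀ a b c d, a < b → c < d → a < c → b ≠ c → b ≠ d →
      y a b c d = r c a b + r d a b + r' a c d + r' b c d) :
    y 0 1 2 3 + y 0 1 2 4 + y 0 1 3 4 + y 0 2 1 3 + y 0 2 1 4 + y 0 2 3 4 + y 0 3 1 2 +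
      y 0 3 1 4 + y 0 3 2 4 + y 0 4 1 2 + y 0 4 1 3 + y 0 4 2 3 + y 1 2 3 4 + y 1 3 2 4 +
      y 1 4 2 3 = 1 := by
  -- A vertex `c` and an edge `ab` avoiding it occur in two of the fifteen pairs, one for each
  -- remaining vertex `d`. So the ray terms cancel once all are made upward by `hr`, and the order
  -- terms left over sum to 1 by `ho`.
  simp (discharger := decide) only [hy, hr, ho]
  ring_nf
  reduce_mod_char

lemma ae_apply_two_ne_zero : ∀ᵐ u : R3, u 2 ≠ 0 := by
  let f : R3 →ₗ[ℝ] ℝ :=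
    { toFun := fun x => x 2
      map_add' := fun x y => rfl
      map_smul' := fun t x => rfl }
  have h : LinearMap.ker f ≠ ⊤ := by
    intro h
    have h1 : vertical ∈ LinearMap.ker f := h ▸ Submodule.mem_top
    have h2 : vertical 2 = 0 := h1
    rw [vertical_two] at h2
    exact one_ne_zero h2
  filter_upwards [ae_notMem_submodule h] with u hu h0 using hu h0

/-- The van Kampen obstruction: if the edges of the complete graph on five vertices are mapped to
polygonal paths such that disjoint edges have disjoint images, then, with respect to a generic
direction, the number of crossings between disjoint edges is odd. -/
theorem ae_vanKampen {X : Fin 5 → R3} {p : Fin 5 → Fin 5 → ℕ → R3} {N : ℕ} (hN : 0 < N)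
    (hX : Function.Injective X) (hp0 : ∀ a b, p a b 0 = X a) (hpN : ∀ a b, p a b N = X b)
    (hstep : ∀ a b, a ≠ b → ∀ i < N, p a b i ≠ p a b (i + 1))
    (hd : ∀ a b c d, a ≠ b → c ≠ d → a ≠ c → a ≠ d → b ≠ c → b ≠ d → ∀ i < N, ∀ j < N,
      Disjoint (segment ℝ (p a b i) (p a b (i + 1))) (segment ℝ (p c d j) (p c d (j + 1)))) :
    ∀ᵐ u : R3, ∀ y : Fin 5 → Fin 5 → Fin 5 → Fin 5 → ZMod 2,
      (∀ a b c d, a < b → c < d → a < c → b ≠ c → b ≠ d →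
      y a b c d = polyOver u (p a b) N (p c d) N + polyOver u (p c d) N (p a b) N) →
      y 0 1 2 3 + y 0 1 2 4 + y 0 1 3 4 + y 0 2 1 3 + y 0 2 1 4 + y 0 2 3 4 + y 0 3 1 2 +
      y 0 3 1 4 + y 0 3 2 4 + y 0 4 1 2 + y 0 4 1 3 + y 0 4 2 3 + y 1 2 3 4 + y 1 3 2 4 +
      y 1 4 2 3 = 1 := by
  classical
  let A : Finset R3 := (Finset.univ ×ˢ Finset.univ ×ˢ Finset.range (N + 1)).image
    fun z : Fin 5 × Fin 5 × ℕ => p z.1 z.2.1 z.2.2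
  have hA : ∀ a b i, i ≤ N → p a b i ∈ A := fun a b i hi =>
    Finset.mem_image.2 ⟨(a, b, i), by simpa using hi, rfl⟩
  have hXA : ∀ a, X a ∈ A := fun a => hp0 a a ▸ hA a a 0 (Nat.zero_le N)
  let D : Finset R3 := (A ×ˢ A).image fun z => z.1 - z.2
  have hD : ∀ x ∈ A, ∀ y ∈ A, x - y ∈ D := fun x hx y hy =>
    Finset.mem_image.2 ⟨(x, y), Finset.mk_mem_product hx hy, rfl⟩
  filter_upwards [ae_generic D, ae_apply_two_ne_zero] with u hu hu2 y hy
  have hu' : ∀ a ∈ A, ∀ b ∈ A, ∀ c ∈ A, ∀ d ∈ A, u ∉ Submodule.span ℝ {a - b, c - d} :=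
    fun a ha b hb c hc d hd => hu _ (hD a ha b hb) _ (hD c hc d hd)
  obtain ⟨ξ, η, hξ⟩ := exists_chart (A := A) hu2 (by
    intro a ha b hb hab t e
    have ht : t ≠ 0 := by
      rintro rfl
      rw [zero_smul, sub_eq_zero] at e
      exact hab e
    refine notMem_span_pair (hu' a ha b hb a ha b hb) t⁻¹ 0 ?_
    rw [e, smul_smul, inv_mul_cancel₀ ht, one_smul, zero_smul, add_zero])
  have reg : ∀ a b c d, a ≠ b → c ≠ d → a ≠ c → a ≠ d → b ≠ c → b ≠ d → ∀ i < N, ∀ j < N,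
      ChartRegular ξ η (p a b i) (p a b (i + 1)) (p c d j) (p c d (j + 1)) := by
    intro a b c d h1 h2 h3 h4 h5 h6 i hi j hj
    have a1 := hA a b i hi.le
    have a2 := hA a b (i + 1) hi
    have a3 := hA c d j hj.le
    have a4 := hA c d (j + 1) hj
    exact hξ.regular (hd a b c d h1 h2 h3 h4 h5 h6 i hi j hj) (hu' _ a1 _ a3 _ a4 _ a3)
      (hu' _ a2 _ a3 _ a4 _ a3) (hu' _ a3 _ a1 _ a2 _ a1) (hu' _ a4 _ a1 _ a2 _ a1)
  have step : ∀ a b, a ≠ b → ∀ i < N, ξ (p a b i) ≠ ξ (p a b (i + 1)) := fun a b hab i hi =>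
    hξ.inj _ (hA a b i hi.le) _ (hA a b (i + 1) hi) (hstep a b hab i hi)
  -- The hypothesis speaks of disjoint edges only. The vertex `c` is seen to avoid the path from `a`
  -- to `b` as the starting point of the edge to an auxiliary vertex `d`.
  have exd : ∀ a b c : Fin 5, ∃ d, c ≠ d ∧ a ≠ d ∧ b ≠ d := by decide
  refine sum_K5 (r := fun c a b => upPath ξ η (X c) (p a b) N)
    (r' := fun c a b => downPath ξ η (X c) (p a b) N)
    (o := fun a c => rightCount ξ (X a) (X c)) ?_ ?_ ?_
  · intro c a b hca hcb hab
    obtain ⟨d, h1, h2, h3⟩ := exd a b c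
    have key : ∀ i ∈ Finset.range N, downCount ξ η (X c) (p a b i) (p a b (i + 1)) =
        upCount ξ η (X c) (p a b i) (p a b (i + 1)) +
          (rightCount ξ (p a b i) (X c) + rightCount ξ (p a b (i + 1)) (X c)) := by
      intro i hi
      have hi := Finset.mem_range.1 hi
      have hreg := (reg c d a b h1 hab.ne hca hcb h2.symm h3.symm 0 hN i hi).left
      have hdis := hd c d a b h1 hab.ne hca hcb h2.symm h3.symm 0 hN i hi
      rw [hp0] at hreg hdis
      refine downCount_eq hreg (step a b hab.ne i hi) (hξ.inj _ (hXA c) _ (hA a b i hi.le) ?_)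
        (hξ.inj _ (hXA c) _ (hA a b (i + 1) hi) ?_)
      · intro e
        exact Set.disjoint_left.1 hdis (left_mem_segment ..) (e ▸ left_mem_segment ..)
      · intro e
        exact Set.disjoint_left.1 hdis (left_mem_segment ..) (e ▸ right_mem_segment ..)
    simp only [downPath, upPath]
    rw [Finset.sum_congr rfl key, Finset.sum_add_distrib,
      sum_range_add_succ (fun i => rightCount ξ (p a b i) (X c)), hp0, hpN]
  · intro a b hab
    have := hξ.inj _ (hXA a) _ (hXA b) (hX.ne hab.ne)
    simp only [rightCount]
    rcases this.lt_or_gt with h | h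
    · rw [if_neg h.le.not_gt, if_pos h]; rfl
    · rw [if_pos h, if_neg h.le.not_gt]; rfl
  · intro a b c d hab hcd hac hbc hbd
    have had := (hac.trans hcd).ne
    rw [hy a b c d hab hcd hac hbc hbd, polyOver_add_swap (ξ := ξ) (η := η), hp0, hp0, hpN, hpN]
    intro i hi j hj
    have hdis := hd a b c d hab.ne hcd.ne hac.ne had hbc hbd i hi j hj
    have hne : ∀ i' ≤ N, ∀ j' ≤ N, p a b i' ∈ segment ℝ (p a b i) (p a b (i + 1)) →
        p c d j' ∈ segment ℝ (p c d j) (p c d (j + 1)) → ξ (p a b i') ≠ ξ (p c d j') := by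
      intro i' hi' j' hj' h1 h2
      exact hξ.inj _ (hA a b i' hi') _ (hA c d j' hj') fun e =>
        Set.disjoint_left.1 hdis h1 (e ▸ h2)
    rw [overCount_add_swap hξ hdis (hu' _ (hA a b (i + 1) hi) _ (hA a b i hi.le) _
      (hA c d (j + 1) hj) _ (hA c d j hj.le))]
    exact meets_count (reg a b c d hab.ne hcd.ne hac.ne had hbc hbd i hi j hj)
      (step a b hab.ne i hi) (step c d hcd.ne j hj)
      (hne _ hi.le _ hj.le (left_mem_segment ..) (left_mem_segment ..))
      (hne _ hi.le _ hj (left_mem_segment ..) (right_mem_segment ..))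
      (hne _ hi _ hj.le (right_mem_segment ..) (left_mem_segment ..))
      (hne _ hi _ hj (right_mem_segment ..) (right_mem_segment ..))

end

/-! ### Cycles of the complete graph as simple closed curves in its realization -/

section

variable {V : Type}

/-- A cycle in the complete graph on `V`, given by the list of its vertices. -/
structure VertexCycle (V : Type) where
  list : List V
  nodup : list.Nodup
  three_le : 3 ≤ list.length

namespace VertexCycle

instance [Finite V] : Finite (VertexCycle V) :=
  have := Fintype.ofFinite V
  have := Classical.decEq V
  Finite.of_injective (β := {l : List V // l.Nodup}) (fun c => ⟨c.list, c.nodup⟩) fun c c' h => by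
    cases c
    cases c'
    simpa using h

/-- The length of a cycle. -/
def length (c : VertexCycle V) : ℕ := c.list.length

lemma length_pos (c : VertexCycle V) : 0 < c.length := by
  have := c.three_le
  unfold length
  omega

/-- The vertices of a cycle in cyclic order. -/
def vertex (c : VertexCycle V) (i : ℕ) : V := c.list[i % c.length]'(Nat.mod_lt _ c.length_pos)

lemma vertex_mem (c : VertexCycle V) (i : ℕ) : c.vertex i ∈ c.list := List.getElem_mem _

lemma vertex_eq_iff (c : VertexCycle V) {i j : ℕ} :
    c.vertex i = c.vertex j ↔ i % c.length = j % c.length := by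
  unfold vertex
  exact c.nodup.getElem_inj_iff

lemma vertex_ne_succ (c : VertexCycle V) (i : ℕ) : c.vertex i ≠ c.vertex (i + 1) := by
  rw [Ne, vertex_eq_iff]
  intro h
  have h1 : (i + 0) ≡ (i + 1) [MOD c.length] := h
  have h2 := Nat.ModEq.add_left_cancel' i h1
  have := (Nat.modEq_iff_dvd' (by omega)).1 h2
  have h3 : 3 ≤ c.length := c.three_le
  have := Nat.le_of_dvd (by omega) this
  omega

/-- The piecewise linear function on the circle which is `1` at `k / m` and vanishes outside of the
interval from `(k - 1) / m` to `(k + 1) / m`. -/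
def tent (m k : ℕ) (x : UnitAddCircle) : ℝ :=
  max 0 (1 - m * ‖x - ((k / m : ℝ) : UnitAddCircle)‖)

/-- On the arc from `k / m` to `(k + 1) / m` only the tents of its two ends are nonzero, so that
`VertexCycle.point` interpolates affinely there. -/
lemma tent_apply {m k j : ℕ} {s : ℝ} (hm : 3 ≤ m) (hk : k < m) (hj : j < m) (hs0 : 0 ≤ s)
    (hs1 : s ≤ 1) : tent m j (((k + s) / m : ℝ) : UnitAddCircle) =
      (if j = k then 1 - s else 0) + (if j = (k + 1) % m then s else 0) := by
  have hm0 : (0 : ℝ) < m := by exact_mod_cast (by omega : 0 < m)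
  have hm3 : (3 : ℝ) ≤ m := by exact_mod_cast hm
  have hk1 : (k + 1) % m ≠ k := by
    rcases (Nat.succ_le_of_lt hk).lt_or_eq with h | h
    · rw [Nat.mod_eq_of_lt h]; omega
    · rw [show k + 1 = m from h, Nat.mod_self]; omega
  have hshift : ∀ n : ℤ, ‖((((k + s) / m : ℝ) : UnitAddCircle) - ((j / m : ℝ) : UnitAddCircle))‖ =
      ‖(((k + s - j - n * m) / m : ℝ) : UnitAddCircle)‖ := by
    intro n
    rw [← AddCircle.coe_sub, ← sub_div]
    have : (k + s - j - n * m) / m = (k + s - j) / m - n := by field_simp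
    rw [this, AddCircle.coe_sub]
    have : ((n : ℝ) : UnitAddCircle) = 0 := by
      rw [AddCircle.coe_eq_zero_iff]
      exact ⟨n, by simp⟩
    rw [this, sub_zero]
  have hnorm : ∀ t : ℝ, |t| ≤ 1 → ‖((t / m : ℝ) : UnitAddCircle)‖ = |t| / m := by
    intro t ht
    have : |t / m| = |t| / m := by rw [abs_div, abs_of_pos hm0]
    rw [← this, AddCircle.norm_coe_eq_abs_iff _ one_ne_zero, this, abs_one,
      div_le_div_iff₀ hm0 two_pos]
    linarith
  have tent_eq : ∀ n : ℤ, |k + s - j - n * m| ≤ 1 →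
      tent m j (((k + s) / m : ℝ) : UnitAddCircle) = max 0 (1 - |k + s - j - n * m|) := by
    intro n hn
    rw [tent, hshift n, hnorm _ hn, mul_div_cancel₀ _ hm0.ne']
  by_cases h1 : j = k
  · subst h1
    have e : (j : ℝ) + s - j - (0 : ℤ) * m = s := by push_cast; ring
    rw [tent_eq 0 (by rw [e, abs_le]; constructor <;> linarith), e, abs_of_nonneg hs0,
      max_eq_right (by linarith), if_pos rfl, if_neg hk1.symm, add_zero]
  by_cases h2 : j = (k + 1) % m
  -- On the last arc the next index is 0 instead of `m`, which costs one full turn of the circle.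
  · have e : (k : ℝ) + s - j - ((if k + 1 = m then 1 else 0 : ℤ) : ℝ) * m = s - 1 := by
      rcases (Nat.succ_le_of_lt hk).lt_or_eq with h | h
      · rw [Nat.mod_eq_of_lt h] at h2
        rw [if_neg (by omega), h2]
        push_cast
        ring
      · have h : k + 1 = m := h
        rw [h, Nat.mod_self] at h2
        rw [if_pos h, h2, ← h]
        push_cast
        ring
    rw [tent_eq _ (by rw [e, abs_le]; constructor <;> linarith), e, abs_of_nonpos (by linarith),
      max_eq_right (by linarith), if_neg h1, if_pos h2]
    ring
  · rw [if_neg h1, if_neg h2, add_zero, tent]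
    apply max_eq_left
    set t : ℝ := (k + s - j) / m with ht
    have e1 : (((k + s) / m : ℝ) : UnitAddCircle) - ((j / m : ℝ) : UnitAddCircle) = (t : UnitAddCircle) := by
      rw [← AddCircle.coe_sub, ← sub_div]
    rw [e1, UnitAddCircle.norm_eq]
    have e2 : m * |t - round t| = |((k : ℤ) - j - round t * m : ℤ) + s| := by
      nth_rw 1 [← abs_of_pos hm0]
      rw [← abs_mul]
      congr 1
      rw [ht]
      push_cast
      field_simp
      ring
    rw [e2]
    -- The distance to `j / m`, scaled by `m`, is `|q + s|`. The integer `q` is neither 0 nor -1, as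
    -- `j` is not an end of the arc, so this is at least 1.
    set q : ℤ := (k : ℤ) - j - round t * m with hq
    have q0 : q ≠ 0 := by
      intro h
      apply h1
      have h3 : (j : ℤ) ≡ k [ZMOD m] := (Int.modEq_iff_dvd.2 ⟨round t, by linarith⟩)
      have h4 := (Int.natCast_modEq_iff.1 h3)
      rwa [Nat.ModEq, Nat.mod_eq_of_lt hj, Nat.mod_eq_of_lt hk] at h4
    have q1 : q ≠ -1 := by
      intro h
      apply h2
      have h3 : ((j : ℕ) : ℤ) ≡ ((k + 1 : ℕ) : ℤ) [ZMOD m] :=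
        (Int.modEq_iff_dvd.2 ⟨round t, by push_cast; linarith⟩)
      have h4 := (Int.natCast_modEq_iff.1 h3)
      rwa [Nat.ModEq, Nat.mod_eq_of_lt hj] at h4
    have : 1 ≤ |(q : ℝ) + s| := by
      rcases lt_or_gt_of_ne q0 with h | h
      · have : (q : ℝ) ≤ -2 := by exact_mod_cast (by omega : q ≤ -2)
        rw [abs_of_nonpos (by linarith)]
        linarith
      · have : (1 : ℝ) ≤ q := by exact_mod_cast (by omega : 1 ≤ q)
        rw [abs_of_nonneg (by linarith)]
        linarith
    linarith

lemma exists_param (c : VertexCycle V) (x : UnitAddCircle) : ∃ k < c.length, ∃ s : ℝ, 0 ≤ s ∧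
    s < 1 ∧ x = (((k + s) / c.length : ℝ) : UnitAddCircle) := by
  have hm0 : (0 : ℝ) < c.length := by exact_mod_cast c.length_pos
  obtain ⟨t, ⟨ht0, ht1⟩, rfl⟩ : ∃ t ∈ Set.Ico (0 : ℝ) (0 + 1), (t : UnitAddCircle) = x := by
    have := AddCircle.coe_image_Ico_eq (1 : ℝ) 0
    exact (Set.image_eq_iff_surjOn_mapsTo.1 this).1 (Set.mem_univ x)
  rw [zero_add] at ht1
  have h0 : 0 ≤ t * c.length := by positivity
  refine ⟨⌊t * c.length⌋₊, (Nat.floor_lt h0).2 (by nlinarith), t * c.length - ⌊t * c.length⌋₊,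
    sub_nonneg.2 (Nat.floor_le h0), by linarith [Nat.lt_floor_add_one (t * c.length)], ?_⟩
  congr 1
  field_simp
  ring

variable [DecidableEq V]

/-- The closed curve in the realization of the complete graph which runs along a cycle. -/
def point (c : VertexCycle V) (x : UnitAddCircle) (v : V) : ℝ :=
  ∑ k ∈ Finset.range c.length, if c.vertex k = v then tent c.length k x else 0

lemma continuous_point (c : VertexCycle V) : Continuous c.point := by
  refine continuous_pi fun v => continuous_finsetSum _ fun k _ => ?_
  unfold tent
  split_ifs
  · fun_prop
  · fun_prop

lemma point_apply (c : VertexCycle V) {k : ℕ} (hk : k < c.length) {s : ℝ} (hs0 : 0 ≤ s)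
    (hs1 : s ≤ 1) : c.point (((k + s) / c.length : ℝ) : UnitAddCircle) =
      AffineMap.lineMap (Pi.single (c.vertex k) (1 : ℝ) : V → ℝ)
        (Pi.single (c.vertex (k + 1)) (1 : ℝ) : V → ℝ) s := by
  ext v
  have e : ∀ j ∈ Finset.range c.length, (if c.vertex j = v then
      tent c.length j (((k + s) / c.length : ℝ) : UnitAddCircle) else 0) =
      (if j = k then (if c.vertex k = v then 1 - s else 0) else 0) +
      (if j = (k + 1) % c.length then (if c.vertex (k + 1) = v then s else 0) else 0) := by
    intro j hj
    have hj := Finset.mem_range.1 hj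
    have e1 : c.vertex ((k + 1) % c.length) = c.vertex (k + 1) := by
      rw [vertex_eq_iff, Nat.mod_mod]
    rw [tent_apply (m := c.length) c.three_le hk hj hs0 hs1]
    by_cases h1 : j = k <;> by_cases h2 : j = (k + 1) % c.length
    · have : k = (k + 1) % c.length := h1.symm.trans h2
      exact absurd (by rw [vertex_eq_iff, ← this, Nat.mod_eq_of_lt hk]) (c.vertex_ne_succ k)
    · subst h1
      simp [h2]
    · rw [if_neg h1, if_pos h2, if_neg h1, if_pos h2, h2, e1, zero_add, zero_add]
    · simp [h1, h2]
  rw [point, Finset.sum_congr rfl e, Finset.sum_add_distrib, Finset.sum_ite_eq',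
    Finset.sum_ite_eq', if_pos (Finset.mem_range.2 hk),
    if_pos (Finset.mem_range.2 (Nat.mod_lt _ c.length_pos))]
  simp only [AffineMap.lineMap_apply, vsub_eq_sub, vadd_eq_add, Pi.add_apply, Pi.smul_apply,
    Pi.sub_apply, Pi.single_apply, smul_eq_mul, eq_comm (a := v)]
  split_ifs <;> ring

lemma point_apply_coord (c : VertexCycle V) {k : ℕ} (hk : k < c.length) {s : ℝ} (hs0 : 0 ≤ s)
    (hs1 : s ≤ 1) (v : V) : c.point (((k + s) / c.length : ℝ) : UnitAddCircle) v =
      (if c.vertex k = v then 1 - s else 0) + (if c.vertex (k + 1) = v then s else 0) := by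
  rw [point_apply c hk hs0 hs1]
  simp only [AffineMap.lineMap_apply, vsub_eq_sub, vadd_eq_add, Pi.add_apply, Pi.smul_apply,
    Pi.sub_apply, Pi.single_apply, smul_eq_mul, eq_comm (a := v)]
  split_ifs <;> ring

/-- A common point of two different arcs, taken half-open, would make each of them start where the
other ends, so the length would divide 2. This is where cycles need at least three vertices. -/
lemma point_injective (c : VertexCycle V) : Function.Injective c.point := by
  intro x y h
  obtain ⟨k, hk, s, hs0, hs1, rfl⟩ := c.exists_param x
  obtain ⟨k', hk', s', hs0', hs1', rfl⟩ := c.exists_param y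
  have h1 := congrFun h (c.vertex k)
  have h2 := congrFun h (c.vertex k')
  rw [point_apply_coord c hk hs0 hs1.le, point_apply_coord c hk' hs0' hs1'.le] at h1 h2
  rw [if_pos rfl, if_neg (c.vertex_ne_succ k).symm, add_zero] at h1
  rw [if_pos rfl, if_neg (c.vertex_ne_succ k').symm, add_zero] at h2
  by_cases e : c.vertex k' = c.vertex k
  · have ek : k' = k := by
      rwa [vertex_eq_iff, Nat.mod_eq_of_lt hk, Nat.mod_eq_of_lt hk'] at e
    subst ek
    rw [if_pos rfl, if_neg (c.vertex_ne_succ k').symm, add_zero] at h1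
    rw [show s = s' by linarith]
  · rw [if_neg e, zero_add] at h1
    rw [if_neg (Ne.symm e), zero_add] at h2
    have e1 : c.vertex (k' + 1) = c.vertex k := by
      by_contra h3
      rw [if_neg h3] at h1
      linarith
    have e2 : c.vertex (k + 1) = c.vertex k' := by
      by_contra h3
      rw [if_neg h3] at h2
      linarith
    rw [vertex_eq_iff] at e1 e2
    have f1 : k' + 1 ≡ k [MOD c.length] := e1
    have f2 : k + 1 ≡ k' [MOD c.length] := e2
    have f3 : k + 2 ≡ k + 0 [MOD c.length] := (f2.add_right 1).trans f1
    have f4 := (Nat.modEq_iff_dvd' (by omega)).1 (Nat.ModEq.add_left_cancel' k f3).symm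
    have := Nat.le_of_dvd (by omega) f4
    have h3 : 3 ≤ c.length := c.three_le
    omega

lemma point_ne_point {c c' : VertexCycle V} (h : c.list.Disjoint c'.list) (x y : UnitAddCircle) :
    c.point x ≠ c'.point y := by
  intro e
  obtain ⟨k, hk, s, hs0, hs1, rfl⟩ := c.exists_param x
  obtain ⟨k', hk', s', hs0', hs1', rfl⟩ := c'.exists_param y
  have h1 := congrFun e (c.vertex k)
  have hne : ∀ i, c'.vertex i ≠ c.vertex k := fun i e =>
    h (c.vertex_mem k) (e ▸ c'.vertex_mem i)
  rw [point_apply_coord c hk hs0 hs1.le, point_apply_coord c' hk' hs0' hs1'.le, if_pos rfl,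
    if_neg (c.vertex_ne_succ k).symm, if_neg (hne _), if_neg (hne _)] at h1
  linarith

variable [Fintype V]

lemma point_mem (c : VertexCycle V) (x : UnitAddCircle) :
    c.point x ∈ realization (⊤ : SimpleGraph V) := by
  obtain ⟨k, hk, s, hs0, hs1, rfl⟩ := c.exists_param x
  refine Or.inr ⟨_, _, c.vertex_ne_succ k, ?_⟩
  rw [point_apply c hk hs0 hs1.le, segment_eq_image_lineMap]
  exact ⟨s, ⟨hs0, hs1.le⟩, rfl⟩

/-- The closed curve which runs along a cycle of an embedded complete graph. -/
def curve (f : C(realization (⊤ : SimpleGraph V), R3)) (c : VertexCycle V) : ClosedCurve where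
  toFun x := f ⟨c.point x, c.point_mem x⟩
  continuous_toFun := f.continuous.comp (c.continuous_point.subtype_mk _)

end VertexCycle

end

/-! ### Crossing numbers of the edges of an embedded complete graph -/

section

variable {V : Type} [DecidableEq V]

/-- The point of the edge from `a` to `b` at time `s`. -/
def edgePoint (a b : V) (s : ℝ) : V → ℝ :=
  AffineMap.lineMap (Pi.single a (1 : ℝ) : V → ℝ) (Pi.single b (1 : ℝ) : V → ℝ)
    (Set.projIcc (0 : ℝ) 1 zero_le_one s : ℝ)

lemma edgePoint_of_mem (a b : V) {s : ℝ} (hs : s ∈ Set.Icc (0 : ℝ) 1) : edgePoint a b s =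
    AffineMap.lineMap (Pi.single a (1 : ℝ) : V → ℝ) (Pi.single b (1 : ℝ) : V → ℝ) s := by
  rw [edgePoint, Set.projIcc_of_mem _ hs]

lemma edgePoint_coord (a b : V) {s : ℝ} (hs : s ∈ Set.Icc (0 : ℝ) 1) (v : V) :
    edgePoint a b s v = (if a = v then 1 - s else 0) + (if b = v then s else 0) := by
  rw [edgePoint_of_mem a b hs]
  simp only [AffineMap.lineMap_apply, vsub_eq_sub, vadd_eq_add, Pi.add_apply, Pi.smul_apply,
    Pi.sub_apply, Pi.single_apply, smul_eq_mul, eq_comm (a := v)]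
  split_ifs <;> ring

lemma edgePoint_zero (a b : V) : edgePoint a b 0 = Pi.single a (1 : ℝ) := by
  rw [edgePoint_of_mem a b (by simp), AffineMap.lineMap_apply_zero]

lemma edgePoint_one (a b : V) : edgePoint a b 1 = Pi.single b (1 : ℝ) := by
  rw [edgePoint_of_mem a b (by simp), AffineMap.lineMap_apply_one]

lemma edgePoint_symm (a b : V) {s : ℝ} (hs : s ∈ Set.Icc (0 : ℝ) 1) :
    edgePoint a b (1 - s) = edgePoint b a s := by
  have hs' : 1 - s ∈ Set.Icc (0 : ℝ) 1 := ⟨by linarith [hs.2], by linarith [hs.1]⟩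
  ext v
  rw [edgePoint_coord a b hs', edgePoint_coord b a hs]
  split_ifs <;> ring

lemma edgePoint_injOn {a b : V} (h : a ≠ b) : Set.InjOn (edgePoint a b) (Set.Icc 0 1) := by
  intro s hs t ht e
  have := congrFun e a
  rw [edgePoint_coord a b hs, edgePoint_coord a b ht, if_pos rfl, if_pos rfl, if_neg h.symm,
    if_neg h.symm] at this
  linarith

lemma edgePoint_ne {a b c d : V} (hac : a ≠ c) (had : a ≠ d) (hbc : b ≠ c) (hbd : b ≠ d)
    {s t : ℝ} (hs : s ∈ Set.Icc (0 : ℝ) 1) (ht : t ∈ Set.Icc (0 : ℝ) 1) :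
    edgePoint a b s ≠ edgePoint c d t := by
  intro e
  have h1 := congrFun e a
  have h2 := congrFun e b
  rw [edgePoint_coord a b hs, edgePoint_coord c d ht, if_pos rfl, if_neg hac.symm,
    if_neg had.symm] at h1
  rw [edgePoint_coord a b hs, edgePoint_coord c d ht, if_pos rfl, if_neg hbc.symm,
    if_neg hbd.symm] at h2
  have h3 := hs.1
  have h4 := hs.2
  split_ifs at h1 h2 <;> linarith

lemma continuous_edgePoint (a b : V) : Continuous (edgePoint a b) :=
  AffineMap.lineMap_continuous.comp (continuous_subtype_val.comp continuous_projIcc)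

variable [Fintype V]

lemma edgePoint_mem (a b : V) (s : ℝ) : edgePoint a b s ∈ realization (⊤ : SimpleGraph V) := by
  unfold edgePoint
  by_cases h : a = b
  · subst h
    exact Or.inl ⟨a, by simp⟩
  · refine Or.inr ⟨a, b, h, ?_⟩
    rw [segment_eq_image_lineMap]
    exact ⟨_, (Set.projIcc (0 : ℝ) 1 zero_le_one s).2, rfl⟩

variable (f : C(realization (⊤ : SimpleGraph V), R3))

/-- The image of an edge of an embedded complete graph. -/
def edgePath (a b : V) (s : ℝ) : R3 := f ⟨edgePoint a b s, edgePoint_mem a b s⟩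

lemma continuous_edgePath (a b : V) : Continuous (edgePath f a b) :=
  f.continuous.comp ((continuous_edgePoint a b).subtype_mk _)

/-- The vertices of the polygonal path with `N` edges inscribed in the image of an edge. -/
def edgeSample (N : ℕ) (a b : V) (i : ℕ) : R3 := edgePath f a b (i / N)

/-- The mod 2 number of times that an edge of an embedded complete graph passes over another one,
after replacing both by inscribed polygonal paths with `N` edges. -/
def edgeOver (u : R3) (N : ℕ) (a b c d : V) : ZMod 2 :=
  polyOver u (edgeSample f N a b) N (edgeSample f N c d) N

lemma div_mem_Icc {i N : ℕ} (h : i ≤ N) : (i / N : ℝ) ∈ Set.Icc (0 : ℝ) 1 :=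
  ⟨by positivity, div_le_one_of_le₀ (by exact_mod_cast h) (by positivity)⟩

lemma edgeSample_symm {N : ℕ} (hN : 0 < N) (a b : V) {i : ℕ} (hi : i ≤ N) :
    edgeSample f N a b (N - i) = edgeSample f N b a i := by
  have hN' : (N : ℝ) ≠ 0 := by positivity
  have : ((N - i : ℕ) / N : ℝ) = 1 - i / N := by
    rw [Nat.cast_sub hi, sub_div, div_self hN']
  simp only [edgeSample, edgePath, this, edgePoint_symm a b (div_mem_Icc hi)]

lemma edgeOver_symm_left (u : R3) {N : ℕ} (hN : 0 < N) (a b c d : V) :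
    edgeOver f u N a b c d = edgeOver f u N b a c d := by
  simp only [edgeOver, polyOver]
  rw [← Finset.sum_range_reflect]
  refine Finset.sum_congr rfl fun i hi => ?_
  have hi := Finset.mem_range.1 hi
  have e1 : edgeSample f N a b (N - 1 - i) = edgeSample f N b a (i + 1) := by
    rw [← edgeSample_symm f hN a b (by omega), Nat.sub_sub, add_comm 1 i]
  have e2 : edgeSample f N a b (N - 1 - i + 1) = edgeSample f N b a i := by
    rw [← edgeSample_symm f hN a b hi.le]
    congr 1
    omega
  rw [e1, e2]
  exact Finset.sum_congr rfl fun j _ => overCount_symm_left ..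

lemma edgeOver_swap (u : R3) (N : ℕ) (a b c d : V) :
    edgeOver f u N a b c d = edgeOver f (-u) N c d a b := polyOver_swap ..

lemma edgeOver_symm_right (u : R3) {N : ℕ} (hN : 0 < N) (a b c d : V) :
    edgeOver f u N a b c d = edgeOver f u N a b d c := by
  rw [edgeOver_swap, edgeOver_symm_left f _ hN, ← edgeOver_swap]

/-- Sampling at a multiple of the length hits every vertex of the cycle, so that the inscribed
polygon is a concatenation of edge paths and the count becomes a sum over pairs of edges. -/
lemma sample_curve (c : VertexCycle V) {N : ℕ} (hN : 0 < N) {k : ℕ} (hk : k < c.length) {j : ℕ}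
    (hj : j ≤ N) : sample (c.curve f) (c.length * N) (k * N + j) =
      edgeSample f N (c.vertex k) (c.vertex (k + 1)) j := by
  have hN' : (N : ℝ) ≠ 0 := by positivity
  have hm : (c.length : ℝ) ≠ 0 := by exact_mod_cast c.length_pos.ne'
  have e : ((k * N + j : ℕ) / (c.length * N : ℕ) : ℝ) = (k + j / N) / c.length := by
    push_cast
    field_simp
  have hs := div_mem_Icc hj
  have : c.point ((((k * N + j : ℕ) / (c.length * N : ℕ) : ℝ)) : UnitAddCircle) =
      edgePoint (c.vertex k) (c.vertex (k + 1)) (j / N) := by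
    rw [e, c.point_apply hk hs.1 hs.2, edgePoint_of_mem _ _ hs]
  simp only [sample, VertexCycle.curve, ContinuousMap.coe_mk, edgeSample, edgePath, this]

/-- The mod 2 number of times that a cycle passes over another one, where `φ` counts for pairs of
edges. -/
def cycleSum (φ : V → V → V → V → ZMod 2) (c c' : VertexCycle V) : ZMod 2 :=
  ∑ k ∈ Finset.range c.length, ∑ l ∈ Finset.range c'.length,
    φ (c.vertex k) (c.vertex (k + 1)) (c'.vertex l) (c'.vertex (l + 1))

lemma polyOver_sample_curve (u : R3) (c c' : VertexCycle V) {N : ℕ} (hN : 0 < N) :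
    polyOver u (sample (c.curve f) (c.length * N)) (c.length * N)
      (sample (c'.curve f) (c'.length * N)) (c'.length * N) = cycleSum (edgeOver f u N) c c' := by
  simp only [polyOver, pathOver, cycleSum, edgeOver]
  rw [sum_range_mul]
  refine Finset.sum_congr rfl fun k hk => ?_
  have hk := Finset.mem_range.1 hk
  conv_rhs => rw [Finset.sum_comm]
  refine Finset.sum_congr rfl fun j hj => ?_
  have hj := Finset.mem_range.1 hj
  rw [sum_range_mul]
  refine Finset.sum_congr rfl fun k' hk' => ?_
  have hk' := Finset.mem_range.1 hk'
  refine Finset.sum_congr rfl fun j' hj' => ?_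
  have hj' := Finset.mem_range.1 hj'
  rw [add_assoc, add_assoc, sample_curve f c hN hk hj.le, sample_curve f c hN hk hj,
    sample_curve f c' hN hk' hj'.le, sample_curve f c' hN hk' hj']

/-- Fine polygonal paths inscribed in disjoint arcs are disjoint. -/
lemma eventually_disjoint_segments {φ ψ : ℝ → R3} (hφ : Continuous φ) (hψ : Continuous ψ)
    (h : ∀ s ∈ Set.Icc (0 : ℝ) 1, ∀ t ∈ Set.Icc (0 : ℝ) 1, φ s ≠ ψ t) :
    ∀ᶠ N : ℕ in atTop, ∀ i < N, ∀ j < N,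
      Disjoint (segment ℝ (φ (i / N)) (φ ((i + 1 : ℕ) / N)))
        (segment ℝ (ψ (j / N)) (ψ ((j + 1 : ℕ) / N))) := by
  obtain ⟨r, hr, hd⟩ : ∃ r > 0, ∀ s ∈ Set.Icc (0 : ℝ) 1, ∀ t ∈ Set.Icc (0 : ℝ) 1,
      r ≤ dist (φ s) (ψ t) := by
    have hc : Continuous fun z : ℝ × ℝ => dist (φ z.1) (ψ z.2) := by fun_prop
    obtain ⟨z, hz, hmin⟩ := (isCompact_Icc.prod isCompact_Icc).exists_isMinOn
      (⟨(0, 0), by simp⟩ : (Set.Icc (0 : ℝ) 1 ×ˢ Set.Icc (0 : ℝ) 1).Nonempty) hc.continuousOn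
    exact ⟨dist (φ z.1) (ψ z.2), dist_pos.2 (h _ hz.1 _ hz.2),
      fun s hs t ht => isMinOn_iff.1 hmin (s, t) ⟨hs, ht⟩⟩
  have unif : ∀ {φ : ℝ → R3}, Continuous φ → ∀ᶠ N : ℕ in atTop, ∀ i < N,
      segment ℝ (φ (i / N)) (φ ((i + 1 : ℕ) / N)) ⊆ Metric.ball (φ (i / N)) (r / 2) := by
    intro φ hφ
    obtain ⟨δ, hδ, hu⟩ := Metric.uniformContinuousOn_iff.1
      (isCompact_Icc.uniformContinuousOn_of_continuous (hφ.continuousOn (s := Set.Icc 0 1)))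
      (r / 2) (half_pos hr)
    have h1 : ∀ᶠ N : ℕ in atTop, 1 / δ < N :=
      (tendsto_natCast_atTop_atTop (R := ℝ)).eventually_gt_atTop _
    filter_upwards [h1] with N hN i hi
    have hN0 : (0 : ℝ) < N := (by positivity : 0 < 1 / δ).trans hN
    refine (convex_ball _ _).segment_subset (by simpa using half_pos hr) ?_
    refine hu _ (div_mem_Icc hi) _ (div_mem_Icc hi.le) ?_
    rw [Real.dist_eq, ← sub_div]
    push_cast
    rw [add_sub_cancel_left, abs_of_pos (by positivity), one_div_lt hN0 hδ]
    exact hN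
  filter_upwards [unif hφ, unif hψ] with N h1 h2 i hi j hj
  refine Set.disjoint_left.2 fun z hz hz' => ?_
  have e1 := h1 i hi hz
  have e2 := h2 j hj hz'
  rw [Metric.mem_ball] at e1 e2
  have := hd _ (div_mem_Icc hi.le) _ (div_mem_Icc hj.le)
  linarith [dist_triangle_left (φ (i / N)) (ψ (j / N)) z]

/-- The crossing numbers of the edges of an embedded complete graph. -/
structure CrossingNumbers (φ : V → V → V → V → ZMod 2) : Prop where
  symm_left : ∀ a b c d, φ a b c d = φ b a c d
  symm_right : ∀ a b c d, φ a b c d = φ a b d c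
  linked : ∀ c c' : VertexCycle V, c.list.Disjoint c'.list → cycleSum φ c c' = 1 →
    HasMod2LinkingNumber (c.curve f) (c'.curve f) 1
  vanKampen : ∀ v : Fin 5 → V, Function.Injective v →
    ∀ y : Fin 5 → Fin 5 → Fin 5 → Fin 5 → ZMod 2,
      (∀ a b c d, a < b → c < d → a < c → b ≠ c → b ≠ d →
      y a b c d = φ (v a) (v b) (v c) (v d) + φ (v c) (v d) (v a) (v b)) →
      y 0 1 2 3 + y 0 1 2 4 + y 0 1 3 4 + y 0 2 1 3 + y 0 2 1 4 + y 0 2 3 4 + y 0 3 1 2 +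
      y 0 3 1 4 + y 0 3 2 4 + y 0 4 1 2 + y 0 4 1 3 + y 0 4 2 3 + y 1 2 3 4 + y 1 3 2 4 +
      y 1 4 2 3 = 1

/-- There are finitely many cycles and five-tuples of vertices, so a single large `N` works for all
of them, and then a single generic direction `u` near the vertical; the table is `edgeOver f u N`.
It counts only the first edge passing over the second, which is why the van Kampen sum contains both
orders. -/
theorem exists_crossingNumbers (hf : Function.Injective f) : ∃ φ, CrossingNumbers f φ := by
  have h1 : ∀ c c' : VertexCycle V, ∀ᶠ N : ℕ in atTop, ∀ᶠ u in generic,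
      c.list.Disjoint c'.list → cycleSum (edgeOver f u N) c c' = 1 →
      HasMod2LinkingNumber (c.curve f) (c'.curve f) 1 := by
    intro c c'
    by_cases hd : c.list.Disjoint c'.list
    · have hr : Disjoint (Set.range (c.curve f)) (Set.range (c'.curve f)) := by
        rw [Set.disjoint_left]
        rintro _ ⟨x, rfl⟩ ⟨y, e⟩
        exact VertexCycle.point_ne_point hd x y (congrArg Subtype.val (hf e)).symm
      obtain ⟨w, hw, ε, hε, h⟩ := exists_hasMod2LinkingNumber hr
      obtain ⟨K, hK⟩ := exists_samplePolygon_approximates (c.curve f) hε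
      obtain ⟨K', hK'⟩ := exists_samplePolygon_approximates (c'.curve f) hε
      filter_upwards [eventually_ge_atTop K, eventually_ge_atTop K', eventually_gt_atTop 0]
        with N hN hN' hN0
      have := h _ _ (hK (c.length * N) (Nat.mul_pos c.length_pos hN0)
        (by nlinarith [c.length_pos])) (hK' (c'.length * N) (Nat.mul_pos c'.length_pos hN0)
        (by nlinarith [c'.length_pos]))
      filter_upwards [this] with u hu _ e
      simp only [samplePolygon] at hu
      rw [polyOver_sample_curve f u c c' hN0, e] at hu
      rwa [hu]
    · exact Eventually.of_forall fun N => Eventually.of_forall fun u h => absurd h hd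
  have h2 : ∀ a b c d : V, ∀ᶠ N : ℕ in atTop, a ≠ c → a ≠ d → b ≠ c → b ≠ d →
      ∀ i < N, ∀ j < N, Disjoint (segment ℝ (edgeSample f N a b i) (edgeSample f N a b (i + 1)))
        (segment ℝ (edgeSample f N c d j) (edgeSample f N c d (j + 1))) := by
    intro a b c d
    by_cases h : a ≠ c ∧ a ≠ d ∧ b ≠ c ∧ b ≠ d
    · filter_upwards [eventually_disjoint_segments (continuous_edgePath f a b)
        (continuous_edgePath f c d) (fun s hs t ht e => edgePoint_ne h.1 h.2.1 h.2.2.1 h.2.2.2 hs ht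
          (congrArg Subtype.val (hf e)))] with N hN _ _ _ _
      exact hN
    · exact Eventually.of_forall fun N h1 h2 h3 h4 => absurd ⟨h1, h2, h3, h4⟩ h
  obtain ⟨N, hN1, hN2, hN0⟩ := ((eventually_all.2 fun c => eventually_all.2 (h1 c)).and
    ((eventually_all.2 fun a => eventually_all.2 fun b => eventually_all.2 fun c =>
      eventually_all.2 (h2 a b c)).and (eventually_gt_atTop 0))).exists
  have hNR : (N : ℝ) ≠ 0 := by positivity
  have h3 : ∀ v : Fin 5 → V, ∀ᶠ u in generic, Function.Injective v →
      ∀ y : Fin 5 → Fin 5 → Fin 5 → Fin 5 → ZMod 2,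
      (∀ a b c d, a < b → c < d → a < c → b ≠ c → b ≠ d →
      y a b c d = edgeOver f u N (v a) (v b) (v c) (v d) +
        edgeOver f u N (v c) (v d) (v a) (v b)) →
      y 0 1 2 3 + y 0 1 2 4 + y 0 1 3 4 + y 0 2 1 3 + y 0 2 1 4 + y 0 2 3 4 + y 0 3 1 2 +
      y 0 3 1 4 + y 0 3 2 4 + y 0 4 1 2 + y 0 4 1 3 + y 0 4 2 3 + y 1 2 3 4 + y 1 3 2 4 +
      y 1 4 2 3 = 1 := by
    intro v
    by_cases hv : Function.Injective v
    · have := ae_vanKampen (X := fun a => f ⟨Pi.single (v a) 1, Or.inl ⟨_, rfl⟩⟩)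
        (p := fun a b => edgeSample f N (v a) (v b)) hN0 ?_ ?_ ?_ ?_ ?_
      · filter_upwards [eventually_generic_of_ae this] with u hu _ using hu
      · intro a b e
        have e1 := congrFun (congrArg Subtype.val (hf e)) (v a)
        by_contra hab
        simp [hv.eq_iff, hab] at e1
      · intro a b
        simp only [edgeSample, edgePath, Nat.cast_zero, zero_div, edgePoint_zero]
      · intro a b
        simp only [edgeSample, edgePath, div_self hNR, edgePoint_one]
      · intro a b hab i hi e
        have e1 := edgePoint_injOn (hv.ne hab) (div_mem_Icc hi.le) (div_mem_Icc hi)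
          (congrArg Subtype.val (hf e))
        rw [div_left_inj' hNR] at e1
        have : i = i + 1 := by exact_mod_cast e1
        omega
      · intro a b c d _ _ hac had hbc hbd
        exact hN2 _ _ _ _ (hv.ne hac) (hv.ne had) (hv.ne hbc) (hv.ne hbd)
    · exact Eventually.of_forall fun u h => absurd h hv
  obtain ⟨u, hu1, hu2⟩ := ((eventually_all.2 fun c => eventually_all.2 (hN1 c)).and
    (eventually_all.2 h3)).exists
  exact ⟨edgeOver f u N, edgeOver_symm_left f u hN0, edgeOver_symm_right f u hN0, hu1, hu2⟩

end

/-! ### Linked triangles among six vertices -/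

/-- The sum of `ψ` over the edges of a triangle. -/
def triSum {V : Type} (ψ : V → V → ZMod 2) (x : Fin 3 → V) : ZMod 2 :=
  ψ (x 0) (x 1) + ψ (x 1) (x 2) + ψ (x 2) (x 0)

lemma zmod_two_eq_zero : ∀ z : ZMod 2, z ≠ 1 → z = 0 := by decide

/-- The combinatorial core of the theorem that the complete graph on six vertices is intrinsically
linked. -/
lemma exists_linked_triangles_aux {K : Fin 6 → Fin 6 → Fin 6 → Fin 6 → ZMod 2}
    (hl : ∀ a b c d, K a b c d = K b a c d) (hr : ∀ a b c d, K a b c d = K a b d c)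
    {y : Fin 6 → Fin 6 → Fin 6 → Fin 6 → ZMod 2}
    (hy : ∀ a b c d, y a b c d = K a b c d + K c d a b)
    (h : y 1 2 3 4 + y 1 2 3 5 + y 1 2 4 5 + y 1 3 2 4 + y 1 3 2 5 + y 1 3 4 5 + y 1 4 2 3 +
      y 1 4 2 5 + y 1 4 3 5 + y 1 5 2 3 + y 1 5 2 4 + y 1 5 3 4 + y 2 3 4 5 + y 2 4 3 5 +
      y 2 5 3 4 = 1) :
    ∃ σ : Fin 6 → Fin 6, Function.Injective σ ∧
      triSum (fun a b => triSum (K a b) ![σ 3, σ 4, σ 5]) ![σ 0, σ 1, σ 2] = 1 := by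
  by_contra! hcon
  have key : ∀ a b c d e : Fin 6, Function.Injective ![0, a, b, c, d, e] →
      triSum (fun p q => triSum (K p q) ![c, d, e]) ![0, a, b] = 0 := fun a b c d e hσ =>
    zmod_two_eq_zero _ (hcon ![0, a, b, c, d, e] hσ)
  have hl' : ∀ a b c d, a < b → K b a c d = K a b c d := fun a b c d _ => hl b a c d
  have hr' : ∀ a b c d, c < d → K a b d c = K a b c d := fun a b c d _ => hr a b d c
  -- These are the ten splittings into two triangles, the first one containing 0. In their sum, an
  -- edge at 0 paired with an edge disjoint from it occurs twice, and every ordered pair of disjoint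
  -- edges among 1, …, 5 occurs once, which leaves the van Kampen sum.
  have h1 := key 1 2 3 4 5 (by decide)
  have h2 := key 1 3 2 4 5 (by decide)
  have h3 := key 1 4 2 3 5 (by decide)
  have h4 := key 1 5 2 3 4 (by decide)
  have h5 := key 2 3 1 4 5 (by decide)
  have h6 := key 2 4 1 3 5 (by decide)
  have h7 := key 2 5 1 3 4 (by decide)
  have h8 := key 3 4 1 2 5 (by decide)
  have h9 := key 3 5 1 2 4 (by decide)
  have h10 := key 4 5 1 2 3 (by decide)
  simp only [triSum, Matrix.cons_val_zero, Matrix.cons_val_one, Matrix.cons_val]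
    at h1 h2 h3 h4 h5 h6 h7 h8 h9 h10
  simp (discharger := decide) only [hl', hr'] at h1 h2 h3 h4 h5 h6 h7 h8 h9 h10
  simp only [hy] at h
  apply zero_ne_one (α := ZMod 2)
  rw [← h]
  have T := congrArg₂ (· + ·)
    (congrArg₂ (· + ·) (congrArg₂ (· + ·) h1 h2) (congrArg₂ (· + ·) h3 h4))
    (congrArg₂ (· + ·) (congrArg₂ (· + ·) (congrArg₂ (· + ·) h5 h6) (congrArg₂ (· + ·) h7 h8))
      (congrArg₂ (· + ·) h9 h10))
  simp only [add_zero] at T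
  rw [← T, ← sub_eq_zero]
  ring_nf
  reduce_mod_char

/-- If the vectors span a space of dimension less than `k`, it has at most `2 ^ k` elements. By the
pigeonhole principle `k` of the vectors coincide, and any coordinate where the common vector is 1
will do. -/
lemma exists_linearIndepOn_or_common {ι H : Type} [Finite H]
    {b : ι → H → ZMod 2} {η : ι → H} (hη : ∀ s, b s (η s) = 1) {k : ℕ} {T : Finset ι}
    (hT : k * 2 ^ k ≤ T.card) : ∃ T' ⊆ T, T'.card = k ∧
      (LinearIndepOn (ZMod 2) b (T' : Set ι) ∨ ∃ h, ∀ s ∈ T', b s h = 1) := by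
  classical
  have := Fintype.ofFinite H
  rcases k.eq_zero_or_pos with rfl | hk
  · exact ⟨∅, by simp, rfl, Or.inl (by simp)⟩
  let W := Submodule.span (ZMod 2) (b '' T)
  by_cases hW : k ≤ Module.finrank (ZMod 2) W
  · obtain ⟨κ, a, ha, hspan, hli⟩ := exists_linearIndependent' (ZMod 2) (fun s : T => b s)
    have hfin : Finite κ := Finite.of_injective a ha
    have := Fintype.ofFinite κ
    have hcard : k ≤ Fintype.card κ := by
      have h1 := finrank_span_eq_card hli
      rw [← h1, hspan]
      have : Set.range (fun s : T => b s) = b '' T := by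
        ext x
        simp
      rwa [this]
    obtain ⟨U, hU⟩ := Finset.exists_subset_card_eq (s := (Finset.univ : Finset κ)) hcard
    have hinj : Function.Injective fun j : κ => ((a j : T) : ι) :=
      Subtype.val_injective.comp ha
    refine ⟨U.image fun j => ((a j : T) : ι), ?_, ?_, Or.inl ?_⟩
    · intro x hx
      obtain ⟨j, -, rfl⟩ := Finset.mem_image.1 hx
      exact (a j).2
    · rw [Finset.card_image_of_injective _ hinj, hU.2]
    · have hrange : LinearIndepOn (ZMod 2) b (Set.range fun j : κ => ((a j : T) : ι)) :=
        (linearIndepOn_range_iff hinj b).2 hli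
      refine hrange.mono ?_
      intro x hx
      obtain ⟨j, -, rfl⟩ := Finset.mem_image.1 hx
      exact ⟨j, rfl⟩
  · have hcardW : Nat.card W ≤ 2 ^ k := by
      rw [Module.natCard_eq_pow_finrank (K := ZMod 2), Nat.card_zmod]
      exact Nat.pow_le_pow_right (by norm_num) (by omega)
    have hsub : ((T.image b : Finset (H → ZMod 2)) : Set (H → ZMod 2)) ⊆ W := by
      rw [Finset.coe_image]
      exact Submodule.subset_span
    have himage : (T.image b).card ≤ 2 ^ k := by
      rw [← Set.ncard_coe_finset]
      exact (Set.ncard_le_ncard hsub (Set.toFinite _)).trans hcardW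
    have hne : (T.image b).Nonempty := by
      rw [Finset.image_nonempty, ← Finset.card_pos]
      exact (Nat.mul_pos hk (by positivity)).trans_le hT
    obtain ⟨w, hw, hfib⟩ := Finset.exists_le_card_fiber_of_mul_le_card_of_maps_to
      (s := T) (t := T.image b) (f := b) (n := k)
      (fun s hs => Finset.mem_image_of_mem b hs) hne (by nlinarith)
    obtain ⟨T', hT', hcard⟩ := Finset.exists_subset_card_eq hfib
    obtain ⟨s, hs⟩ : T'.Nonempty := by rw [← Finset.card_pos]; omega
    refine ⟨T', hT'.trans (Finset.filter_subset _ _), hcard, Or.inr ⟨η s, fun t ht => ?_⟩⟩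
    rw [(Finset.mem_filter.1 (hT' ht)).2, ← (Finset.mem_filter.1 (hT' hs)).2, hη]

lemma exists_coeff_of_linearIndepOn {ι H : Type} [Fintype H] {b : ι → H → ZMod 2} {T : Set ι}
    (h : LinearIndepOn (ZMod 2) b T) (t : ι → ZMod 2) :
    ∃ ε : H → ZMod 2, ∀ s ∈ T, ∑ i, ε i * b s i = t s := by
  classical
  have hli : LinearIndependent (ZMod 2) fun s : T => b s := h
  obtain ⟨g, hg⟩ := LinearMap.exists_extend
    ((Finsupp.linearCombination (ZMod 2) fun s : T => (t s : ZMod 2)) ∘ₗ hli.repr)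
  refine ⟨fun i => g fun j => if i = j then 1 else 0, fun s hs => ?_⟩
  have h1 : g (b s) = t s := by
    have hmem : b s ∈ Submodule.span (ZMod 2) (Set.range fun s : T => b s) :=
      Submodule.subset_span ⟨⟨s, hs⟩, rfl⟩
    have h2 := LinearMap.congr_fun hg ⟨b s, hmem⟩
    have h3 := hli.repr_eq_single ⟨s, hs⟩ ⟨b s, hmem⟩ rfl
    rw [LinearMap.comp_apply, LinearMap.comp_apply, h3] at h2
    simpa using h2
  rw [← h1, LinearMap.pi_apply_eq_sum_univ g]
  exact Finset.sum_congr rfl fun i _ => by rw [smul_eq_mul, mul_comm]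

/-- The number of vectors needed to find `k` good ones for each of `m` families. -/
def familySize (k : ℕ) : ℕ → ℕ
  | 0 => k
  | m + 1 => familySize k m * 2 ^ familySize k m

/-- Both alternatives pass to subsets, so the families can be treated one after the other, shrinking
the index set each time. -/
lemma exists_forall_linearIndepOn_or_common {κ ι H : Type} [Finite H]
    {b : κ → ι → H → ZMod 2} {η : ι → H} (hη : ∀ i s, b i s (η s) = 1) {k : ℕ} (I : Finset κ) :
    ∀ T : Finset ι, familySize k I.card ≤ T.card → ∃ T' ⊆ T, T'.card = k ∧ ∀ i ∈ I,
      (LinearIndepOn (ZMod 2) (b i) (T' : Set ι) ∨ ∃ h, ∀ s ∈ T', b i s h = 1) := by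
  classical
  induction I using Finset.induction_on with
  | empty =>
    intro T hT
    obtain ⟨T', h1, h2⟩ := Finset.exists_subset_card_eq hT
    exact ⟨T', h1, h2, by simp⟩
  | insert i I hi ih =>
    intro T hT
    rw [Finset.card_insert_of_notMem hi] at hT
    obtain ⟨T₁, hsub, hcard, hgood⟩ := exists_linearIndepOn_or_common (hη i) hT
    obtain ⟨T', hsub', hcard', hgood'⟩ := ih T₁ hcard.ge
    refine ⟨T', hsub'.trans hsub, hcard', fun j hj => ?_⟩
    rcases Finset.mem_insert.1 hj with rfl | hj
    · exact hgood.imp (fun h => h.mono hsub') fun ⟨h, hh⟩ => ⟨h, fun s hs => hh s (hsub' hs)⟩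
    · exact hgood' j hj

/-! ### Rings of triangles with prescribed sums -/

section

variable {V : Type}

/-- The sum of `ψ` over the edges of a walk. -/
def walkSum (ψ : V → V → ZMod 2) : List V → ZMod 2
  | a :: b :: l => ψ a b + walkSum ψ (b :: l)
  | _ => 0

lemma walkSum_append (ψ : V → V → ZMod 2) (l : List V) (a : V) (l' : List V) :
    walkSum ψ (l ++ a :: l') = walkSum ψ (l ++ [a]) + walkSum ψ (a :: l') := by
  induction l with
  | nil => simp [walkSum]
  | cons b l ih =>
    cases l with
    | nil => simp [walkSum]
    | cons c l =>
      simp only [List.cons_append, walkSum] at ih ⊢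
      rw [ih, add_assoc]

lemma walkSum_map_range (ψ : V → V → ZMod 2) (g : ℕ → V) (m : ℕ) :
    walkSum ψ ((List.range (m + 1)).map g) = ∑ k ∈ Finset.range m, ψ (g k) (g (k + 1)) := by
  induction m with
  | zero => simp [walkSum]
  | succ m ih =>
    rw [List.range_succ, List.map_append, List.range_succ, List.map_append, List.append_assoc,
      Finset.sum_range_succ, ← ih, List.range_succ, List.map_append]
    simp only [List.map_cons, List.map_nil, List.cons_append, List.nil_append]
    rw [walkSum_append ψ _ (g m) [g (m + 1)]]
    simp [walkSum]

namespace VertexCycle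

/-- The sum of `ψ` over the edges of a cycle. -/
def sum (ψ : V → V → ZMod 2) (c : VertexCycle V) : ZMod 2 :=
  ∑ k ∈ Finset.range c.length, ψ (c.vertex k) (c.vertex (k + 1))

lemma sum_eq_walkSum (ψ : V → V → ZMod 2) (c : VertexCycle V) {a : V} {l : List V}
    (h : c.list = a :: l) : c.sum ψ = walkSum ψ (a :: l ++ [a]) := by
  rw [sum, ← walkSum_map_range, ← h]
  congr 1
  refine List.ext_getElem (by simp [length]) fun i h1 h2 => ?_
  simp only [List.length_map, List.length_range] at h1
  rw [List.getElem_map, List.getElem_range]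
  rcases Nat.lt_succ_iff_lt_or_eq.1 h1 with hi | rfl
  · rw [List.getElem_append_left hi]
    unfold vertex
    congr 1
    exact Nat.mod_eq_of_lt hi
  · rw [List.getElem_append_right (show c.list.length ≤ c.length from le_rfl)]
    simp [vertex, h]

/-- The cycle of length three through three given points. -/
def triangle (x : Fin 3 → V) (hx : Function.Injective x) : VertexCycle V where
  list := List.ofFn x
  nodup := List.nodup_ofFn.2 hx
  three_le := by simp

lemma triangle_sum (ψ : V → V → ZMod 2) (x : Fin 3 → V) (hx : Function.Injective x) :
    (triangle x hx).sum ψ = triSum ψ x := by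
  rw [sum_eq_walkSum ψ _ (a := x 0) (l := [x 1, x 2]) (by simp [triangle, List.ofFn_succ])]
  simp [walkSum, triSum, add_assoc]

end VertexCycle

/-- A side of the triangle `x`, or the other two sides when `e = 1`. -/
def detour (x : Fin 3 → V) (e : ZMod 2) : List V :=
  if e = 1 then [x 0, x 2, x 1] else [x 0, x 1]

/-- Mod 2, the two ways from `x 0` to `x 1` along the triangle differ by the sum over all its sides.
Both have the same ends, so the choices at different triangles are independent. -/
lemma walkSum_flatMap_detour {ψ : V → V → ZMod 2} (hψ : ∀ a b, ψ a b = ψ b a) {H : Type}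
    (x : H → Fin 3 → V) (ε : H → ZMod 2) (q : V) (l : List H) : ∀ p,
    walkSum ψ (p :: l.flatMap (fun h => detour (x h) (ε h)) ++ [q]) =
      walkSum ψ (p :: l.flatMap (fun h => detour (x h) 0) ++ [q]) +
        (l.map fun h => ε h * triSum ψ (x h)).sum := by
  induction l with
  | nil => intro p; simp
  | cons h l ih =>
    intro p
    simp only [List.flatMap_cons, List.map_cons, List.sum_cons]
    have h0 : detour (x h) 0 = [x h 0, x h 1] := by simp [detour]
    by_cases hε : ε h = 1
    · have h1 : detour (x h) (ε h) = [x h 0, x h 2, x h 1] := by simp [detour, hε]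
      have ih := ih (x h 1)
      rw [h0, h1, hε]
      simp only [List.cons_append, List.nil_append, walkSum, triSum] at ih ⊢
      rw [ih, hψ (x h 2) (x h 0), hψ (x h 2) (x h 1)]
      rw [← sub_eq_zero]
      ring_nf
      reduce_mod_char
    · have h1 : detour (x h) (ε h) = [x h 0, x h 1] := by simp [detour, hε]
      have ih := ih (x h 1)
      rw [h0, h1, zmod_two_eq_zero _ hε]
      simp only [List.cons_append, List.nil_append, walkSum] at ih ⊢
      rw [ih]
      ring

lemma detour_subset (x : Fin 3 → V) (e : ZMod 2) : ∀ v ∈ detour x e, ∃ i, v = x i := by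
  intro v hv
  unfold detour at hv
  split_ifs at hv
  · simp only [List.mem_cons, List.not_mem_nil, or_false] at hv
    rcases hv with h | h | h <;> exact ⟨_, h⟩
  · simp only [List.mem_cons, List.not_mem_nil, or_false] at hv
    rcases hv with h | h <;> exact ⟨_, h⟩

lemma detour_nodup {x : Fin 3 → V} (hx : Function.Injective x) (e : ZMod 2) :
    (detour x e).Nodup := by
  unfold detour
  split_ifs <;> simp [hx.eq_iff]

lemma two_le_length_detour (x : Fin 3 → V) (e : ZMod 2) : 2 ≤ (detour x e).length := by
  unfold detour
  split_ifs <;> simp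

/-- The cycles running around a ring of triangles, along one or two sides of each. -/
def ring {H : Type} [Fintype H] [Nontrivial H] (x : H → Fin 3 → V)
    (hx : Function.Injective (Function.uncurry x)) (ε : H → ZMod 2) : VertexCycle V where
  list := (Finset.univ : Finset H).toList.flatMap fun h => detour (x h) (ε h)
  nodup := by
    rw [List.nodup_flatMap]
    refine ⟨fun h _ => detour_nodup (fun i j e => ?_) _, ?_⟩
    · simpa using @hx (h, i) (h, j) e
    · refine (Finset.nodup_toList _).imp fun {h h'} hne v hv hv' => hne ?_
      obtain ⟨i, hi⟩ := detour_subset _ _ v hv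
      obtain ⟨j, hj⟩ := detour_subset _ _ v hv'
      exact congrArg Prod.fst (@hx (h, i) (h', j) (hi.symm.trans hj))
  three_le := by
    have h2 : 2 ≤ (Finset.univ : Finset H).toList.length := by
      rw [Finset.length_toList, Finset.card_univ]
      exact Fintype.one_lt_card
    match hl : (Finset.univ : Finset H).toList with
    | [] => simp [hl] at h2
    | [_] => simp [hl] at h2
    | a :: b :: l =>
      have ha := two_le_length_detour (x a) (ε a)
      have hb := two_le_length_detour (x b) (ε b)
      simp only [List.flatMap_cons, List.length_append]
      omega

lemma ring_subset {H : Type} [Fintype H] [Nontrivial H] {x : H → Fin 3 → V}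
    (hx : Function.Injective (Function.uncurry x)) (ε : H → ZMod 2) :
    ∀ v ∈ (ring x hx ε).list, ∃ h i, v = x h i := by
  intro v hv
  obtain ⟨h, -, hv⟩ := List.mem_flatMap.1 hv
  exact ⟨h, detour_subset _ _ v hv⟩

lemma ring_sum {H : Type} [Fintype H] [Nontrivial H] {x : H → Fin 3 → V}
    (hx : Function.Injective (Function.uncurry x)) {ψ : V → V → ZMod 2}
    (hψ : ∀ a b, ψ a b = ψ b a) (ε : H → ZMod 2) :
    (ring x hx ε).sum ψ = (ring x hx 0).sum ψ + ∑ h, ε h * triSum ψ (x h) := by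
  obtain ⟨a, l, hl⟩ : ∃ a l, (Finset.univ : Finset H).toList = a :: l := by
    refine List.exists_cons_of_ne_nil ?_
    simpa using Finset.univ_nonempty.ne_empty
  have hhead : ∀ ε, ∃ l', (ring x hx ε).list = x a 0 :: l' := by
    intro ε
    unfold ring detour
    simp only [hl, List.flatMap_cons]
    split_ifs
    · exact ⟨_, rfl⟩
    · exact ⟨_, rfl⟩
  -- The walk lemma needs a vertex before the first triangle. Repeating the starting vertex of the
  -- cycle provides one, at the price of a loop term that cancels.
  have hsum : ∀ ε, ψ (x a 0) (x a 0) + (ring x hx ε).sum ψ =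
      walkSum ψ (x a 0 :: (ring x hx ε).list ++ [x a 0]) := by
    intro ε
    obtain ⟨l', hl'⟩ := hhead ε
    rw [VertexCycle.sum_eq_walkSum ψ _ hl', hl']
    rfl
  apply add_left_cancel (a := ψ (x a 0) (x a 0))
  rw [← add_assoc, hsum, hsum]
  refine (walkSum_flatMap_detour hψ x ε _ _ _).trans ?_
  rw [Finset.sum_map_toList]
  rfl

/-- The sum over a suitable cycle is `1` for all the functions in a family, if the sums over the
triangles of a ring are linearly independent or one of them is `1` for all functions. -/
lemma exists_vertexCycle_sum_eq_one {H : Type} [Fintype H] [Nontrivial H] {x : H → Fin 3 → V}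
    (hx : Function.Injective (Function.uncurry x)) {ι : Type} {ψ : ι → V → V → ZMod 2}
    (hψ : ∀ s a b, ψ s a b = ψ s b a) {T : Finset ι}
    (h : LinearIndepOn (ZMod 2) (fun s h => triSum (ψ s) (x h)) (T : Set ι) ∨
      ∃ h, ∀ s ∈ T, triSum (ψ s) (x h) = 1) :
    ∃ c : VertexCycle V, (∀ v ∈ c.list, ∃ h i, v = x h i) ∧ ∀ s ∈ T, c.sum (ψ s) = 1 := by
  rcases h with h | ⟨h, hh⟩
  -- The target is the correction which the ring without detours needs to have all sums equal to 1.
  · obtain ⟨ε, hε⟩ := exists_coeff_of_linearIndepOn h fun s => 1 - (ring x hx 0).sum (ψ s)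
    refine ⟨ring x hx ε, ring_subset hx ε, fun s hs => ?_⟩
    rw [ring_sum hx (hψ s), hε s hs, add_sub_cancel]
  · have hinj : Function.Injective (x h) := fun i j e => by simpa using @hx (h, i) (h, j) e
    refine ⟨.triangle (x h) hinj, fun v hv => ?_, fun s hs => ?_⟩
    · obtain ⟨i, rfl⟩ := List.mem_ofFn.1 hv
      exact ⟨h, i, rfl⟩
    · rw [VertexCycle.triangle_sum, hh s hs]

end

/-! ### Two mutually linked families of cycles -/

section

variable {V : Type}

lemma cycleSum_eq_sum (φ : V → V → V → V → ZMod 2) (c c' : VertexCycle V) :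
    cycleSum φ c c' = c'.sum fun x y => c.sum fun a b => φ a b x y :=
  Finset.sum_comm

lemma triSum_sum (ψ : V → V → V → V → ZMod 2) (c : VertexCycle V) (x : Fin 3 → V) :
    triSum (fun p q => c.sum fun a b => ψ a b p q) x = c.sum fun a b => triSum (ψ a b) x := by
  simp only [triSum, VertexCycle.sum, Finset.sum_add_distrib]

variable [Fintype V] [DecidableEq V] {f : C(realization (⊤ : SimpleGraph V), R3)}
  {φ : V → V → V → V → ZMod 2}

lemma CrossingNumbers.exists_linked_triangles (hφ : CrossingNumbers f φ) {w : Fin 6 → V}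
    (hw : Function.Injective w) : ∃ σ : Fin 6 → Fin 6, Function.Injective σ ∧
      triSum (fun a b => triSum (φ a b) (w ∘ ![σ 3, σ 4, σ 5])) (w ∘ ![σ 0, σ 1, σ 2]) = 1 :=
  exists_linked_triangles_aux (K := fun a b c d => φ (w a) (w b) (w c) (w d))
    (fun _ _ _ _ => hφ.symm_left _ _ _ _) (fun _ _ _ _ => hφ.symm_right _ _ _ _)
    (fun _ _ _ _ => rfl)
    (hφ.vanKampen (fun i => w i.succ) (hw.comp (Fin.succ_injective 5))
      (fun a b c d => φ (w a.succ) (w b.succ) (w c.succ) (w d.succ) +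
        φ (w c.succ) (w d.succ) (w a.succ) (w b.succ)) fun _ _ _ _ _ _ _ _ _ => rfl)

/-- Many copies of the complete graph on six vertices contain a cycle which is linked with each of
`n` triangles. -/
lemma CrossingNumbers.exists_cycle_linked_triangles (hφ : CrossingNumbers f φ) {n : ℕ} {H : Type}
    [Fintype H] [Nontrivial H] (hH : n * 2 ^ n ≤ Fintype.card H) {w : H → Fin 6 → V}
    (hw : Function.Injective (Function.uncurry w)) :
    ∃ (Z : VertexCycle V) (X : Fin n → Fin 3 → V), Function.Injective (Function.uncurry X) ∧
      (∀ v ∈ Z.list, ∃ h i, v = w h i) ∧ (∀ i j, ∃ h k, X i j = w h k) ∧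
      (∀ i j, X i j ∉ Z.list) ∧ ∀ i, (Z.sum fun a b => triSum (φ a b) (X i)) = 1 := by
  have hw' : ∀ h, Function.Injective (w h) := fun h i j e => by simpa using @hw (h, i) (h, j) e
  choose σ hσ hlink using fun h => hφ.exists_linked_triangles (hw' h)
  let A : H → Fin 3 → V := fun h => w h ∘ ![σ h 0, σ h 1, σ h 2]
  let B : H → Fin 3 → V := fun h => w h ∘ ![σ h 3, σ h 4, σ h 5]
  have hA' : ∀ h, Function.Injective ![σ h 0, σ h 1, σ h 2] := fun h => by
    intro i j
    fin_cases i <;> fin_cases j <;> simp [(hσ h).eq_iff]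
  have hB' : ∀ h, Function.Injective ![σ h 3, σ h 4, σ h 5] := fun h => by
    intro i j
    fin_cases i <;> fin_cases j <;> simp [(hσ h).eq_iff]
  have hAB : ∀ h i j, ![σ h 0, σ h 1, σ h 2] i ≠ ![σ h 3, σ h 4, σ h 5] j := fun h i j => by
    fin_cases i <;> fin_cases j <;> simp [(hσ h).eq_iff]
  have hA : Function.Injective (Function.uncurry A) := by
    rintro ⟨h, i⟩ ⟨h', j⟩ e
    have := @hw (h, ![σ h 0, σ h 1, σ h 2] i) (h', ![σ h' 0, σ h' 1, σ h' 2] j) e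
    simp only [Prod.mk.injEq] at this
    obtain ⟨rfl, h2⟩ := this
    rw [hA' _ h2]
  have hB : Function.Injective (Function.uncurry B) := by
    rintro ⟨h, i⟩ ⟨h', j⟩ e
    have := @hw (h, ![σ h 3, σ h 4, σ h 5] i) (h', ![σ h' 3, σ h' 4, σ h' 5] j) e
    simp only [Prod.mk.injEq] at this
    obtain ⟨rfl, h2⟩ := this
    rw [hB' _ h2]
  -- The vector of `s` lists the linking of the target `B s` with all triangles `A h`. Its
  -- coordinate at `s` itself is 1, as both triangles come from the same copy.
  obtain ⟨T, -, hcard, hgood⟩ := exists_linearIndepOn_or_common (ι := H)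
    (b := fun s h => triSum (fun a b => triSum (φ a b) (B s)) (A h)) (η := id)
    (fun s => hlink s) (T := Finset.univ) hH
  obtain ⟨Z, hZ, hsum⟩ := exists_vertexCycle_sum_eq_one hA
    (fun s a b => by simp only [triSum, hφ.symm_left a b]) hgood
  let e := (Finset.equivFinOfCardEq hcard).symm
  refine ⟨Z, fun i => B (e i), ?_, fun v hv => ?_, fun i j => ⟨_, _, rfl⟩, fun i j hmem => ?_,
    fun i => hsum _ (e i).2⟩
  · rintro ⟨i, k⟩ ⟨j, l⟩ h
    have := @hB ((e i : H), k) ((e j : H), l) h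
    simpa [Subtype.val_inj] using this
  · obtain ⟨h, i, rfl⟩ := hZ v hv
    exact ⟨_, _, rfl⟩
  · obtain ⟨h, k, hk⟩ := hZ _ hmem
    have := @hw ((e i : H), ![σ (e i) 3, σ (e i) 4, σ (e i) 5] j) (h, ![σ h 0, σ h 1, σ h 2] k) hk
    simp only [Prod.mk.injEq] at this
    obtain ⟨rfl, h2⟩ := this
    exact hAB _ _ _ h2.symm

/-- A sufficiently large complete graph contains two families of `n` cycles, all of them disjoint,
such that each cycle of the first family is linked with each one of the second family. -/
lemma CrossingNumbers.exists_linked_families (hφ : CrossingNumbers f φ) {n : ℕ} {G H : Type}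
    [Fintype G] [Nontrivial G] [Fintype H] [Nontrivial H]
    (hG : familySize n n ≤ Fintype.card G) (hH : n * 2 ^ n ≤ Fintype.card H)
    {w : G → H → Fin 6 → V}
    (hw : Function.Injective fun p : G × H × Fin 6 => w p.1 p.2.1 p.2.2) :
    ∃ Z Y : Fin n → VertexCycle V, (∀ i j, i ≠ j → (Z i).list.Disjoint (Z j).list) ∧
      (∀ i j, i ≠ j → (Y i).list.Disjoint (Y j).list) ∧
      (∀ i j, (Z i).list.Disjoint (Y j).list) ∧ ∀ i j, cycleSum φ (Z i) (Y j) = 1 := by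
  have hw' : ∀ g, Function.Injective (Function.uncurry (w g)) := by
    rintro g ⟨h, i⟩ ⟨h', j⟩ e
    simpa using @hw (g, h, i) (g, h', j) e
  choose Z X hX hZw hXw hXZ hlink using fun g => hφ.exists_cycle_linked_triangles hH (hw' g)
  have hgroup : ∀ {g g' h h' i j}, w g h i = w g' h' j → g = g' := fun {g g' h h' i j} e =>
    congrArg Prod.fst (@hw (g, h, i) (g', h', j) e)
  have hX' : ∀ i, Function.Injective (Function.uncurry fun g => X g i) := by
    rintro i ⟨g, k⟩ ⟨g', l⟩ e
    simp only [Function.uncurry_apply_pair] at e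
    obtain ⟨h, p, hp⟩ := hXw g i k
    obtain ⟨h', p', hp'⟩ := hXw g' i l
    obtain rfl := hgroup (hp.symm.trans (e.trans hp'))
    simpa using @hX g (i, k) (i, l) e
  -- Now the cycles `Z g` are the targets and, for each fixed `i`, the triangles `X h i` with `h` in
  -- `G` form the ring. A single set `T` of `n` groups has to serve all `i`.
  obtain ⟨T, -, hcard, hgood⟩ := exists_forall_linearIndepOn_or_common (κ := Fin n) (ι := G)
    (b := fun i g h => triSum (fun p q => (Z g).sum fun a b => φ a b p q) (X h i)) (η := id)
    (fun i g => by rw [id, triSum_sum, hlink]) (k := n) Finset.univ Finset.univ (by simpa using hG)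
  choose Y hY hsum using fun i => exists_vertexCycle_sum_eq_one (hX' i)
    (fun s p q => by simp only [hφ.symm_right _ _ p q]) (hgood i (Finset.mem_univ i))
  let e := (Finset.equivFinOfCardEq hcard).symm
  refine ⟨fun i => Z (e i), Y, fun i j hij v hv hv' => ?_, fun i j hij v hv hv' => ?_,
    fun i j v hv hv' => ?_, fun i j => ?_⟩
  · obtain ⟨h, p, hp⟩ := hZw _ v hv
    obtain ⟨h', p', hp'⟩ := hZw _ v hv'
    exact hij (e.injective (Subtype.ext (hgroup (hp.symm.trans hp'))))
  · obtain ⟨g, k, rfl⟩ := hY i v hv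
    obtain ⟨g', l, e'⟩ := hY j _ hv'
    obtain ⟨h, p, hp⟩ := hXw g i k
    obtain ⟨h', p', hp'⟩ := hXw g' j l
    obtain rfl := hgroup (hp.symm.trans (e'.trans hp'))
    exact hij (congrArg Prod.fst (@hX g (i, k) (j, l) e'))
  · obtain ⟨h, p, hp⟩ := hZw _ v hv
    obtain ⟨g, k, rfl⟩ := hY j v hv'
    obtain ⟨h', p', hp'⟩ := hXw g j k
    obtain rfl := hgroup (hp'.symm.trans hp)
    exact hXZ _ _ _ hv
  · rw [cycleSum_eq_sum]
    exact hsum j _ (e i).2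

end

end SpatialGraph

end

theorem propositionT (n : ℕ) :
    ∃ (r : ℕ) (G : SimpleGraph (Fin r)),
      ∀ f : SpatialGraph.realization G → SpatialGraph.R3, Topology.IsEmbedding f →
        ∃ (k : ℕ) (L : Fin k → SpatialGraph.ClosedCurve),
          SpatialGraph.IsLink L ∧ (∀ i, Set.range (L i) ⊆ Set.range f) ∧
          (completeBipartiteGraph (Fin n) (Fin n)).IsContained
            (SpatialGraph.mod2LinkingPattern L) := by
  -- A ring needs at least two triangles; the bound 2 is only effective for `n = 0`.
  let M := max 2 (SpatialGraph.familySize n n)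
  let N := max 2 (n * 2 ^ n)
  have : Nontrivial (Fin M) := Fin.nontrivial_iff_two_le.2 (le_max_left _ _)
  have : Nontrivial (Fin N) := Fin.nontrivial_iff_two_le.2 (le_max_left _ _)
  let w := Fintype.equivFin (Fin M × Fin N × Fin 6)
  refine ⟨Fintype.card (Fin M × Fin N × Fin 6), ⊤, fun f hf => ?_⟩
  obtain ⟨φ, hφ⟩ := SpatialGraph.exists_crossingNumbers ⟨f, hf.continuous⟩ hf.injective
  obtain ⟨Z, Y, hZ, hY, hZY, hlink⟩ := hφ.exists_linked_families (n := n)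
    (G := Fin M) (H := Fin N) (by simp [M]) (by simp [N]) (w := fun g h i => w (g, h, i))
    fun p q e => w.injective e
  let c : Fin n ⊕ Fin n → SpatialGraph.VertexCycle (Fin _) := Sum.elim Z Y
  have hc : ∀ i j, i ≠ j → (c i).list.Disjoint (c j).list := by
    rintro (i | i) (j | j) hij
    · exact hZ i j fun h => hij (congrArg _ h)
    · exact hZY i j
    · exact (hZY j i).symm
    · exact hY i j fun h => hij (congrArg _ h)
  refine ⟨n + n, fun i => (c (finSumFinEquiv.symm i)).curve ⟨f, hf.continuous⟩,
    ⟨fun i x y h => ?_, fun i j hij => ?_⟩, fun i => ?_, ?_⟩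
  · exact (c _).point_injective (congrArg Subtype.val (hf.injective h))
  · refine Set.disjoint_left.2 ?_
    rintro _ ⟨x, rfl⟩ ⟨y, h⟩
    exact SpatialGraph.VertexCycle.point_ne_point
      (hc _ _ (finSumFinEquiv.symm.injective.ne hij)) x y
      (congrArg Subtype.val (hf.injective h)).symm
  · rintro _ ⟨x, rfl⟩
    exact ⟨_, rfl⟩
  · have hadj : ∀ i j, SpatialGraph.HasMod2LinkingNumber ((Z i).curve ⟨f, hf.continuous⟩)
        ((Y j).curve ⟨f, hf.continuous⟩) 1 := fun i j => hφ.linked _ _ (hZY i j) (hlink i j)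
    refine ⟨⟨⟨finSumFinEquiv, fun {a b} hab => ?_⟩, finSumFinEquiv.injective⟩⟩
    rw [SpatialGraph.mod2LinkingPattern, SimpleGraph.fromRel_adj]
    refine ⟨finSumFinEquiv.injective.ne hab.ne, ?_⟩
    simp only [Equiv.symm_apply_apply]
    rcases a with i | i <;> rcases b with j | j
    · simp at hab
    · exact Or.inl (hadj i j)
    · exact Or.inr (hadj j i)
    · simp at hab
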